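/- Let $p,q\ge 0$ be integers with $p-q\equiv 1 \pmod 4$ and $n=p+q\le 9$, and let $C\ell_{p,q}$ be the real Clifford algebra with orthonormal generators $e_1,\dots,e_n$, $e_i^2=1$ for $i\le p$ and $e_i^2=-1$ for $i>p$. For $i_1<\dots<i_s$ let $e_{i_1\cdots i_s}=e_{i_1}\cdots e_{i_s}$ be the basis monomials (the empty one is $1$), let $G_{p,q}$ be the group consisting of all $\pm$ basis monomials, acting on $C\ell_{p,q}$ by conjugation $x\mapsto gxg^{-1}$, and write $G_{p,q}(x)$ and $\mathcal O(x)$ for the stabilizer and the orbit of $x$. Let $\hat{\ }$ be the grade involution. The Radon–Hurwitz numbers $r_i$ ($i\in\mathbb Z$) are given by $r_0=0$, $r_1=1$, $r_2=r_3=2$, $r_4=\dots=r_7=3$, $r_{i+8}=r_i+4$. Put $k=q-r_{q-p}$. Let $\mathcal T=(e_{\underline i_1},\dots,e_{\underline i_k})$ be commuting basis monomials with square $1$ which generate a group of order $2^k$, let $\mathcal F=\{\prod_{j=1}^k\tfrac12(1+\varepsilon_j e_{\underline i_j}) : \varepsilon_j=\pm1\}$, and let $f\in\mathcal F$ be a primitive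 idempotent (nonzero, and not a sum of two nonzero mutually annihilating idempotents). Then: (1) $G_{p,q}(f)=G_{p,q}(\hat f)$. This is a normal subgroup of $G_{p,q}$, a $2$-group, and $|G_{p,q}(f)|=2^{2+p+r_{q-p}}$. (2) If $p-q\equiv1\pmod 8$ (real case), $G_{p,q}(f)$ is abelian, it is generated by $k+1$ distinct elements of order $2$, and $G_{p,q}(f)\cong(\mathbb Z_2)^{k+1}$. (3) If $p-q\equiv5\pmod 8$ (quaternionic case), $G_{p,q}(f)$ is not abelian, it is generated by $k+2$ distinct elements, three of order $4$ and $k-1$ of order $2$, and $G_{p,q}(f)\cong F_3\times(\mathbb Z_2)^{k-1}$, where $F_3=\langle e_1,e_2,e_3\rangle\subset C\ell_{0,3}$. (4) $m\,e_{\underline i_j}m^{-1}=e_{\underline i_j}$ for all $m\in G_{p,q}(f)$ and $j=1,\dots,k$. (5) The elements $J_\pm=\frac12(1\pm e_{1\cdots n})$ are central idempotents. The orbits $\mathcal O(f)$ and $\mathcal O(\hat f)$ are disjoint, each has $2^{k-1}$ elements, and their union is $\mathcal F$. The elements of one of the two orbits add up to $J_+$, those of the other to $J_-$. (6) In each row of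 the following two tables, the listed monomials are a family $\mathcal T$ as above, $f=\prod_{t\in\mathcal T}\frac12(1+t)$ is a primitive idempotent, and $G_{p,q}(f)$ is generated by the listed elements. Real case; $G_{p,q}(f)=\langle -1,\mathcal T\rangle$, and all these generators have order $2$: $C\ell_{2,1}$: $\mathcal T=e_1,e_{23}$; $C\ell_{3,2}$: $e_1,e_{24},e_{35}$; $C\ell_{0,7}$: $e_{123},e_{146},e_{345},e_{367}$; $C\ell_{4,3}$: $e_1,e_{25},e_{36},e_{47}$; $C\ell_{5,4}$: $e_1,e_{26},e_{37},e_{48},e_{59}$; $C\ell_{9,0}$ and $C\ell_{1,8}$: $e_1,e_{2345},e_{2367},e_{2389},e_{2468}$. Quaternionic case (orders of the generators in parentheses): $C\ell_{0,3}$: $\mathcal T=e_{123}$, $G_{0,3}(f)=\langle e_1,e_2,e_3\rangle$, $(4,4,4)$; $C\ell_{5,0}$: $e_1,e_{2345}$, $\langle e_1,e_{23},e_{24},e_{25}\rangle$, $(2,4,4,4)$; $C\ell_{1,4}$: $e_{15},e_{234}$, $\langle e_2,e_3,e_4,e_{15}\rangle$, $(4,4,4,2)$; $C\ell_{2,5}$: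 $e_{16},e_{27},e_{345}$, $\langle e_3,e_4,e_5,e_{16},e_{27}\rangle$, $(4,4,4,2,2)$; $C\ell_{6,1}$: $e_1,e_{67},e_{2345}$, $\langle e_1,e_{23},e_{24},e_{25},e_{67}\rangle$, $(2,4,4,4,2)$; $C\ell_{7,2}$: $e_1,e_{28},e_{39},e_{4567}$, $\langle e_1,e_{28},e_{39},e_{45},e_{56},e_{57}\rangle$, $(2,2,2,4,4,4)$; $C\ell_{3,6}$: $e_1,e_{24},e_{35},e_{6789}$, $\langle e_1,e_{24},e_{35},e_{67},e_{68},e_{69}\rangle$, $(2,2,2,4,4,4)$. -/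

import Mathlib

namespace CliffordVee

/-- The Radon-Hurwitz numbers `r_i`, `i ∈ ℤ` (`/` and `%` are Euclidean division on `ℤ`). -/
def radonHurwitz (i : ℤ) : ℤ :=
  4 * (i / 8) + (if i % 8 = 0 then 0 else if i % 8 = 1 then 1 else if i % 8 ≤ 3 then 2 else 3)

theorem radonHurwitz_add_eight (i : ℤ) : radonHurwitz (i + 8) = radonHurwitz i + 4 := by
  have h1 : (i + 8) / 8 = i / 8 + 1 := by omega
  have h2 : (i + 8) % 8 = i % 8 := by omega
  simp only [radonHurwitz, h1, h2]
  ring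

theorem radonHurwitz_initial :
    radonHurwitz 0 = 0 ∧ radonHurwitz 1 = 1 ∧ radonHurwitz 2 = 2 ∧ radonHurwitz 3 = 2 ∧
      radonHurwitz 4 = 3 ∧ radonHurwitz 5 = 3 ∧ radonHurwitz 6 = 3 ∧ radonHurwitz 7 = 3 := by
  decide

/-- The diagonal entries of the form of signature `(p, q)`: first `p` times `1`, then `q` times
`-1`. -/
def weight (p q : ℕ) (i : Fin (p + q)) : ℝ := if (i : ℕ) < p then 1 else -1

/-- The quadratic form `x₁² + ⋯ + x_p² - x_{p+1}² - ⋯ - x_{p+q}²`. -/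
noncomputable def form (p q : ℕ) : QuadraticForm ℝ (Fin (p + q) → ℝ) :=
  QuadraticMap.weightedSumSquares ℝ (weight p q)

/-- The real Clifford algebra `Cl_{p,q}`. -/
abbrev Cl (p q : ℕ) : Type := CliffordAlgebra (form p q)

/-- The orthonormal generators `e_i` of `Cl_{p,q}` (indexed from `0`). -/
noncomputable def gen (p q : ℕ) (i : Fin (p + q)) : Cl p q :=
  CliffordAlgebra.ι (form p q) (Pi.single i 1)

/-- The basis monomial `e_A = e_{i₁} ⋯ e_{iₛ}` for `A = {i₁ < ⋯ < iₛ}`; `e_∅ = 1`. -/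
noncomputable def mono (p q : ℕ) (A : Finset (Fin (p + q))) : Cl p q :=
  ((A.sort (· ≤ ·)).map (gen p q)).prod

section helper

variable {p q : ℕ}

theorem mono_empty : mono p q ∅ = 1 := by simp [mono]

theorem mono_insert {a : Fin (p + q)} {s : Finset (Fin (p + q))} (h : ∀ b ∈ s, a < b) :
    mono p q (insert a s) = gen p q a * mono p q s := by
  have ha : a ∉ s := fun hs => lt_irrefl _ (h a hs)
  unfold mono
  rw [Finset.sort_insert (· ≤ ·) (fun b hb => (h b hb).le) ha]
  simp

theorem gen_sq (i : Fin (p + q)) : gen p q i * gen p q i = 1 ∨ gen p q i * gen p q i = -1 := by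
  unfold gen
  rw [CliffordAlgebra.ι_sq_scalar]
  have h : form p q (Pi.single i 1) = weight p q i := by
    simp only [form, QuadraticMap.weightedSumSquares_apply]
    rw [Finset.sum_eq_single i]
    · simp
    · intro j _ hj
      simp [Pi.single_eq_of_ne hj]
    · simp
  rw [h]
  unfold weight
  split_ifs
  · left; simp
  · right; simp

theorem gen_swap {i j : Fin (p + q)} (hij : i ≠ j) :
    gen p q i * gen p q j = -(gen p q j * gen p q i) := by
  unfold gen
  apply CliffordAlgebra.ι_mul_ι_comm_of_isOrtho
  rw [QuadraticMap.isOrtho_def]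
  simp only [form, QuadraticMap.weightedSumSquares_apply, ← Finset.sum_add_distrib]
  refine Finset.sum_congr rfl fun l _ => ?_
  by_cases h1 : l = i
  · subst h1; simp [Pi.single_eq_of_ne hij]
  · simp [Pi.single_eq_of_ne h1]

theorem gen_mul_mono (i : Fin (p + q)) (s : Finset (Fin (p + q))) :
    gen p q i * mono p q s = mono p q (symmDiff {i} s) ∨
      gen p q i * mono p q s = -mono p q (symmDiff {i} s) := by
  induction s using Finset.induction_on_min with
  | empty =>
    left
    have h : symmDiff ({i} : Finset (Fin (p + q))) ∅ = insert i ∅ := by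
      ext x; simp [Finset.mem_symmDiff]
    rw [h, mono_insert (by simp)]
  | insert a s hs ih =>
    have ha : a ∉ s := fun h => lt_irrefl _ (hs a h)
    rcases lt_trichotomy i a with hlt | rfl | hgt
    · left
      have h : symmDiff {i} (insert a s) = insert i (insert a s) := by
        ext x
        simp only [Finset.mem_symmDiff, Finset.mem_singleton, Finset.mem_insert]
        have h2 : i ∉ s := fun h => lt_asymm hlt (hs i h)
        have h3 := hlt.ne
        grind
      rw [h, mono_insert (a := i)]
      intro b hb
      rcases Finset.mem_insert.1 hb with rfl | hb
      · exact hlt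
      · exact hlt.trans (hs b hb)
    · have h : symmDiff {i} (insert i s) = s := by
        ext x
        simp only [Finset.mem_symmDiff, Finset.mem_singleton, Finset.mem_insert]
        grind
      rw [h, mono_insert hs, ← mul_assoc]
      rcases gen_sq i with h | h <;> simp [h]
    · have h : symmDiff {i} (insert a s) = insert a (symmDiff {i} s) := by
        ext x
        simp only [Finset.mem_symmDiff, Finset.mem_singleton, Finset.mem_insert]
        have h3 := hgt.ne
        grind
      rw [h, mono_insert hs, mono_insert (a := a), ← mul_assoc, gen_swap hgt.ne', neg_mul,
        mul_assoc]
      · rcases ih with h | h <;> simp [h]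
      · intro b hb
        simp only [Finset.mem_symmDiff, Finset.mem_singleton] at hb
        rcases hb with ⟨rfl, _⟩ | ⟨hb, _⟩
        · exact hgt
        · exact hs b hb

theorem mono_mul_mono (s t : Finset (Fin (p + q))) :
    mono p q s * mono p q t = mono p q (symmDiff s t) ∨
      mono p q s * mono p q t = -mono p q (symmDiff s t) := by
  induction s using Finset.induction_on_min generalizing t with
  | empty =>
    left
    rw [mono_empty, one_mul, ← Finset.bot_eq_empty, bot_symmDiff]
  | insert a s hs ih =>
    have ha : a ∉ s := fun h => lt_irrefl _ (hs a h)
    have h : symmDiff (insert a s) t = symmDiff {a} (symmDiff s t) := by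
      rw [← symmDiff_assoc]
      congr 1
      ext x
      simp only [Finset.mem_symmDiff, Finset.mem_singleton, Finset.mem_insert]
      grind
    rw [mono_insert hs, mul_assoc, h]
    rcases ih t with h1 | h1 <;> rw [h1] <;>
      rcases gen_mul_mono a (symmDiff s t) with h2 | h2 <;> simp [h2]

end helper

/-- The Salingaros vee group `G_{p,q} = {± e_A}` inside the unit group of `Cl_{p,q}`. -/
noncomputable def veeGroup (p q : ℕ) : Subgroup (Cl p q)ˣ where
  carrier := {u | ∃ A : Finset (Fin (p + q)), (u : Cl p q) = mono p q A ∨ (u : Cl p q) = -mono p q A}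
  one_mem' := ⟨∅, Or.inl (by simp [mono_empty])⟩
  mul_mem' := by
    rintro a b ⟨A, hA⟩ ⟨B, hB⟩
    refine ⟨symmDiff A B, ?_⟩
    rw [Units.val_mul]
    rcases hA with hA | hA <;> rcases hB with hB | hB <;> rw [hA, hB] <;>
      rcases mono_mul_mono A B with h | h <;> simp [h]
  inv_mem' := by
    rintro a ⟨A, hA⟩
    have h1 : (a : Cl p q) * a = 1 ∨ (a : Cl p q) * a = -1 := by
      have h := mono_mul_mono A A
      rw [symmDiff_self, Finset.bot_eq_empty, mono_empty] at h
      rcases hA with hA | hA <;> rw [hA] <;> simpa using h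
    have h2 : ((a⁻¹ : (Cl p q)ˣ) : Cl p q) = a ∨ ((a⁻¹ : (Cl p q)ˣ) : Cl p q) = -a := by
      rcases h1 with h | h
      · left; exact Units.inv_eq_of_mul_eq_one_right h
      · right; exact Units.inv_eq_of_mul_eq_one_right (by simp [h])
    refine ⟨A, ?_⟩
    rcases hA with hA | hA <;> rcases h2 with h | h <;> rw [h, hA] <;> simp

/-- The conjugate `g x g⁻¹` of `x ∈ Cl_{p,q}` by `g ∈ G_{p,q}`. -/
noncomputable def conj {p q : ℕ} (g : veeGroup p q) (x : Cl p q) : Cl p q :=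
  ((g : (Cl p q)ˣ) : Cl p q) * x * (((g : (Cl p q)ˣ)⁻¹ : (Cl p q)ˣ) : Cl p q)

theorem conj_one {p q : ℕ} (x : Cl p q) : conj (1 : veeGroup p q) x = x := by
  simp [conj]

theorem conj_mul {p q : ℕ} (g h : veeGroup p q) (x : Cl p q) :
    conj (g * h) x = conj g (conj h x) := by
  simp [conj, mul_assoc]

/-- The stabilizer `G_{p,q}(f)` of `f` under the conjugate action of `G_{p,q}`. -/
noncomputable def stab {p q : ℕ} (f : Cl p q) : Subgroup (veeGroup p q) where
  carrier := {g | conj g f = f}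
  one_mem' := conj_one f
  mul_mem' := by
    intro a b ha hb
    simp only [Set.mem_ofPred_eq] at *
    rw [conj_mul, hb, ha]
  inv_mem' := by
    intro a ha
    simp only [Set.mem_ofPred_eq] at *
    conv_lhs => rw [← ha]
    rw [← conj_mul, inv_mul_cancel, conj_one]

/-- The orbit `O(f)` of `f` under the conjugate action of `G_{p,q}`. -/
def orbit {p q : ℕ} (f : Cl p q) : Set (Cl p q) := {x | ∃ g : veeGroup p q, x = conj g f}

/-- A primitive idempotent of a ring: a nonzero idempotent which is not a sum of two nonzero
mutually annihilating idempotents. -/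
def IsPrimitiveIdempotent {R : Type*} [Ring R] (f : R) : Prop :=
  f ≠ 0 ∧ f * f = f ∧
    ∀ a b : R, a * a = a → b * b = b → a * b = 0 → b * a = 0 → f = a + b → a = 0 ∨ b = 0

/-- The element `½(1 + ε₁ e_{T₁}) ⋯ ½(1 + ε_k e_{T_k})`. -/
noncomputable def idem {p q k : ℕ} (T : Fin k → Finset (Fin (p + q))) (ε : Fin k → ℤˣ) : Cl p q :=
  (List.ofFn fun i => (1 / 2 : ℝ) • (1 + (ε i : ℤ) • mono p q (T i))).prod

/-- `e_{T₁}, …, e_{T_k}` are commuting basis monomials with square `1` which generate a group of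
order `2 ^ k`, where `k = q - r_{q-p}`. -/
structure IsCommutingFamily {p q k : ℕ} (T : Fin k → Finset (Fin (p + q))) : Prop where
  length : (k : ℤ) = (q : ℤ) - radonHurwitz ((q : ℤ) - p)
  sq_eq_one : ∀ i, mono p q (T i) * mono p q (T i) = 1
  comm : ∀ i j, mono p q (T i) * mono p q (T j) = mono p q (T j) * mono p q (T i)
  card_closure :
    Nat.card (Subgroup.closure {u : (Cl p q)ˣ | ∃ i, (u : Cl p q) = mono p q (T i)}) = 2 ^ k

/-- The element `½(1 + s e_{1⋯n})`, `s = ±1`, `n = p + q`. -/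
noncomputable def centralIdem (p q : ℕ) (s : ℤˣ) : Cl p q :=
  (1 / 2 : ℝ) • (1 + (s : ℤ) • mono p q Finset.univ)

/-- The group `F₃ = ⟨e₁, e₂, e₃⟩` in `Cl_{0,3}`. -/
noncomputable def F3 : Subgroup (Cl 0 3)ˣ :=
  Subgroup.closure {u | ∃ i : Fin (0 + 3), (u : Cl 0 3) = gen 0 3 i}

/-- The set of indices given by a list of numbers between `1` and `n`: `[2, 3]` is the index set
of the monomial `e_{23}`. -/
def idx (n : ℕ) (l : List ℕ) : Finset (Fin n) := Finset.univ.filter fun i => (i : ℕ) + 1 ∈ l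

/-- A tabulated example: the signature `(p, q)`, the commuting monomials `e_{T₁}, …, e_{T_k}`
in the idempotent `f = ½(1 + e_{T₁}) ⋯ ½(1 + e_{T_k})`, and the generators of its stabilizer other
than `-1`, each with its order. -/
structure Row where
  p : ℕ
  q : ℕ
  T : List (List ℕ)
  gens : List (List ℕ × ℕ)

namespace Row

/-- The family of monomials of a row. -/
def family (r : Row) (i : Fin r.T.length) : Finset (Fin (r.p + r.q)) := idx (r.p + r.q) (r.T.get i)

/-- The idempotent of a row (all signs are plus). -/
noncomputable def f (r : Row) : Cl r.p r.q := idem r.family fun _ => 1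

end Row

/-- The real semisimple algebras; here `-1` is a further generator, of order `2`. -/
def realTable : List Row :=
  [⟨2, 1, [[1], [2, 3]], [([1], 2), ([2, 3], 2)]⟩,
   ⟨3, 2, [[1], [2, 4], [3, 5]], [([1], 2), ([2, 4], 2), ([3, 5], 2)]⟩,
   ⟨0, 7, [[1, 2, 3], [1, 4, 6], [3, 4, 5], [3, 6, 7]],
      [([1, 2, 3], 2), ([1, 4, 6], 2), ([3, 4, 5], 2), ([3, 6, 7], 2)]⟩,
   ⟨4, 3, [[1], [2, 5], [3, 6], [4, 7]],
      [([1], 2), ([2, 5], 2), ([3, 6], 2), ([4, 7], 2)]⟩,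
   ⟨5, 4, [[1], [2, 6], [3, 7], [4, 8], [5, 9]],
      [([1], 2), ([2, 6], 2), ([3, 7], 2), ([4, 8], 2), ([5, 9], 2)]⟩,
   ⟨9, 0, [[1], [2, 3, 4, 5], [2, 3, 6, 7], [2, 3, 8, 9], [2, 4, 6, 8]],
      [([1], 2), ([2, 3, 4, 5], 2), ([2, 3, 6, 7], 2), ([2, 3, 8, 9], 2), ([2, 4, 6, 8], 2)]⟩,
   ⟨1, 8, [[1], [2, 3, 4, 5], [2, 3, 6, 7], [2, 3, 8, 9], [2, 4, 6, 8]],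
      [([1], 2), ([2, 3, 4, 5], 2), ([2, 3, 6, 7], 2), ([2, 3, 8, 9], 2), ([2, 4, 6, 8], 2)]⟩]

/-- The quaternionic semisimple algebras. -/
def quaternionicTable : List Row :=
  [⟨0, 3, [[1, 2, 3]], [([1], 4), ([2], 4), ([3], 4)]⟩,
   ⟨5, 0, [[1], [2, 3, 4, 5]], [([1], 2), ([2, 3], 4), ([2, 4], 4), ([2, 5], 4)]⟩,
   ⟨1, 4, [[1, 5], [2, 3, 4]], [([2], 4), ([3], 4), ([4], 4), ([1, 5], 2)]⟩,
   ⟨2, 5, [[1, 6], [2, 7], [3, 4, 5]],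
      [([3], 4), ([4], 4), ([5], 4), ([1, 6], 2), ([2, 7], 2)]⟩,
   ⟨6, 1, [[1], [6, 7], [2, 3, 4, 5]],
      [([1], 2), ([2, 3], 4), ([2, 4], 4), ([2, 5], 4), ([6, 7], 2)]⟩,
   ⟨7, 2, [[1], [2, 8], [3, 9], [4, 5, 6, 7]],
      [([1], 2), ([2, 8], 2), ([3, 9], 2), ([4, 5], 4), ([5, 6], 4), ([5, 7], 4)]⟩,
   ⟨3, 6, [[1], [2, 4], [3, 5], [6, 7, 8, 9]],
      [([1], 2), ([2, 4], 2), ([3, 5], 2), ([6, 7], 4), ([6, 8], 4), ([6, 9], 4)]⟩]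

/-- All assertions about one primitive idempotent `f = idem T ε` of `Cl_{p,q}`, except those that
depend on `p - q mod 8`. -/
structure CommonConclusion {p q k : ℕ} (T : Fin k → Finset (Fin (p + q))) (ε : Fin k → ℤˣ) :
    Prop where
  stab_involute : stab (idem T ε) = stab (CliffordAlgebra.involute (idem T ε))
  normal : (stab (idem T ε)).Normal
  card : (Nat.card (stab (idem T ε)) : ℚ) = 2 ^ (2 + (p : ℤ) + radonHurwitz ((q : ℤ) - p))
  isPGroup : IsPGroup 2 (stab (idem T ε))
  pointwise : ∀ m ∈ stab (idem T ε), ∀ i, conj m (mono p q (T i)) = mono p q (T i)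
  central : ∀ s, IsIdempotentElem (centralIdem p q s) ∧
    centralIdem p q s ∈ Subalgebra.center ℝ (Cl p q)
  orbit_card : (orbit (idem T ε)).ncard = 2 ^ (k - 1) ∧
    (orbit (CliffordAlgebra.involute (idem T ε))).ncard = 2 ^ (k - 1)
  orbit_disjoint : Disjoint (orbit (idem T ε)) (orbit (CliffordAlgebra.involute (idem T ε)))
  orbit_union : orbit (idem T ε) ∪ orbit (CliffordAlgebra.involute (idem T ε)) =
    Set.range fun ε' : Fin k → ℤˣ => idem T ε'
  orbit_sum : ∃ s : ℤˣ, (∑ᶠ x ∈ orbit (idem T ε), x) = centralIdem p q s ∧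
    (∑ᶠ x ∈ orbit (CliffordAlgebra.involute (idem T ε)), x) = centralIdem p q (-s)

/-- The structure of the stabilizer `G` in the real case: `G` is abelian, generated by `k + 1`
distinct elements of order `2`, and isomorphic to `(ℤ/2)^(k+1)`. -/
structure RealConclusion (k : ℕ) (G : Type) [Group G] : Prop where
  abelian : ∀ a b : G, a * b = b * a
  generators : ∃ g : Fin (k + 1) → G, Function.Injective g ∧
    Subgroup.closure (Set.range g) = ⊤ ∧ ∀ i, orderOf (g i) = 2
  iso : Nonempty (G ≃* Multiplicative (Fin (k + 1) → ZMod 2))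

/-- The structure of the stabilizer `G` in the quaternionic case: `G` is not abelian, generated by
`k + 2` distinct elements, three of order `4` and the others of order `2`, and isomorphic to
`F₃ × (ℤ/2)^(k-1)`. -/
structure QuaternionicConclusion (k : ℕ) (G : Type) [Group G] : Prop where
  nonabelian : ¬ ∀ a b : G, a * b = b * a
  generators : ∃ g : Fin (k + 2) → G, Function.Injective g ∧
    Subgroup.closure (Set.range g) = ⊤ ∧ ∀ i, orderOf (g i) = if (i : ℕ) < 3 then 4 else 2
  iso : Nonempty (G ≃* F3 × Multiplicative (Fin (k - 1) → ZMod 2))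

end CliffordVee

open CliffordVee

namespace CliffordVee

open scoped symmDiff

variable {p q : ℕ}

/-! ### A faithful representation and the trace -/

-- Put ω = e_{1⋯n}; n is odd, so ω is central, and ω² = 1. Two sets of monomials control f: H
-- (`fixSet`), those with e_A f = ±f, and C (`commSet`), those commuting with every member of the
-- family. Conjugation by e_A only flips signs ε_i, and different sign patterns give mutually
-- annihilating idempotents. Hence the stabilizer of f is {±e_A : A ∈ C}. It does not see the signs,
-- so it is the same for the grade involute of f and for all conjugates of f, and is therefore
-- normal.
--
-- Everything else rests on the sizes of H and C, which satisfy two equations.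
--
-- First equation. Let tr be the coefficient of 1 and `adj` the anti-automorphism e_A ↦ e_A⁻¹; then
-- tr(adj x · y) is an inner product with orthonormal monomials. The self-adjoint idempotent f has
-- coefficients ±tr f on H and 0 elsewhere, so |H| tr f = 1. The sum of all monomial conjugates of f
-- lies in the span of 1 and ω; as ωf = sf, the orbit sum is a multiple of J_s. Both are nonzero
-- idempotents, so they agree (`sum_orbitFinset`), and comparing scalars gives |C||H| = 2^(n+1).
-- Hence the orbit has |H|/2 elements.
--
-- Second equation. The identity Σ e_A x e_A = σ adj x, with σ the sum of the signs e_A², gives at x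
-- = f that the signs over C also add up to σ (`sum_commSet_sqSign`). If f is primitive and A ∈ C
-- has e_A² = 1, then f = ½(1 + e_A)f + ½(1 − e_A)f forces A ∈ H. So 2|H| − |C| = σ. A computation
-- with Gaussian integers gives σ = 2^k in the real and −2^(k+1) in the quaternionic case. Therefore
-- |H| = 2^k, and |C| is 2^k or 2^(k+2).
--
-- Group structure. In the real case C = H and all its monomials have square 1. In the quaternionic
-- case the elements with gf = f form a central elementary abelian group of order 2^k without −1,
-- and two monomials of C independent modulo H generate a complementary quaternion group
-- (`nonempty_mulEquiv_quaternion_prod`). F₃ is the instance Cl_{0,3}.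
--
-- For the tables the counting is reversed: |H| ≥ 2^k and ω ∈ H imply that all A ∈ C of square 1 lie
-- in H, which makes f primitive (`isPrimitiveIdempotent_idem`). The rest is a finite check on bit
-- masks.

theorem weight_mul_self (i : Fin (p + q)) : weight p q i * weight p q i = 1 := by
  unfold weight; split_ifs <;> norm_num

theorem form_apply (v : Fin (p + q) → ℝ) : form p q v = ∑ i, weight p q i * (v i * v i) := by
  simp [form, QuadraticMap.weightedSumSquares_apply]

theorem gen_mul_self (i : Fin (p + q)) :
    gen p q i * gen p q i = algebraMap ℝ (Cl p q) (weight p q i) := by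
  unfold gen
  rw [CliffordAlgebra.ι_sq_scalar, form_apply, Finset.sum_eq_single i]
  · simp
  · intro j _ hj
    simp [Pi.single_eq_of_ne hj]
  · simp

/-- The sign with which `e_i` moves the coordinate of index `A`. -/
noncomputable def genSign (i : Fin (p + q)) (A : Finset (Fin (p + q))) : ℝ :=
  (-1) ^ (A.filter (· < i)).card * (if i ∈ A then weight p q i else 1)

/-- `A` and `{i} ∆ A` agree below `i` and exactly one of them contains `i`: the powers of `-1`
cancel and the weight occurs once. -/
theorem genSign_self (i : Fin (p + q)) (A : Finset (Fin (p + q))) :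
    genSign i A * genSign i ({i} ∆ A) = weight p q i := by
  have h1 : ({i} ∆ A).filter (· < i) = A.filter (· < i) := by
    ext x
    simp only [Finset.mem_filter, Finset.mem_symmDiff, Finset.mem_singleton]
    grind
  have h2 : i ∈ ({i} ∆ A) ↔ i ∉ A := by
    simp only [Finset.mem_symmDiff, Finset.mem_singleton]
    grind
  have h3 : ((-1 : ℝ) ^ (A.filter (· < i)).card) * ((-1) ^ (A.filter (· < i)).card) = 1 := by
    rw [← mul_pow]; norm_num
  unfold genSign
  rw [h1]
  simp only [h2]
  by_cases h : i ∈ A <;> simp only [h, not_true, not_false_iff, if_true, if_false] <;>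
    linear_combination weight p q i * h3

/-- Toggling `j` changes nothing at or below `i`, whereas toggling `i` changes the number of
elements below `j` by one. That one parity change is the sign. -/
theorem genSign_anticomm_of_lt {i j : Fin (p + q)} (hij : i < j) (A : Finset (Fin (p + q))) :
    genSign i A * genSign j ({i} ∆ A) = -(genSign j A * genSign i ({j} ∆ A)) := by
  have h1 : ({j} ∆ A).filter (· < i) = A.filter (· < i) := by
    ext x
    simp only [Finset.mem_filter, Finset.mem_symmDiff, Finset.mem_singleton]
    grind
  have h2 : ({i} ∆ A).filter (· < j) = {i} ∆ (A.filter (· < j)) := by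
    ext x
    simp only [Finset.mem_filter, Finset.mem_symmDiff, Finset.mem_singleton]
    grind
  have h3 : i ∈ ({j} ∆ A) ↔ i ∈ A := by
    simp only [Finset.mem_symmDiff, Finset.mem_singleton]
    grind
  have h4 : j ∈ ({i} ∆ A) ↔ j ∈ A := by
    simp only [Finset.mem_symmDiff, Finset.mem_singleton]
    grind
  have h5 : (-1 : ℝ) ^ ({i} ∆ (A.filter (· < j))).card = -(-1) ^ (A.filter (· < j)).card := by
    by_cases h : i ∈ A
    · have e : {i} ∆ (A.filter (· < j)) = (A.filter (· < j)).erase i := by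
        ext x
        simp only [Finset.mem_filter, Finset.mem_symmDiff, Finset.mem_singleton, Finset.mem_erase]
        grind
      rw [e, ← Finset.card_erase_add_one (show i ∈ A.filter (· < j) by simp [h, hij]), pow_succ]
      ring
    · have e : {i} ∆ (A.filter (· < j)) = insert i (A.filter (· < j)) := by
        ext x
        simp only [Finset.mem_filter, Finset.mem_symmDiff, Finset.mem_singleton, Finset.mem_insert]
        grind
      rw [e, Finset.card_insert_of_notMem (by simp [h]), pow_succ]
      ring
  unfold genSign
  rw [h1, h2, h5]
  simp only [h3, h4]
  ring

theorem genSign_anticomm {i j : Fin (p + q)} (hij : i ≠ j) (A : Finset (Fin (p + q))) :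
    genSign i A * genSign j ({i} ∆ A) = -(genSign j A * genSign i ({j} ∆ A)) := by
  rcases lt_or_gt_of_ne hij with h | h
  · exact genSign_anticomm_of_lt h A
  · rw [genSign_anticomm_of_lt h A, neg_neg]

/-- The operator by which `e_i` acts on functions of index sets. -/
noncomputable def genOp (i : Fin (p + q)) : Module.End ℝ (Finset (Fin (p + q)) → ℝ) where
  toFun φ A := genSign i A * φ ({i} ∆ A)
  map_add' φ ψ := by ext A; simp [mul_add]
  map_smul' c φ := by ext A; simp [mul_left_comm]

theorem genOp_apply (i : Fin (p + q)) (φ : Finset (Fin (p + q)) → ℝ) (A : Finset (Fin (p + q))) :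
    genOp i φ A = genSign i A * φ ({i} ∆ A) := rfl

theorem genOp_mul_self (i : Fin (p + q)) : genOp i * genOp i = weight p q i • 1 := by
  ext φ A
  simp only [Module.End.mul_apply, LinearMap.smul_apply, Module.End.one_apply,
    Pi.smul_apply, smul_eq_mul, genOp_apply, LinearMap.coe_comp, Function.comp_apply]
  rw [← mul_assoc, genSign_self, symmDiff_symmDiff_cancel_left]

theorem genOp_anticomm {i j : Fin (p + q)} (hij : i ≠ j) :
    genOp i * genOp j = -(genOp j * genOp i) := by
  ext φ A
  simp only [Module.End.mul_apply, LinearMap.neg_apply, Pi.neg_apply, genOp_apply,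
    LinearMap.coe_comp, Function.comp_apply]
  rw [← mul_assoc, ← mul_assoc, genSign_anticomm hij, symmDiff_left_comm]
  ring

/-- Adding the double sum to its transpose cancels the off-diagonal terms, so twice the sum is twice
the diagonal. This yields the Clifford relation for `rep`. -/
theorem sum_sum_eq_sum_diag {ι M : Type*} [Fintype ι] [DecidableEq ι] [AddCommGroup M] [Module ℝ M]
    (F : ι → ι → M) (h : ∀ i j, i ≠ j → F i j = -F j i) : ∑ i, ∑ j, F i j = ∑ i, F i i := by
  have h1 : ∑ i, ∑ j, F i j + ∑ i, ∑ j, F i j = ∑ i, F i i + ∑ i, F i i := by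
    nth_rewrite 2 [Finset.sum_comm]
    simp only [← Finset.sum_add_distrib]
    refine Finset.sum_congr rfl fun i _ => ?_
    rw [Finset.sum_eq_single i]
    · intro j _ hj
      rw [h i j hj.symm, neg_add_cancel]
    · simp
  rw [← two_smul ℝ, ← two_smul ℝ] at h1
  exact smul_right_injective M (two_ne_zero) h1

/-- `Cl_{p,q}` acting on functions of index sets. -/
noncomputable def rep : Cl p q →ₐ[ℝ] Module.End ℝ (Finset (Fin (p + q)) → ℝ) :=
  CliffordAlgebra.lift (form p q) ⟨∑ i, (LinearMap.proj i : (Fin (p + q) → ℝ) →ₗ[ℝ] ℝ).smulRight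
    (genOp i), by
    intro v
    simp only [LinearMap.sum_apply, LinearMap.smulRight_apply, LinearMap.proj_apply]
    rw [Finset.sum_mul_sum, sum_sum_eq_sum_diag, form_apply, map_sum]
    · refine Finset.sum_congr rfl fun i _ => ?_
      rw [smul_mul_smul_comm, genOp_mul_self, smul_smul, Algebra.algebraMap_eq_smul_one, mul_comm]
    · intro i j hij
      rw [smul_mul_smul_comm, smul_mul_smul_comm, genOp_anticomm hij, smul_neg, mul_comm]⟩

theorem rep_gen (i : Fin (p + q)) : rep (gen p q i) = genOp i := by
  unfold rep gen
  rw [CliffordAlgebra.lift_ι_apply]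
  simp only [LinearMap.sum_apply, LinearMap.smulRight_apply, LinearMap.proj_apply]
  rw [Finset.sum_eq_single i]
  · simp
  · intro j _ hj
    simp [Pi.single_eq_of_ne hj]
  · simp

/-- The normalized trace: the coefficient of `1` in the basis of monomials. -/
noncomputable def tr : Cl p q →ₗ[ℝ] ℝ :=
  (LinearMap.proj ∅ : (Finset (Fin (p + q)) → ℝ) →ₗ[ℝ] ℝ) ∘ₗ
    (LinearMap.applyₗ (Pi.single ∅ 1 : Finset (Fin (p + q)) → ℝ)) ∘ₗ
    (rep : Cl p q →ₐ[ℝ] _).toLinearMap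

theorem tr_apply (x : Cl p q) : tr x = rep x (Pi.single ∅ 1) ∅ := rfl

theorem tr_one : tr (1 : Cl p q) = 1 := by simp [tr_apply]

/-- Each `genOp a` moves supports by `{a} ∆ ·`, so `e_A` carries the point mass at `∅` to a function
supported at `A`. Hence the trace vanishes on nontrivial monomials. -/
theorem rep_mono_apply_eq_zero (A B : Finset (Fin (p + q))) (h : B ≠ A) :
    rep (mono p q A) (Pi.single ∅ 1) B = 0 := by
  induction A using Finset.induction_on_min generalizing B with
  | empty => simp [mono_empty, Pi.single_eq_of_ne h]
  | insert a s hs ih =>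
    have ha : a ∉ s := fun h => lt_irrefl _ (hs a h)
    rw [mono_insert hs, map_mul, Module.End.mul_apply, rep_gen, genOp_apply, ih, mul_zero]
    rintro rfl
    apply h
    have : insert a ({a} ∆ B) = {a} ∆ ({a} ∆ B) := by
      ext x
      simp only [Finset.mem_symmDiff, Finset.mem_singleton, Finset.mem_insert] at ha ⊢
      grind
    rw [this, symmDiff_symmDiff_cancel_left]

theorem tr_mono {A : Finset (Fin (p + q))} (h : A ≠ ∅) : tr (mono p q A) = 0 :=
  rep_mono_apply_eq_zero A ∅ h.symm

/-! ### Products of monomials -/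

/-- The sign of `e_A ^ 2`. -/
def sqSign (A : Finset (Fin (p + q))) : ℤˣ :=
  (-1) ^ (A.card.choose 2 + (A.filter fun i : Fin (p + q) => p ≤ (i : ℕ)).card)

/-- The sign in `e_A e_B = ± e_B e_A`. -/
def commSign {n : ℕ} (A B : Finset (Fin n)) : ℤˣ := (-1) ^ (A.card * B.card + (A ∩ B).card)

theorem commSign_comm {n : ℕ} (A B : Finset (Fin n)) : commSign A B = commSign B A := by
  unfold commSign; rw [mul_comm, Finset.inter_comm]

/-- `e_i` picks up a sign from every element of `A` other than `i`. -/
theorem gen_mul_mono_comm (i : Fin (p + q)) (A : Finset (Fin (p + q))) :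
    gen p q i * mono p q A = (commSign {i} A : ℤ) • (mono p q A * gen p q i) := by
  induction A using Finset.induction_on_min with
  | empty => simp [mono_empty, commSign]
  | insert a s hs ih =>
    have ha : a ∉ s := fun h => lt_irrefl _ (hs a h)
    rw [mono_insert hs, ← mul_assoc]
    by_cases hia : i = a
    · subst hia
      have e : commSign {i} (insert i s) = commSign {i} s := by
        unfold commSign
        rw [Finset.card_insert_of_notMem ha, Finset.singleton_inter_of_mem (by simp),
          Finset.singleton_inter_of_notMem ha]
        simp [pow_succ]
      conv_lhs => rw [mul_assoc, ih, mul_smul_comm, ← mul_assoc]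
      rw [e]
    · have e : commSign {i} (insert a s) = -commSign {i} s := by
        unfold commSign
        rw [Finset.card_insert_of_notMem ha]
        have : ({i} : Finset (Fin (p + q))) ∩ insert a s = {i} ∩ s := by
          ext x; simp only [Finset.mem_inter, Finset.mem_singleton, Finset.mem_insert]; grind
        rw [this]
        simp [pow_succ, pow_add]
      rw [e, gen_swap hia, neg_mul, mul_assoc, ih, mul_smul_comm, mul_assoc]
      simp

theorem commSign_insert {n : ℕ} {a : Fin n} {s : Finset (Fin n)} (h : a ∉ s)
    (B : Finset (Fin n)) : commSign (insert a s) B = commSign {a} B * commSign s B := by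
  unfold commSign
  rw [← pow_add, Finset.card_insert_of_notMem h]
  have : (insert a s ∩ B).card = ({a} ∩ B).card + (s ∩ B).card := by
    rw [← Finset.card_union_of_disjoint]
    · congr 1
      ext x; simp only [Finset.mem_inter, Finset.mem_singleton, Finset.mem_insert, Finset.mem_union]
      grind
    · rw [Finset.disjoint_left]
      intro x; simp only [Finset.mem_inter, Finset.mem_singleton]
      grind
  rw [this]
  congr 1
  simp only [Finset.card_singleton]
  ring

theorem mono_mul_mono_comm (A B : Finset (Fin (p + q))) :
    mono p q A * mono p q B = (commSign A B : ℤ) • (mono p q B * mono p q A) := by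
  induction A using Finset.induction_on_min with
  | empty => simp [mono_empty, commSign]
  | insert a s hs ih =>
    have ha : a ∉ s := fun h => lt_irrefl _ (hs a h)
    rw [mono_insert hs, mul_assoc, ih, commSign_insert ha, mul_smul_comm, ← mul_assoc,
      gen_mul_mono_comm, smul_mul_assoc, smul_smul, mul_assoc]
    rw [Units.val_mul, mul_comm]

/-- Moving the second `e_a` past `e_s` costs `(-1)^|s|`, which matches the growth of the binomial
coefficient from `|s|` to `|s| + 1`; the square of `e_a` accounts for the other summand. -/
theorem mono_mul_self (A : Finset (Fin (p + q))) :
    mono p q A * mono p q A = (sqSign A : ℤ) • 1 := by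
  induction A using Finset.induction_on_min with
  | empty => simp [mono_empty, sqSign]
  | insert a s hs ih =>
    have ha : a ∉ s := fun h => lt_irrefl _ (hs a h)
    have h1 : mono p q s * gen p q a = (commSign {a} s : ℤ) • (gen p q a * mono p q s) := by
      rw [gen_mul_mono_comm, smul_smul, ← Units.val_mul, Int.units_mul_self]
      simp
    have h2 : commSign {a} s = (-1) ^ s.card := by
      unfold commSign; rw [Finset.singleton_inter_of_notMem ha]; simp
    have h3 : gen p q a * gen p q a = (((-1) ^ (if p ≤ (a : ℕ) then 1 else 0) : ℤˣ) : ℤ) • 1 := by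
      rw [gen_mul_self]
      unfold weight
      by_cases h : (a : ℕ) < p
      · simp [h, not_le.2 h]
      · simp [h, not_lt.1 h]
    have h4 : sqSign (insert a s) =
        (-1) ^ s.card * (-1) ^ (if p ≤ (a : ℕ) then 1 else 0) * sqSign s := by
      unfold sqSign
      rw [← pow_add, ← pow_add, Finset.card_insert_of_notMem ha, Finset.filter_insert,
        Nat.choose_succ_succ' s.card 1, Nat.choose_one_right]
      congr 1
      split_ifs with h
      · rw [Finset.card_insert_of_notMem (by simp [ha])]; ring
      · ring
    rw [mono_insert hs, mul_assoc, ← mul_assoc _ (gen p q a), h1, h2, h4, smul_mul_assoc,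
      mul_smul_comm, mul_assoc, ih, mul_smul_comm, mul_one, mul_smul_comm, h3, smul_smul, smul_smul,
      ← Units.val_mul, ← Units.val_mul]
    rw [mul_right_comm]

theorem units_zsmul_self {M : Type*} [AddCommGroup M] (u : ℤˣ) (x : M) :
    (u : ℤ) • (u : ℤ) • x = x := by
  rw [smul_smul, ← Units.val_mul, Int.units_mul_self]; simp

/-- `e_A e_B = ± e_{A ∆ B}` with the sign as a unit. -/
theorem exists_mono_mul_mono (A B : Finset (Fin (p + q))) :
    ∃ u : ℤˣ, mono p q A * mono p q B = (u : ℤ) • mono p q (A ∆ B) := by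
  rcases mono_mul_mono A B with h | h
  · exact ⟨1, by simp [h]⟩
  · exact ⟨-1, by simp [h]⟩

theorem mono_singleton (i : Fin (p + q)) : mono p q {i} = gen p q i := by
  simp [mono]

/-! ### The anti-involution with `e_A ↦ e_A⁻¹` -/

/-- The reflection of `ℝ^{p,q}` in the negative definite part. -/
noncomputable def reflection (p q : ℕ) : form p q →qᵢ form p q where
  toFun v i := weight p q i * v i
  map_add' v w := by ext i; simp [mul_add]
  map_smul' c v := by ext i; simp [mul_left_comm]
  map_app' v := by
    simp only [form_apply]
    refine Finset.sum_congr rfl fun i _ => ?_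
    linear_combination weight p q i * v i * v i * weight_mul_self i

/-- The linear anti-automorphism of `Cl_{p,q}` with `e_i ↦ e_i⁻¹`. -/
noncomputable def adj : Cl p q →ₗ[ℝ] Cl p q :=
  CliffordAlgebra.reverse ∘ₗ (CliffordAlgebra.map (reflection p q)).toLinearMap

theorem adj_apply (x : Cl p q) :
    adj x = CliffordAlgebra.reverse (CliffordAlgebra.map (reflection p q) x) := rfl

theorem adj_mul (x y : Cl p q) : adj (x * y) = adj y * adj x := by
  simp [adj_apply, CliffordAlgebra.reverse.map_mul]

theorem adj_one : adj (1 : Cl p q) = 1 := by simp [adj_apply]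

theorem adj_gen (i : Fin (p + q)) : adj (gen p q i) = weight p q i • gen p q i := by
  rw [adj_apply, gen, CliffordAlgebra.map_apply_ι, CliffordAlgebra.reverse_ι, ← map_smul]
  congr 1
  ext j
  change weight p q j * _ = _
  by_cases h : j = i
  · subst h; simp
  · simp [Pi.single_eq_of_ne h]

theorem adj_mono_mul (A : Finset (Fin (p + q))) : adj (mono p q A) * mono p q A = 1 := by
  induction A using Finset.induction_on_min with
  | empty => simp [mono_empty, adj_one]
  | insert a s hs ih =>
    rw [mono_insert hs, adj_mul, mul_assoc, ← mul_assoc _ (gen p q a), adj_gen, smul_mul_assoc,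
      gen_mul_self, Algebra.algebraMap_eq_smul_one, smul_smul, weight_mul_self, one_smul, one_mul,
      ih]

theorem adj_mono (A : Finset (Fin (p + q))) :
    adj (mono p q A) = (sqSign A : ℤ) • mono p q A := by
  have h := congrArg (fun x => (sqSign A : ℤ) • (x * mono p q A)) (adj_mono_mul A)
  simp only [mul_assoc, mono_mul_self, one_mul, mul_smul_comm, mul_one] at h
  rwa [units_zsmul_self] at h

theorem mono_mul_adj (A : Finset (Fin (p + q))) : mono p q A * adj (mono p q A) = 1 := by
  rw [adj_mono, mul_smul_comm, mono_mul_self, units_zsmul_self]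

theorem mono_ne_zero (A : Finset (Fin (p + q))) : mono p q A ≠ 0 := by
  intro h
  have := congrArg tr (adj_mono_mul A)
  rw [h, mul_zero, tr_one, map_zero] at this
  exact zero_ne_one this

theorem one_ne_zero_cl : (1 : Cl p q) ≠ 0 := by
  rw [← mono_empty]; exact mono_ne_zero _

/-- Orthonormality of the monomials; coefficients, their independence and positivity are read off
from it. -/
theorem tr_adj_mono_mul (A B : Finset (Fin (p + q))) :
    tr (adj (mono p q A) * mono p q B) = if A = B then 1 else 0 := by
  split_ifs with h
  · rw [h, adj_mono_mul, tr_one]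
  · obtain ⟨u, hu⟩ := exists_mono_mul_mono A B
    rw [adj_mono, smul_mul_assoc, hu, map_zsmul, map_zsmul, tr_mono]
    · simp
    · intro h0
      exact h (symmDiff_eq_bot.1 h0)

theorem span_mono : Submodule.span ℝ (Set.range (mono p q)) = ⊤ := by
  rw [eq_top_iff]
  intro x _
  induction x using CliffordAlgebra.left_induction with
  | algebraMap r =>
    rw [Algebra.algebraMap_eq_smul_one]
    exact Submodule.smul_mem _ _ (Submodule.subset_span ⟨∅, mono_empty⟩)
  | add x y hx hy => exact Submodule.add_mem _ (hx trivial) (hy trivial)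
  | ι_mul x v hx =>
    have hv : CliffordAlgebra.ι (form p q) v = ∑ i, v i • gen p q i := by
      conv_lhs => rw [pi_eq_sum_univ' v]
      rw [map_sum]
      refine Finset.sum_congr rfl fun i _ => ?_
      rw [map_smul]; rfl
    have key : ∀ y ∈ Submodule.span ℝ (Set.range (mono p q)), ∀ i,
        gen p q i * y ∈ Submodule.span ℝ (Set.range (mono p q)) := by
      intro y hy i
      induction hy using Submodule.span_induction with
      | mem y hy =>
        obtain ⟨A, rfl⟩ := hy
        rcases gen_mul_mono i A with h | h <;> rw [h]
        · exact Submodule.subset_span ⟨_, rfl⟩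
        · exact Submodule.neg_mem _ (Submodule.subset_span ⟨_, rfl⟩)
      | zero => simp
      | add y z _ _ hy hz => rw [mul_add]; exact Submodule.add_mem _ hy hz
      | smul c y _ hy => rw [mul_smul_comm]; exact Submodule.smul_mem _ _ hy
    rw [hv, Finset.sum_mul]
    refine Submodule.sum_mem _ fun i _ => ?_
    rw [smul_mul_assoc]
    exact Submodule.smul_mem _ _ (key x (hx trivial) i)

theorem linearMap_ext_mono {M : Type*} [AddCommGroup M] [Module ℝ M] {f g : Cl p q →ₗ[ℝ] M}
    (h : ∀ A, f (mono p q A) = g (mono p q A)) : f = g :=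
  LinearMap.ext_on_range span_mono h

/-- The coefficient of `e_A`. -/
noncomputable def coef (A : Finset (Fin (p + q))) : Cl p q →ₗ[ℝ] ℝ :=
  tr ∘ₗ LinearMap.mulLeft ℝ (adj (mono p q A))

theorem coef_apply (A : Finset (Fin (p + q))) (x : Cl p q) :
    coef A x = tr (adj (mono p q A) * x) := rfl

theorem coef_mono (A B : Finset (Fin (p + q))) : coef A (mono p q B) = if A = B then 1 else 0 :=
  tr_adj_mono_mul A B

theorem coef_empty (x : Cl p q) : coef ∅ x = tr x := by
  rw [coef_apply, mono_empty, adj_one, one_mul]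

theorem sum_coef (x : Cl p q) : ∑ A, coef A x • mono p q A = x := by
  have : ∑ A, (coef A).smulRight (mono p q A) = (LinearMap.id : Cl p q →ₗ[ℝ] Cl p q) := by
    apply linearMap_ext_mono
    intro B
    simp [LinearMap.sum_apply, coef_mono]
  simpa [LinearMap.sum_apply] using congrArg (fun f => f x) this

theorem adj_adj (x : Cl p q) : adj (adj x) = x := by
  have : adj ∘ₗ adj = (LinearMap.id : Cl p q →ₗ[ℝ] Cl p q) := by
    apply linearMap_ext_mono
    intro B
    rw [LinearMap.comp_apply, adj_mono, map_zsmul, adj_mono, units_zsmul_self]; rfl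
  exact congrArg (fun f => f x) this

theorem tr_adj_mul_self (x : Cl p q) : tr (adj x * x) = ∑ A, coef A x ^ 2 := by
  have h : adj x = ∑ A, coef A x • adj (mono p q A) := by
    conv_lhs => rw [← sum_coef x, map_sum]
    simp only [map_smul]
  rw [h, Finset.sum_mul, map_sum]
  refine Finset.sum_congr rfl fun A _ => ?_
  rw [smul_mul_assoc, map_smul, smul_eq_mul, sq, coef_apply]

theorem tr_adj_mul_self_nonneg (x : Cl p q) : 0 ≤ tr (adj x * x) := by
  rw [tr_adj_mul_self]; positivity

/-- The form is definite in every signature, because `adj` absorbs the signs of the generators and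
leaves a sum of squares of coefficients. -/
theorem eq_zero_of_tr_adj_mul_self {x : Cl p q} (h : tr (adj x * x) = 0) : x = 0 := by
  rw [tr_adj_mul_self, Finset.sum_eq_zero_iff_of_nonneg (fun _ _ => by positivity)] at h
  rw [← sum_coef x]
  refine Finset.sum_eq_zero fun A hA => ?_
  rw [pow_eq_zero_iff (by norm_num : (2 : ℕ) ≠ 0) |>.1 (h A hA), zero_smul]

theorem mono_injective_up_to_sign {A B : Finset (Fin (p + q))} {u v : ℤˣ}
    (h : (u : ℤ) • mono p q A = (v : ℤ) • mono p q B) : A = B ∧ u = v := by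
  have h1 := congrArg (coef A) h
  simp only [map_zsmul, coef_mono, if_true] at h1
  by_cases hAB : A = B
  · refine ⟨hAB, ?_⟩
    simp only [hAB, if_true, zsmul_eq_mul, mul_one] at h1
    exact Units.ext (by exact_mod_cast h1)
  · exfalso
    simp only [hAB, if_false, smul_zero, zsmul_eq_mul, mul_one] at h1
    rcases Int.units_eq_one_or u with rfl | rfl <;> simp at h1

/-! ### Signs -/

theorem neg_one_pow_card_symmDiff {α : Type*} [DecidableEq α] (A B : Finset α) :
    (-1 : ℤˣ) ^ (A ∆ B).card = (-1) ^ A.card * (-1) ^ B.card := by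
  have h1 : (A ∆ B).card = (A \ B).card + (B \ A).card :=
    Finset.card_union_of_disjoint disjoint_sdiff_sdiff
  have h2 := Finset.card_sdiff_add_card_inter A B
  have h3 := Finset.card_sdiff_add_card_inter B A
  rw [Finset.inter_comm B A] at h3
  rw [← pow_add, ← h2, ← h3, h1, show (A \ B).card + (A ∩ B).card + ((B \ A).card + (A ∩ B).card) =
    (A \ B).card + (B \ A).card + 2 * (A ∩ B).card by ring, pow_add _ _ (2 * _), pow_mul]
  simp

/-- The parity of the cardinality is a character for `∆`, and intersection distributes over `∆`. -/
theorem commSign_symmDiff {n : ℕ} (A A' B : Finset (Fin n)) :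
    commSign (A ∆ A') B = commSign A B * commSign A' B := by
  unfold commSign
  rw [pow_add, pow_add, pow_add, pow_mul, pow_mul, pow_mul, neg_one_pow_card_symmDiff, mul_pow,
    show (A ∆ A') ∩ B = (A ∩ B) ∆ (A' ∩ B) from inf_symmDiff_distrib_right A A' B,
    neg_one_pow_card_symmDiff]
  exact mul_mul_mul_comm _ _ _ _

theorem commSign_univ {n : ℕ} (hn : Odd n) (A : Finset (Fin n)) : commSign A Finset.univ = 1 := by
  unfold commSign
  rw [Finset.card_univ, Fintype.card_fin, Finset.inter_univ]
  apply Even.neg_one_pow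
  have : Even (A.card * (n + 1)) := (hn.add_one).mul_left _
  rwa [mul_add, mul_one] at this

theorem commSign_empty {n : ℕ} (A : Finset (Fin n)) : commSign A ∅ = 1 := by
  simp [commSign]

/-- For one index the exponent is `|B|` plus `1` if `i ∈ B`. So `i` is taken inside `B` when `|B|`
is even, outside when it is odd. -/
theorem exists_commSign_eq_neg_one {n : ℕ} {B : Finset (Fin n)} (h0 : B ≠ ∅)
    (h1 : B ≠ Finset.univ) : ∃ i, commSign {i} B = -1 := by
  rcases Nat.even_or_odd B.card with h | h
  · obtain ⟨i, hi⟩ := Finset.nonempty_iff_ne_empty.2 h0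
    refine ⟨i, ?_⟩
    unfold commSign
    rw [Finset.singleton_inter_of_mem hi]
    simp only [Finset.card_singleton, one_mul]
    exact (h.add_one).neg_one_pow
  · have : ∃ i, i ∉ B := by
      by_contra hc; push Not at hc
      exact h1 (Finset.eq_univ_of_forall hc)
    obtain ⟨i, hi⟩ := this
    refine ⟨i, ?_⟩
    unfold commSign
    rw [Finset.singleton_inter_of_notMem hi]
    simp only [Finset.card_singleton, one_mul, Finset.card_empty, add_zero]
    exact h.neg_one_pow

/-- A character sum: if `e_i` anticommutes with `e_B`, the involution `A ↦ {i} ∆ A` reverses every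
term. -/
theorem sum_commSign_eq_zero {n : ℕ} {B : Finset (Fin n)} (h0 : B ≠ ∅) (h1 : B ≠ Finset.univ) :
    ∑ A, (commSign A B : ℤ) = 0 := by
  obtain ⟨i, hi⟩ := exists_commSign_eq_neg_one h0 h1
  have h : ∑ A, (commSign ({i} ∆ A) B : ℤ) = ∑ A, (commSign A B : ℤ) :=
    Equiv.sum_comp (Function.Involutive.toPerm (fun A : Finset (Fin n) => {i} ∆ A)
      fun A => symmDiff_symmDiff_cancel_left {i} A) fun A => (commSign A B : ℤ)
  simp only [commSign_symmDiff, hi] at h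
  simp only [neg_mul, one_mul, Units.val_neg, Finset.sum_neg_distrib] at h
  omega

/-! ### Averages over the monomials -/

/-- Conjugation by `e_A`. -/
noncomputable def monoConj (A : Finset (Fin (p + q))) : Cl p q →ₗ[ℝ] Cl p q :=
  LinearMap.mulRight ℝ (adj (mono p q A)) ∘ₗ LinearMap.mulLeft ℝ (mono p q A)

theorem monoConj_apply (A : Finset (Fin (p + q))) (x : Cl p q) :
    monoConj A x = mono p q A * x * adj (mono p q A) := rfl

theorem monoConj_mono (A B : Finset (Fin (p + q))) :
    monoConj A (mono p q B) = (commSign A B : ℤ) • mono p q B := by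
  rw [monoConj_apply, mono_mul_mono_comm, smul_mul_assoc, mul_assoc, mono_mul_adj, mul_one]

theorem monoConj_mul (A : Finset (Fin (p + q))) (x y : Cl p q) :
    monoConj A (x * y) = monoConj A x * monoConj A y := by
  simp only [monoConj_apply]
  rw [mul_assoc (mono p q A * x), ← mul_assoc (adj (mono p q A)),
    ← mul_assoc (adj (mono p q A)), adj_mono_mul, one_mul]
  simp only [mul_assoc]

theorem monoConj_one (A : Finset (Fin (p + q))) : monoConj A (1 : Cl p q) = 1 := by
  rw [monoConj_apply, mul_one, mono_mul_adj]

/-- On `e_B` this is the character sum over `A` of `commSign A B`, which vanishes unless `e_B` is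
central; for odd `n` only `1` and `e_{1⋯n}` remain. -/
theorem sum_monoConj (hn : Odd (p + q)) (x : Cl p q) : ∑ A, monoConj A x =
    (2 ^ (p + q) : ℝ) • (tr x • 1 + coef Finset.univ x • mono p q Finset.univ) := by
  have hne : (Finset.univ : Finset (Fin (p + q))) ≠ ∅ := by
    have := hn.pos
    rw [← Finset.nonempty_iff_ne_empty]
    exact ⟨⟨0, this⟩, Finset.mem_univ _⟩
  have : ∑ A, monoConj A = (2 ^ (p + q) : ℝ) • ((tr : Cl p q →ₗ[ℝ] ℝ).smulRight 1 +
      (coef Finset.univ).smulRight (mono p q Finset.univ)) := by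
    apply linearMap_ext_mono
    intro B
    simp only [LinearMap.sum_apply, monoConj_mono, LinearMap.smul_apply, LinearMap.add_apply,
      LinearMap.smulRight_apply]
    rw [← Finset.sum_smul]
    by_cases h0 : B = ∅
    · subst h0
      rw [coef_mono, if_neg hne, mono_empty, tr_one]
      simp [commSign_empty, ← Int.cast_smul_eq_zsmul ℝ]
    by_cases h1 : B = Finset.univ
    · subst h1
      rw [coef_mono, if_pos rfl, tr_mono h0]
      simp [commSign_univ hn, ← Int.cast_smul_eq_zsmul ℝ]
    · rw [sum_commSign_eq_zero h0 h1, coef_mono, if_neg (Ne.symm h1), tr_mono h0]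
      simp
  simpa [LinearMap.sum_apply] using congrArg (fun f => f x) this

/-- The sum of the squares of the basis monomials. -/
def sqSum (p q : ℕ) : ℤ := ∑ A : Finset (Fin (p + q)), (sqSign A : ℤ)

/-- Multiply `(e_A e_B)² = ±1` on the right by `e_B⁻¹ = adj e_B`. -/
theorem mono_mul_mono_mul_mono (A B : Finset (Fin (p + q))) :
    mono p q A * mono p q B * mono p q A = (sqSign (A ∆ B) : ℤ) • adj (mono p q B) := by
  obtain ⟨u, hu⟩ := exists_mono_mul_mono A B
  have h : mono p q A * mono p q B * (mono p q A * mono p q B) = (sqSign (A ∆ B) : ℤ) • 1 := by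
    rw [hu, smul_mul_smul_comm, mono_mul_self, ← Units.val_mul, Int.units_mul_self]; simp
  calc _ = mono p q A * mono p q B * (mono p q A * mono p q B) * adj (mono p q B) := by
        rw [mul_assoc _ _ (adj _), mul_assoc (mono p q A) _ (adj _), mono_mul_adj, mul_one]
    _ = _ := by rw [h, smul_mul_assoc, one_mul]

/-- For fixed `B` the set `A ∆ B` runs through all index sets along with `A`, so every `e_B`
receives the same total sign. -/
theorem sum_mono_mul_mul_mono (x : Cl p q) :
    ∑ A, mono p q A * x * mono p q A = sqSum p q • adj x := by
  have : ∑ A, LinearMap.mulRight ℝ (mono p q A) ∘ₗ LinearMap.mulLeft ℝ (mono p q A) =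
      sqSum p q • adj := by
    apply linearMap_ext_mono
    intro B
    simp only [LinearMap.sum_apply, LinearMap.comp_apply, LinearMap.mulLeft_apply,
      LinearMap.mulRight_apply, mono_mul_mono_mul_mono, LinearMap.smul_apply]
    rw [← Finset.sum_smul, sqSum]
    congr 1
    exact Fintype.sum_bijective (fun A => A ∆ B)
      (Function.Involutive.bijective fun A => symmDiff_symmDiff_cancel_right B A) _ _ fun A => rfl
  simpa [LinearMap.sum_apply] using congrArg (fun f => f x) this

theorem involute_gen (i : Fin (p + q)) : CliffordAlgebra.involute (gen p q i) = -gen p q i := by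
  unfold gen; rw [CliffordAlgebra.involute_ι]

theorem involute_mono (A : Finset (Fin (p + q))) :
    CliffordAlgebra.involute (mono p q A) = (((-1) ^ A.card : ℤˣ) : ℤ) • mono p q A := by
  induction A using Finset.induction_on_min with
  | empty => simp [mono_empty]
  | insert a s hs ih =>
    have ha : a ∉ s := fun h => lt_irrefl _ (hs a h)
    rw [mono_insert hs, map_mul, ih, involute_gen, Finset.card_insert_of_notMem ha, pow_succ,
      mul_smul_comm]
    simp

theorem mono_univ_central (hn : Odd (p + q)) (x : Cl p q) :
    mono p q Finset.univ * x = x * mono p q Finset.univ := by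
  have : LinearMap.mulLeft ℝ (mono p q Finset.univ) = LinearMap.mulRight ℝ (mono p q Finset.univ) := by
    apply linearMap_ext_mono
    intro B
    rw [LinearMap.mulLeft_apply, LinearMap.mulRight_apply, mono_mul_mono_comm, commSign_comm,
      commSign_univ hn]
    simp
  exact congrArg (fun f => f x) this

theorem eq_zero_of_eq_neg {M : Type*} [AddCommGroup M] [Module ℝ M] {x : M} (h : x = -x) :
    x = 0 := by
  have h1 : (2 : ℝ) • x = 0 := by rw [two_smul]; nth_rewrite 1 [h]; exact neg_add_cancel x
  exact (smul_eq_zero.1 h1).resolve_left two_ne_zero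

/-! ### Products of commuting idempotents -/

theorem list_prod_mul_eq {R : Type*} [Monoid R] {l : List R} {y : R} (h : ∀ x ∈ l, x * y = y) :
    l.prod * y = y := by
  induction l with
  | nil => simp
  | cons a l ih =>
    rw [List.prod_cons, mul_assoc, ih fun x hx => h x (List.mem_cons_of_mem _ hx)]
    exact h a List.mem_cons_self

theorem mul_list_prod_eq {R : Type*} [Monoid R] {l : List R} (hi : ∀ x ∈ l, x * x = x)
    (hc : ∀ x ∈ l, ∀ y ∈ l, x * y = y * x) : ∀ x ∈ l, x * l.prod = l.prod := by
  induction l with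
  | nil => simp
  | cons a l ih =>
    intro x hx
    rw [List.prod_cons, ← mul_assoc]
    rcases List.mem_cons.1 hx with rfl | hx'
    · rw [hi x hx]
    · rw [hc x hx a List.mem_cons_self, mul_assoc]
      rw [ih (fun y hy => hi y (List.mem_cons_of_mem _ hy)) (fun y hy z hz =>
        hc y (List.mem_cons_of_mem _ hy) z (List.mem_cons_of_mem _ hz)) x hx']

theorem adj_list_prod {l : List (Cl p q)} (ha : ∀ x ∈ l, adj x = x)
    (hc : ∀ x ∈ l, ∀ y ∈ l, x * y = y * x) : adj l.prod = l.prod := by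
  induction l with
  | nil => simp [adj_one]
  | cons a l ih =>
    rw [List.prod_cons, adj_mul, ha a List.mem_cons_self,
      ih (fun y hy => ha y (List.mem_cons_of_mem _ hy)) (fun y hy z hz =>
        hc y (List.mem_cons_of_mem _ hy) z (List.mem_cons_of_mem _ hz))]
    exact (Commute.list_prod_right l a fun y hy =>
      hc a List.mem_cons_self y (List.mem_cons_of_mem _ hy)).symm

theorem monoConj_list_prod (A : Finset (Fin (p + q))) (l : List (Cl p q)) :
    monoConj A l.prod = (l.map (monoConj A)).prod := by
  induction l with
  | nil => simp [monoConj_one]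
  | cons a l ih => rw [List.prod_cons, monoConj_mul, ih, List.map_cons, List.prod_cons]

/-! ### The idempotents of a commuting family -/

/-- The monomials `e_{T_i}` commute and have square `1`. -/
structure Admissible {p q k : ℕ} (T : Fin k → Finset (Fin (p + q))) : Prop where
  sq : ∀ i, sqSign (T i) = 1
  comm : ∀ i j, commSign (T i) (T j) = 1

variable {k : ℕ} {T : Fin k → Finset (Fin (p + q))} {ε : Fin k → ℤˣ}

theorem IsCommutingFamily.admissible (h : IsCommutingFamily T) : Admissible T where
  sq i := by
    have h1 := h.sq_eq_one i
    rw [mono_mul_self, ← mono_empty] at h1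
    exact (mono_injective_up_to_sign (v := 1) (by simpa using h1)).2
  comm i j := by
    have h1 := h.comm i j
    rw [mono_mul_mono_comm] at h1
    obtain ⟨u, hu⟩ := exists_mono_mul_mono (T j) (T i)
    rw [hu, smul_smul, ← Units.val_mul] at h1
    exact mul_eq_right.1 (mono_injective_up_to_sign h1).2

/-- The factor `½(1 + ε e_A)`. -/
noncomputable def halfSum (A : Finset (Fin (p + q))) (u : ℤˣ) : Cl p q :=
  (1 / 2 : ℝ) • (1 + (u : ℤ) • mono p q A)

theorem idem_eq (T : Fin k → Finset (Fin (p + q))) (ε : Fin k → ℤˣ) :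
    idem T ε = (List.ofFn fun i => halfSum (T i) (ε i)).prod := rfl

theorem mono_mul_halfSum {A : Finset (Fin (p + q))} (hA : sqSign A = 1) (u : ℤˣ) :
    mono p q A * halfSum A u = (u : ℤ) • halfSum A u := by
  unfold halfSum
  rw [mul_smul_comm, smul_comm (u : ℤ), mul_add, smul_add (u : ℤ), units_zsmul_self, mul_one,
    mul_smul_comm, mono_mul_self, hA, Units.val_one, one_smul, add_comm (mono p q A)]

theorem halfSum_mul_self {A : Finset (Fin (p + q))} (hA : sqSign A = 1) (u : ℤˣ) :
    halfSum A u * halfSum A u = halfSum A u := by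
  conv_lhs => enter [1]; unfold halfSum
  rw [smul_mul_assoc, add_mul, one_mul, smul_mul_assoc, mono_mul_halfSum hA, units_zsmul_self,
    ← two_smul ℝ, smul_smul]
  norm_num

theorem halfSum_comm {A B : Finset (Fin (p + q))} (h : commSign A B = 1) (u v : ℤˣ) :
    halfSum A u * halfSum B v = halfSum B v * halfSum A u := by
  have h1 : Commute (mono p q A) (mono p q B) := by
    have := mono_mul_mono_comm (p := p) (q := q) A B
    rw [h] at this
    rw [commute_iff_eq]; simpa using this
  unfold halfSum
  exact (((Commute.one_left _).add_left ((((Commute.one_right _).add_right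
    (h1.smul_right _)).smul_left _))).smul_left _).smul_right _

theorem adj_halfSum {A : Finset (Fin (p + q))} (hA : sqSign A = 1) (u : ℤˣ) :
    adj (halfSum A u) = halfSum A u := by
  unfold halfSum
  rw [map_smul, map_add, adj_one, map_zsmul, adj_mono, hA, Units.val_one, one_smul]

theorem monoConj_halfSum (A B : Finset (Fin (p + q))) (u : ℤˣ) :
    monoConj A (halfSum B u) = halfSum B (u * commSign A B) := by
  unfold halfSum
  rw [map_smul, map_add, monoConj_one, map_zsmul, monoConj_mono, smul_smul, Units.val_mul]

theorem involute_halfSum (A : Finset (Fin (p + q))) (u : ℤˣ) :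
    CliffordAlgebra.involute (halfSum A u) = halfSum A (u * (-1) ^ A.card) := by
  unfold halfSum
  rw [map_smul, map_add, map_one, map_zsmul, involute_mono, smul_smul, Units.val_mul]

theorem monoConj_idem (A : Finset (Fin (p + q))) (T : Fin k → Finset (Fin (p + q)))
    (ε : Fin k → ℤˣ) : monoConj A (idem T ε) = idem T fun i => ε i * commSign A (T i) := by
  rw [idem_eq, monoConj_list_prod, List.map_ofFn, idem_eq]
  congr 2
  ext i
  exact monoConj_halfSum A (T i) (ε i)

/-- Only the signs of the odd monomials flip, so the involute of `f` belongs to the same family of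
idempotents and can be treated like `f`. -/
theorem involute_idem (T : Fin k → Finset (Fin (p + q))) (ε : Fin k → ℤˣ) :
    CliffordAlgebra.involute (idem T ε) = idem T fun i => ε i * (-1) ^ (T i).card := by
  rw [idem_eq, map_list_prod, List.map_ofFn, idem_eq]
  congr 2
  ext i
  exact involute_halfSum (T i) (ε i)

namespace Admissible

theorem halfSum_mul_idem (hT : Admissible T) (i : Fin k) : halfSum (T i) (ε i) * idem T ε = idem T ε := by
  rw [idem_eq]
  refine mul_list_prod_eq ?_ ?_ _ (List.mem_ofFn.2 ⟨i, rfl⟩)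
  · intro x hx
    obtain ⟨j, rfl⟩ := List.mem_ofFn.1 hx
    exact halfSum_mul_self (hT.sq j) _
  · intro x hx y hy
    obtain ⟨j, rfl⟩ := List.mem_ofFn.1 hx
    obtain ⟨l, rfl⟩ := List.mem_ofFn.1 hy
    exact halfSum_comm (hT.comm j l) _ _

theorem idem_mul_self (hT : Admissible T) : idem T ε * idem T ε = idem T ε := by
  conv_lhs => enter [1]; rw [idem_eq]
  refine list_prod_mul_eq fun x hx => ?_
  obtain ⟨j, rfl⟩ := List.mem_ofFn.1 hx
  exact hT.halfSum_mul_idem j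

theorem adj_idem (hT : Admissible T) : adj (idem T ε) = idem T ε := by
  rw [idem_eq]
  refine adj_list_prod ?_ ?_
  · intro x hx
    obtain ⟨j, rfl⟩ := List.mem_ofFn.1 hx
    exact adj_halfSum (hT.sq j) _
  · intro x hx y hy
    obtain ⟨j, rfl⟩ := List.mem_ofFn.1 hx
    obtain ⟨l, rfl⟩ := List.mem_ofFn.1 hy
    exact halfSum_comm (hT.comm j l) _ _

theorem mono_mul_idem (hT : Admissible T) (i : Fin k) : mono p q (T i) * idem T ε = (ε i : ℤ) • idem T ε := by
  conv_lhs => rw [← hT.halfSum_mul_idem i]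
  rw [← mul_assoc, mono_mul_halfSum (hT.sq i), smul_mul_assoc, hT.halfSum_mul_idem]

theorem idem_mul_mono (hT : Admissible T) (i : Fin k) : idem T ε * mono p q (T i) = (ε i : ℤ) • idem T ε := by
  have h := congrArg adj (hT.mono_mul_idem (ε := ε) i)
  rwa [adj_mul, adj_mono, hT.sq, Units.val_one, one_smul, map_zsmul, hT.adj_idem] at h

/-- Between the two factors `e_{T_i}` acts as `ε i` on the left one and as `ε' i` on the right one.
Where these differ, the product equals its own negative. -/
theorem idem_mul_idem_of_ne (hT : Admissible T) {ε' : Fin k → ℤˣ} (h : ε ≠ ε') : idem T ε * idem T ε' = 0 := by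
  obtain ⟨i, hi⟩ := Function.ne_iff.1 h
  have h1 : (ε i : ℤ) • (idem T ε * idem T ε') = (ε' i : ℤ) • (idem T ε * idem T ε') := by
    rw [← smul_mul_assoc, ← hT.idem_mul_mono, mul_assoc, hT.mono_mul_idem, mul_smul_comm]
  have h2 : (ε' i : ℤ) = -(ε i : ℤ) := by
    rcases Int.units_eq_one_or (ε i) with h | h <;> rcases Int.units_eq_one_or (ε' i) with h' | h' <;>
      simp_all
  rw [h2, neg_smul] at h1
  replace h1 := eq_zero_of_eq_neg h1
  have h3 := congrArg (fun x => (ε i : ℤ) • x) h1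
  simpa only [units_zsmul_self, smul_zero] using h3

end Admissible

/-! ### The monomials fixing an idempotent up to sign, and those commuting with the family -/

open Classical in
/-- The index sets `A` with `e_A f = ± f`. -/
noncomputable def fixSet (f : Cl p q) : Finset (Finset (Fin (p + q))) :=
  Finset.univ.filter fun A => ∃ u : ℤˣ, mono p q A * f = (u : ℤ) • f

theorem mem_fixSet {f : Cl p q} {A : Finset (Fin (p + q))} :
    A ∈ fixSet f ↔ ∃ u : ℤˣ, mono p q A * f = (u : ℤ) • f := by
  simp [fixSet]

/-- The index sets `A` such that `e_A` commutes with all `e_{T_i}`. -/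
def commSet (T : Fin k → Finset (Fin (p + q))) : Finset (Finset (Fin (p + q))) :=
  Finset.univ.filter fun A => ∀ i, commSign A (T i) = 1

theorem mem_commSet {A : Finset (Fin (p + q))} :
    A ∈ commSet T ↔ ∀ i, commSign A (T i) = 1 := by
  simp [commSet]

theorem empty_mem_fixSet (f : Cl p q) : ∅ ∈ fixSet f :=
  mem_fixSet.2 ⟨1, by simp [mono_empty]⟩

theorem symmDiff_mem_fixSet {f : Cl p q} {A B : Finset (Fin (p + q))} (hA : A ∈ fixSet f)
    (hB : B ∈ fixSet f) : A ∆ B ∈ fixSet f := by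
  obtain ⟨u, hu⟩ := mem_fixSet.1 hA
  obtain ⟨v, hv⟩ := mem_fixSet.1 hB
  obtain ⟨w, hw⟩ := exists_mono_mul_mono A B
  refine mem_fixSet.2 ⟨w * (v * u), ?_⟩
  have : mono p q (A ∆ B) = (w : ℤ) • (mono p q A * mono p q B) := by rw [hw, units_zsmul_self]
  rw [this, smul_mul_assoc, mul_assoc, hv, mul_smul_comm, hu, smul_smul, smul_smul]
  simp [mul_assoc]

theorem symmDiff_mem_commSet {A B : Finset (Fin (p + q))} (hA : A ∈ commSet T)
    (hB : B ∈ commSet T) : A ∆ B ∈ commSet T := by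
  rw [mem_commSet] at *
  intro i
  rw [commSign_symmDiff, hA, hB, one_mul]

/-- Since `fixSet f` is closed under `∆`, its monomials span a subalgebra. It contains every factor
of `f`, hence `f`. -/
theorem coef_eq_zero_of_notMem_fixSet (hT : Admissible T) {A : Finset (Fin (p + q))}
    (hA : A ∉ fixSet (idem T ε)) : coef A (idem T ε) = 0 := by
  set f := idem T ε with hf
  let V : Submodule ℝ (Cl p q) := Submodule.span ℝ (mono p q '' fixSet f)
  have hV : ∀ B ∈ fixSet f, mono p q B ∈ V := fun B hB => Submodule.subset_span ⟨B, hB, rfl⟩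
  have h1 : (1 : Cl p q) ∈ V := by
    rw [← mono_empty]; exact hV _ (empty_mem_fixSet f)
  have h2 : ∀ x y, x ∈ V → y ∈ V → x * y ∈ V := by
    intro x y hx hy
    induction hx, hy using Submodule.span_induction₂ with
    | mem_mem x y hx hy =>
      obtain ⟨B, hB, rfl⟩ := hx
      obtain ⟨D, hD, rfl⟩ := hy
      obtain ⟨u, hu⟩ := exists_mono_mul_mono B D
      rw [hu]
      exact zsmul_mem (hV _ (symmDiff_mem_fixSet hB hD)) _
    | zero_left y hy => simp
    | zero_right x hx => simp
    | add_left x y z _ _ _ h1 h2 => rw [add_mul]; exact add_mem h1 h2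
    | add_right x y z _ _ _ h1 h2 => rw [mul_add]; exact add_mem h1 h2
    | smul_left r x y _ _ h => rw [smul_mul_assoc]; exact Submodule.smul_mem _ _ h
    | smul_right r x y _ _ h => rw [mul_smul_comm]; exact Submodule.smul_mem _ _ h
  have h3 : f ∈ V.toSubalgebra h1 h2 := by
    rw [hf, idem_eq]
    refine Subalgebra.list_prod_mem _ fun x hx => ?_
    obtain ⟨i, rfl⟩ := List.mem_ofFn.1 hx
    refine Submodule.smul_mem _ _ (add_mem h1 (zsmul_mem (hV _ ?_) _))
    exact mem_fixSet.2 ⟨_, hT.mono_mul_idem i⟩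
  have h4 : ∀ x ∈ V, coef A x = 0 := by
    intro x hx
    induction hx using Submodule.span_induction with
    | mem x hx =>
      obtain ⟨B, hB, rfl⟩ := hx
      rw [coef_mono, if_neg]
      rintro rfl
      exact hA hB
    | zero => simp
    | add x y _ _ hx hy => rw [map_add, hx, hy, add_zero]
    | smul c x _ hx => rw [map_smul, hx, smul_zero]
  exact h4 f h3

theorem unit_cast_sq (u : ℤˣ) : ((u : ℤ) : ℝ) ^ 2 = 1 := by
  rcases Int.units_eq_one_or u with rfl | rfl <;> simp

theorem coef_of_mem_fixSet {f : Cl p q} {A : Finset (Fin (p + q))} (h : A ∈ fixSet f) :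
    coef A f ^ 2 = tr f ^ 2 := by
  obtain ⟨u, hu⟩ := mem_fixSet.1 h
  rw [coef_apply, adj_mono, smul_mul_assoc, hu, map_zsmul, map_zsmul, zsmul_eq_mul, zsmul_eq_mul,
    mul_pow, mul_pow, unit_cast_sq, unit_cast_sq, one_mul, one_mul]

theorem tr_idem_eq (hT : Admissible T) : tr (idem T ε) = tr (adj (idem T ε) * idem T ε) := by
  rw [hT.adj_idem, hT.idem_mul_self]

theorem tr_idem_pos (hT : Admissible T) (h0 : idem T ε ≠ 0) : 0 < tr (idem T ε) := by
  rw [tr_idem_eq hT]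
  exact lt_of_le_of_ne (tr_adj_mul_self_nonneg _) fun h =>
    h0 (eq_zero_of_tr_adj_mul_self h.symm)

/-- As `f` is a self-adjoint idempotent, `tr f` is the sum of the squares of its coefficients, each
equal to `(tr f)²` on `fixSet f` and to `0` elsewhere. -/
theorem card_fixSet_mul_tr (hT : Admissible T) (h0 : idem T ε ≠ 0) :
    (fixSet (idem T ε)).card * tr (idem T ε) = 1 := by
  have h1 : tr (idem T ε) = (fixSet (idem T ε)).card * tr (idem T ε) ^ 2 := by
    conv_lhs => rw [tr_idem_eq hT, tr_adj_mul_self]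
    rw [← Finset.sum_subset (Finset.subset_univ (fixSet (idem T ε)))
      fun A _ hA => by rw [coef_eq_zero_of_notMem_fixSet hT hA]; norm_num,
      Finset.sum_congr rfl fun A hA => coef_of_mem_fixSet hA]
    simp
  have h2 := (tr_idem_pos hT h0).ne'
  field_simp at h1
  linarith

theorem unit_eq_of_zsmul_eq {M : Type*} [AddCommGroup M] [Module ℝ M] {x : M} (hx : x ≠ 0) {u v : ℤˣ}
    (h : (u : ℤ) • x = (v : ℤ) • x) : u = v := by
  rw [← Int.cast_smul_eq_zsmul ℝ, ← Int.cast_smul_eq_zsmul ℝ] at h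
  exact Units.ext (by exact_mod_cast smul_left_injective ℝ hx h)

theorem sqSign_of_mem_fixSet {f : Cl p q} (h0 : f ≠ 0) {A : Finset (Fin (p + q))}
    (h : A ∈ fixSet f) : sqSign A = 1 := by
  obtain ⟨u, hu⟩ := mem_fixSet.1 h
  have h1 : mono p q A * (mono p q A * f) = f := by
    rw [hu, mul_smul_comm, hu, units_zsmul_self]
  rw [← mul_assoc, mono_mul_self, smul_mul_assoc, one_mul] at h1
  exact unit_eq_of_zsmul_eq (v := 1) h0 (by simpa using h1)

/-- Both `e_A` and `e_{T_i}` act on `f` by scalars, so their products in either order agree on `f`,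
which is nonzero. -/
theorem fixSet_subset_commSet (hT : Admissible T) (h0 : idem T ε ≠ 0) :
    fixSet (idem T ε) ⊆ commSet T := by
  intro A hA
  obtain ⟨u, hu⟩ := mem_fixSet.1 hA
  refine mem_commSet.2 fun i => ?_
  have h1 : mono p q A * (mono p q (T i) * idem T ε) = mono p q (T i) * (mono p q A * idem T ε) := by
    rw [hu, hT.mono_mul_idem, mul_smul_comm, mul_smul_comm, hu, hT.mono_mul_idem, smul_comm]
  rw [← mul_assoc, mono_mul_mono_comm, smul_mul_assoc, mul_assoc] at h1
  refine unit_eq_of_zsmul_eq (v := 1) (x := mono p q (T i) * (mono p q A * idem T ε)) ?_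
    (by simpa using h1)
  rw [hu, mul_smul_comm, hT.mono_mul_idem, smul_smul, ← Units.val_mul]
  intro h
  apply h0
  rw [← units_zsmul_self (u * ε i) (idem T ε), h, smul_zero]

theorem monoConj_idem_of_mem {A : Finset (Fin (p + q))} (hA : A ∈ commSet T) : monoConj A (idem T ε) = idem T ε := by
  rw [monoConj_idem]
  congr 1
  ext i
  rw [mem_commSet.1 hA i, mul_one]

theorem mono_mul_idem_comm {A : Finset (Fin (p + q))} (hA : A ∈ commSet T) :
    mono p q A * idem T ε = idem T ε * mono p q A := by
  have h := congrArg (· * mono p q A) (monoConj_idem_of_mem (ε := ε) hA)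
  simpa only [monoConj_apply, mul_assoc, adj_mono_mul, mul_one] using h

/-- Insert an `e_{T_i}` that anticommutes with `e_A`: absorbed by the right factor it gives `ε i`,
moved to the left factor it gives `-ε i`. -/
theorem idem_mul_mono_mul_idem (hT : Admissible T) {A : Finset (Fin (p + q))} (hA : A ∉ commSet T) :
    idem T ε * mono p q A * idem T ε = 0 := by
  rw [mem_commSet] at hA
  push Not at hA
  obtain ⟨i, hi⟩ := hA
  have hi' : commSign A (T i) = -1 := (Int.units_eq_one_or _).resolve_left hi
  have h1 : idem T ε * (mono p q A * mono p q (T i)) * idem T ε =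
      (ε i : ℤ) • (idem T ε * mono p q A * idem T ε) := by
    rw [mul_assoc, mul_assoc, hT.mono_mul_idem, mul_smul_comm, mul_smul_comm, mul_assoc]
  have h2 : idem T ε * (mono p q A * mono p q (T i)) * idem T ε =
      -((ε i : ℤ) • (idem T ε * mono p q A * idem T ε)) := by
    rw [mono_mul_mono_comm, hi', mul_smul_comm, smul_mul_assoc, ← mul_assoc, hT.idem_mul_mono,
      smul_mul_assoc, smul_mul_assoc]
    simp
  rw [h1] at h2
  replace h2 := eq_zero_of_eq_neg h2
  rw [← units_zsmul_self (ε i) (_ * _), h2, smul_zero]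

/-- Multiply `∑ e_A f e_A = sqSum • f` by `f` on the left: the term `f e_A f e_A` is zero outside
`commSet T` and `e_A² f` inside. -/
theorem sum_commSet_sqSign (hT : Admissible T) (h0 : idem T ε ≠ 0) :
    ∑ A ∈ commSet T, (sqSign A : ℤ) = sqSum p q := by
  have h1 := congrArg (idem T ε * ·) (sum_mono_mul_mul_mono (idem T ε))
  simp only [hT.adj_idem, mul_smul_comm, hT.idem_mul_self, Finset.mul_sum] at h1
  rw [← Finset.sum_subset (Finset.subset_univ (commSet T)) fun A _ hA => by
      rw [← mul_assoc, ← mul_assoc, idem_mul_mono_mul_idem hT hA, zero_mul],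
    Finset.sum_congr rfl fun A hA => show _ = (sqSign A : ℤ) • idem T ε by
      rw [mul_assoc, ← mono_mul_idem_comm hA, ← mul_assoc (mono p q A), mono_mul_self,
        smul_mul_assoc, one_mul, mul_smul_comm, hT.idem_mul_self],
    ← Finset.sum_smul, ← Int.cast_smul_eq_zsmul ℝ, ← Int.cast_smul_eq_zsmul ℝ] at h1
  exact_mod_cast smul_left_injective ℝ h0 h1

/-! ### Primitivity -/

theorem halfSum_add_halfSum_neg (A : Finset (Fin (p + q))) :
    halfSum A 1 + halfSum A (-1) = 1 := by
  unfold halfSum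
  rw [← smul_add, Units.val_neg, Units.val_one, neg_smul, one_smul]
  have : (1 : Cl p q) + mono p q A + (1 + -mono p q A) = (2 : ℝ) • 1 := by rw [two_smul]; abel
  rw [this, smul_smul]
  norm_num

theorem commSign_self {n : ℕ} (A : Finset (Fin n)) : commSign A A = 1 := by
  unfold commSign
  rw [Finset.inter_self, ← Nat.mul_succ]
  exact (Nat.even_mul_succ_self A.card).neg_one_pow

theorem halfSum_mul_halfSum_neg {A : Finset (Fin (p + q))} (hA : sqSign A = 1) (u : ℤˣ) :
    halfSum A u * halfSum A (-u) = 0 := by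
  have h1 : mono p q A * (halfSum A u * halfSum A (-u)) =
      (u : ℤ) • (halfSum A u * halfSum A (-u)) := by
    rw [← mul_assoc, mono_mul_halfSum hA, smul_mul_assoc]
  have h2 : mono p q A * (halfSum A u * halfSum A (-u)) =
      -((u : ℤ) • (halfSum A u * halfSum A (-u))) := by
    rw [halfSum_comm (commSign_self A) u (-u), ← mul_assoc, mono_mul_halfSum hA, smul_mul_assoc]
    simp
  rw [h1] at h2
  rw [← units_zsmul_self u (_ * _), eq_zero_of_eq_neg h2, smul_zero]

theorem halfSum_mul (A : Finset (Fin (p + q))) (u : ℤˣ) (x : Cl p q) :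
    halfSum A u * x = (1 / 2 : ℝ) • (x + (u : ℤ) • (mono p q A * x)) := by
  unfold halfSum
  rw [smul_mul_assoc, add_mul, one_mul, smul_mul_assoc]

theorem halfSum_mul_idem_comm {A : Finset (Fin (p + q))} (hA : A ∈ commSet T) (u : ℤˣ) :
    halfSum A u * idem T ε = idem T ε * halfSum A u := by
  unfold halfSum
  rw [smul_mul_assoc, mul_smul_comm, add_mul, mul_add, one_mul, mul_one, smul_mul_assoc,
    mul_smul_comm, mono_mul_idem_comm hA]

theorem mul_mul_mul_idem {A : Finset (Fin (p + q))} (hT : Admissible T) (hA : A ∈ commSet T)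
    (u v : ℤˣ) : halfSum A u * idem T ε * (halfSum A v * idem T ε) =
      halfSum A u * halfSum A v * idem T ε := by
  rw [mul_assoc, ← mul_assoc (idem T ε), ← halfSum_mul_idem_comm hA, mul_assoc (halfSum A v),
    hT.idem_mul_self, mul_assoc]

/-- Primitivity kills one of the orthogonal summands `½(1 ± e_A) f` of `f`, and the vanishing of
`½(1 + u e_A) f` says `e_A f = -u f`. -/
theorem mem_fixSet_of_isPrimitiveIdempotent (hT : Admissible T)
    (hp : IsPrimitiveIdempotent (idem T ε)) {A : Finset (Fin (p + q))} (hA : A ∈ commSet T)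
    (hs : sqSign A = 1) : A ∈ fixSet (idem T ε) := by
  have key : ∀ u : ℤˣ, halfSum A u * idem T ε = 0 → A ∈ fixSet (idem T ε) := by
    intro u hu
    rw [halfSum_mul, smul_eq_zero] at hu
    have h1 := hu.resolve_left (by norm_num)
    refine mem_fixSet.2 ⟨-u, ?_⟩
    have h2 := congrArg (fun x => (u : ℤ) • x) (eq_neg_of_add_eq_zero_right h1)
    simpa only [units_zsmul_self, smul_neg, Units.val_neg, neg_smul] using h2
  have h := hp.2.2 (halfSum A 1 * idem T ε) (halfSum A (-1) * idem T ε)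
  rw [mul_mul_mul_idem hT hA, mul_mul_mul_idem hT hA, mul_mul_mul_idem hT hA,
    mul_mul_mul_idem hT hA, halfSum_mul_self hs, halfSum_mul_self hs,
    halfSum_mul_halfSum_neg hs] at h
  have h3 := halfSum_mul_halfSum_neg hs (-1)
  rw [neg_neg] at h3
  rw [h3, ← add_mul, halfSum_add_halfSum_neg] at h
  rcases h rfl rfl (zero_mul _) (zero_mul _) (one_mul _).symm with h | h
  · exact key _ h
  · exact key _ h

/-- The corner `f Cl f` is spanned by the `e_A f` with `A` in `commSet T`. Those with `e_A² = 1` are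
`±f`, those with `e_A² = -1` are skew for `adj` and disappear on symmetrizing. -/
theorem add_adj_mem_span (hT : Admissible T)
    (h : ∀ A ∈ commSet T, sqSign A = 1 → A ∈ fixSet (idem T ε)) (y : Cl p q) :
    idem T ε * y * idem T ε + adj (idem T ε * y * idem T ε) ∈ Submodule.span ℝ {idem T ε} := by
  set f := idem T ε with hf
  let L : Cl p q →ₗ[ℝ] Cl p q := LinearMap.mulRight ℝ f ∘ₗ LinearMap.mulLeft ℝ f
  have : Submodule.comap (L + adj ∘ₗ L) (Submodule.span ℝ {f}) = ⊤ := by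
    rw [eq_top_iff, ← span_mono, Submodule.span_le]
    rintro _ ⟨A, rfl⟩
    change f * mono p q A * f + adj (f * mono p q A * f) ∈ Submodule.span ℝ {f}
    by_cases hA : A ∈ commSet T
    · have h1 : f * mono p q A * f = mono p q A * f := by
        rw [hf, ← mono_mul_idem_comm hA, mul_assoc, hT.idem_mul_self]
      rw [h1, adj_mul, hT.adj_idem, adj_mono, mul_smul_comm, ← mono_mul_idem_comm hA]
      rcases Int.units_eq_one_or (sqSign A) with hs | hs
      · obtain ⟨u, hu⟩ := mem_fixSet.1 (h A hA hs)
        rw [← hf, hu]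
        have h2 := Submodule.mem_span_singleton_self (R := ℝ) f
        exact add_mem (zsmul_mem h2 _) (zsmul_mem (zsmul_mem h2 _) _)
      · rw [hs]; simp [hf]
    · rw [hf, idem_mul_mono_mul_idem hT hA]; simp
  have hy : y ∈ Submodule.comap (L + adj ∘ₗ L) (Submodule.span ℝ {f}) := by
    rw [this]; exact Submodule.mem_top
  exact hy

/-- A summand `a` of `f` satisfies `a + adj a = x f`, hence `adj a * a = (x - 1) a`. If `x = 1`,
definiteness gives `a = 0`. Otherwise `a` is self-adjoint, hence a multiple of `f`, and being
idempotent it is `0` or `f`. -/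
theorem isPrimitiveIdempotent_idem (hT : Admissible T) (h0 : idem T ε ≠ 0)
    (h : ∀ A ∈ commSet T, sqSign A = 1 → A ∈ fixSet (idem T ε)) :
    IsPrimitiveIdempotent (idem T ε) := by
  refine ⟨h0, hT.idem_mul_self, fun a b ha hb hab hba hf => ?_⟩
  set f := idem T ε with hf'
  have h1 : f * a = a := by rw [hf, add_mul, ha, hba, add_zero]
  have h2 : a * f = a := by rw [hf, mul_add, ha, hab, add_zero]
  have h3 := add_adj_mem_span hT h a
  rw [← hf', h1, h2] at h3
  obtain ⟨x, hx⟩ := Submodule.mem_span_singleton.1 h3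
  have h4 : adj a * a = (x - 1) • a := by
    rw [eq_sub_of_add_eq' hx.symm, sub_mul, smul_mul_assoc, h1, ha, sub_smul, one_smul]
  by_cases hx1 : x = 1
  · left
    apply eq_zero_of_tr_adj_mul_self
    rw [h4, hx1, sub_self, zero_smul, map_zero]
  have h5 : adj a = a := by
    have := congrArg adj h4
    rw [adj_mul, adj_adj, h4, map_smul] at this
    exact (smul_right_injective _ (sub_ne_zero.2 hx1) this).symm
  have h6 : a = (x / 2) • f := by
    rw [h5, ← two_smul ℝ] at hx
    rw [div_eq_inv_mul, mul_smul, hx, smul_smul]; norm_num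
  have h7 : (x / 2) * (x / 2) = x / 2 := by
    have := ha
    rw [h6, smul_mul_smul_comm, hT.idem_mul_self] at this
    exact smul_left_injective ℝ h0 this
  have h9 : x / 2 = 1 ∨ x / 2 = 0 := by
    rcases mul_eq_zero.1 (show (x / 2 - 1) * (x / 2) = 0 by linarith) with h | h
    · exact Or.inl (by linarith)
    · exact Or.inr h
  rcases h9 with h8 | h8
  · right
    rw [h6, h8, one_smul] at hf
    exact (left_eq_add.1 hf)
  · left; rw [h6, h8, zero_smul]

/-! ### Orbits -/

theorem monoConj_injective (A : Finset (Fin (p + q))) :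
    Function.Injective (monoConj A : Cl p q → Cl p q) := by
  intro x y h
  have := congrArg (fun z => adj (mono p q A) * z * mono p q A) h
  simpa only [monoConj_apply, mul_assoc, adj_mono_mul, mul_one, ← mul_assoc (adj (mono p q A))
    (mono p q A), one_mul] using this

/-- Both conjugates are nonzero members of the family, and different sign patterns annihilate each
other; so they agree only if the patterns do. -/
theorem monoConj_idem_eq_iff (hT : Admissible T) (h0 : idem T ε ≠ 0)
    {A B : Finset (Fin (p + q))} :
    monoConj A (idem T ε) = monoConj B (idem T ε) ↔ A ∆ B ∈ commSet T := by
  rw [mem_commSet]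
  simp only [commSign_symmDiff]
  have h1 : monoConj B (idem T ε) ≠ 0 := fun h =>
    h0 (monoConj_injective B (h.trans (map_zero _).symm))
  rw [monoConj_idem] at h1 ⊢
  rw [monoConj_idem]
  constructor
  · intro h i
    by_contra hi
    refine h1 ?_
    rw [← hT.idem_mul_self]
    nth_rewrite 1 [← h]
    refine hT.idem_mul_idem_of_ne (Function.ne_iff.2 ⟨i, fun h' => hi ?_⟩)
    rw [mul_left_cancel h', Int.units_mul_self]
  · intro h
    congr 1
    ext i
    rw [← mul_one (ε i * commSign A (T i)), ← Int.units_mul_self (commSign B (T i)),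
      ← mul_assoc, mul_assoc (ε i), h, mul_one]

open Classical in
/-- The conjugates of `x` by the monomials. -/
noncomputable def orbitFinset (x : Cl p q) : Finset (Cl p q) :=
  Finset.univ.image fun A => monoConj A x

theorem mem_orbitFinset {x y : Cl p q} : y ∈ orbitFinset x ↔ ∃ A, monoConj A x = y := by
  simp [orbitFinset]

-- The fibre over the conjugate by `e_B` is the translate of `commSet T` by `B`.
open Classical in
theorem card_fiber (hT : Admissible T) (h0 : idem T ε ≠ 0) {b : Cl p q}
    (hb : b ∈ orbitFinset (idem T ε)) :
    (Finset.univ.filter fun A => monoConj A (idem T ε) = b).card = (commSet T).card := by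
  obtain ⟨B, rfl⟩ := mem_orbitFinset.1 hb
  refine Finset.card_bij' (fun A _ => A ∆ B) (fun A _ => A ∆ B) ?_ ?_ ?_ ?_
  · intro A hA
    exact (monoConj_idem_eq_iff hT h0).1 (Finset.mem_filter.1 hA).2
  · intro A hA
    refine Finset.mem_filter.2 ⟨Finset.mem_univ _, (monoConj_idem_eq_iff hT h0).2 ?_⟩
    rwa [symmDiff_symmDiff_cancel_right]
  · intro A _; exact symmDiff_symmDiff_cancel_right _ _
  · intro A _; exact symmDiff_symmDiff_cancel_right _ _

theorem card_orbitFinset_mul (hT : Admissible T) (h0 : idem T ε ≠ 0) :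
    (orbitFinset (idem T ε)).card * (commSet T).card = 2 ^ (p + q) := by
  classical
  have h := Finset.card_eq_sum_card_image (fun A => monoConj A (idem T ε)) Finset.univ
  rw [Finset.sum_congr rfl fun b hb => card_fiber hT h0 (by simpa [orbitFinset] using hb)] at h
  simp only [Finset.card_univ, Fintype.card_finset, Fintype.card_fin, Finset.sum_const,
    smul_eq_mul] at h
  rw [h]
  congr 1

theorem sum_orbitFinset_smul (hT : Admissible T) (h0 : idem T ε ≠ 0) :
    ∑ A, monoConj A (idem T ε) =
      ((commSet T).card : ℝ) • ∑ b ∈ orbitFinset (idem T ε), b := by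
  classical
  have h := Finset.sum_comp (s := Finset.univ) (fun b : Cl p q => b)
    (fun A => monoConj A (idem T ε))
  rw [h, Finset.smul_sum, show Finset.image (fun A => monoConj A (idem T ε)) Finset.univ =
    orbitFinset (idem T ε) by unfold orbitFinset; congr!]
  refine Finset.sum_congr rfl fun b hb => ?_
  rw [card_fiber hT h0 hb, Nat.cast_smul_eq_nsmul]

theorem sum_orbitFinset_mul_self (hT : Admissible T) :
    (∑ b ∈ orbitFinset (idem T ε), b) * (∑ b ∈ orbitFinset (idem T ε), b) =
      ∑ b ∈ orbitFinset (idem T ε), b := by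
  rw [Finset.sum_mul_sum]
  refine Finset.sum_congr rfl fun b hb => ?_
  obtain ⟨B, hB⟩ := mem_orbitFinset.1 hb
  rw [monoConj_idem] at hB
  rw [Finset.sum_eq_single_of_mem b hb, ← hB, hT.idem_mul_self]
  intro a ha hab
  obtain ⟨A, hA⟩ := mem_orbitFinset.1 ha
  rw [monoConj_idem] at hA
  rw [← hA, ← hB]
  refine hT.idem_mul_idem_of_ne fun h => hab ?_
  rw [← hA, ← hB, h]

theorem halfSum_ne_zero {A : Finset (Fin (p + q))} (hA : A ≠ ∅) (u : ℤˣ) :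
    halfSum A u ≠ (0 : Cl p q) := by
  intro h
  have h1 := congrArg tr h
  unfold halfSum at h1
  rw [map_smul, map_add, tr_one, map_zsmul, tr_mono hA] at h1
  simp at h1

-- Orbit sums and the central idempotents

section Central

variable {s : ℤˣ}

theorem univ_ne_empty (hn : Odd (p + q)) : (Finset.univ : Finset (Fin (p + q))) ≠ ∅ := by
  have := hn.pos
  rw [← Finset.nonempty_iff_ne_empty]
  exact ⟨⟨0, this⟩, Finset.mem_univ _⟩

/-- If `e_{1⋯n} f = s f`, the elements of the orbit of `f` add up to `½(1 + s e_{1⋯n})`. -/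
theorem sum_orbitFinset (hn : Odd (p + q)) (hsq : sqSign (Finset.univ : Finset (Fin (p + q))) = 1)
    (hT : Admissible T) (h0 : idem T ε ≠ 0)
    (hs : mono p q Finset.univ * idem T ε = (s : ℤ) • idem T ε) :
    ((commSet T).card : ℝ) = 2 ^ (p + q + 1) * tr (idem T ε) ∧
      ∑ b ∈ orbitFinset (idem T ε), b = halfSum Finset.univ s := by
  set c := tr (idem T ε) with hc
  have hcpos : 0 < c := tr_idem_pos hT h0
  have h1 : coef Finset.univ (idem T ε) = (s : ℤ) * c := by
    rw [coef_apply, adj_mono, hsq, Units.val_one, one_smul, hs, map_zsmul, zsmul_eq_mul]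
  have h2 : ((commSet T).card : ℝ) • ∑ b ∈ orbitFinset (idem T ε), b =
      (2 ^ (p + q + 1) * c) • halfSum Finset.univ s := by
    rw [← sum_orbitFinset_smul hT h0, sum_monoConj hn, h1, ← hc, halfSum,
      ← Int.cast_smul_eq_zsmul ℝ]
    module
  have hC : ((commSet T).card : ℝ) ≠ 0 := by
    intro h
    have h3 := card_orbitFinset_mul hT h0
    rw [Nat.cast_eq_zero.1 h, mul_zero] at h3
    exact absurd h3.symm (by positivity)
  obtain ⟨r, hr⟩ : ∃ r : ℝ, r = 2 ^ (p + q + 1) * c / (commSet T).card := ⟨_, rfl⟩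
  have h3 : ∑ b ∈ orbitFinset (idem T ε), b = r • halfSum Finset.univ s := by
    rw [hr, div_eq_inv_mul, mul_smul, ← h2, smul_smul, inv_mul_cancel₀ hC, one_smul]
  -- The orbit sum and `½(1 + s e_{1⋯n})` are both idempotent, so the factor `r` between them
  -- satisfies `r² = r`; it is nonzero because the trace of `f` is positive.
  have h4 := sum_orbitFinset_mul_self (ε := ε) hT
  rw [h3, smul_mul_smul_comm, halfSum_mul_self hsq] at h4
  have h5 := smul_left_injective ℝ (halfSum_ne_zero (univ_ne_empty hn) s) h4
  have hr0 : r ≠ 0 := by rw [hr]; positivity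
  have h6 : r = 1 := mul_left_cancel₀ hr0 (by simpa using h5)
  refine ⟨?_, by rw [h3, h6, one_smul]⟩
  rw [h6, eq_div_iff hC, one_mul] at hr
  exact hr

theorem card_commSet_mul_card_fixSet (hn : Odd (p + q))
    (hsq : sqSign (Finset.univ : Finset (Fin (p + q))) = 1)
    (hT : Admissible T) (h0 : idem T ε ≠ 0)
    (hs : mono p q Finset.univ * idem T ε = (s : ℤ) • idem T ε) :
    (commSet T).card * (fixSet (idem T ε)).card = 2 ^ (p + q + 1) := by
  have h1 := (sum_orbitFinset hn hsq hT h0 hs).1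
  have h2 := card_fixSet_mul_tr hT h0
  have : ((commSet T).card * (fixSet (idem T ε)).card : ℝ) = 2 ^ (p + q + 1) := by
    rw [h1, mul_assoc, mul_comm (tr _), h2, mul_one]
  exact_mod_cast this

/-- Orbit–stabilizer, `|O||C| = 2^n`, compared with `|C||H| = 2^(n+1)`. -/
theorem two_mul_card_orbitFinset (hn : Odd (p + q))
    (hsq : sqSign (Finset.univ : Finset (Fin (p + q))) = 1)
    (hT : Admissible T) (h0 : idem T ε ≠ 0)
    (hs : mono p q Finset.univ * idem T ε = (s : ℤ) • idem T ε) :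
    2 * (orbitFinset (idem T ε)).card = (fixSet (idem T ε)).card := by
  have h1 := card_commSet_mul_card_fixSet hn hsq hT h0 hs
  have h2 := card_orbitFinset_mul hT h0
  have h3 : 0 < (commSet T).card := Nat.pos_of_ne_zero fun h => by
    rw [h, mul_zero] at h2; exact absurd h2.symm (by positivity)
  refine Nat.eq_of_mul_eq_mul_left h3 ?_
  rw [h1, pow_succ, ← h2]
  ring

end Central

/-! ### The sum of the squares of the monomials -/

/-- The signs `+, +, -, -` of period four are the real parts of `(1 - i) i^a`; the imaginary part is
included for the induction. -/
theorem gaussianInt_mul_I_pow (a : ℕ) : (⟨1, -1⟩ * ⟨0, 1⟩ ^ a : GaussianInt) =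
    ⟨(-1) ^ a.choose 2, -(-1) ^ (a + 1).choose 2⟩ := by
  induction a with
  | zero => decide
  | succ a ih =>
    have h : (a + 1 + 1).choose 2 = a.choose 2 + 2 * a + 1 := by
      rw [Nat.choose_succ_succ' (a + 1) 1, Nat.choose_succ_succ' a 1, Nat.choose_one_right,
        Nat.choose_one_right]
      ring
    rw [pow_succ, ← mul_assoc, ih, h, pow_succ, pow_add _ (a.choose 2), pow_mul]
    ext <;> simp [Zsqrtd.re_mul, Zsqrtd.im_mul]

/-- The square root of `-1` attached to the generator `e_i`. -/
def genRoot (p q : ℕ) (i : Fin (p + q)) : GaussianInt := if p ≤ (i : ℕ) then ⟨0, -1⟩ else ⟨0, 1⟩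

theorem sqSign_eq_re (A : Finset (Fin (p + q))) :
    (sqSign A : ℤ) = ((⟨1, -1⟩ : GaussianInt) * ∏ i ∈ A, genRoot p q i).re := by
  have h1 : ∀ i, genRoot p q i = ⟨0, 1⟩ * (if p ≤ (i : ℕ) then -1 else 1) := by
    intro i; unfold genRoot; split_ifs <;> decide
  have h2 : ∏ i ∈ A, genRoot p q i =
      ⟨0, 1⟩ ^ A.card * (-1) ^ (A.filter fun i : Fin (p + q) => p ≤ (i : ℕ)).card := by
    rw [Finset.prod_congr rfl fun i _ => h1 i, Finset.prod_mul_distrib, Finset.prod_const,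
      Finset.prod_ite, Finset.prod_const, Finset.prod_const_one, mul_one]
  rw [h2, ← mul_assoc, gaussianInt_mul_I_pow, sqSign, pow_add]
  rcases neg_one_pow_eq_or GaussianInt (A.filter fun i : Fin (p + q) => p ≤ (i : ℕ)).card with h | h
  · have h' : (-1 : ℤ) ^ (A.filter fun i : Fin (p + q) => p ≤ (i : ℕ)).card = 1 := by
      have := congrArg Zsqrtd.re h
      rcases neg_one_pow_eq_or ℤ (A.filter fun i : Fin (p + q) => p ≤ (i : ℕ)).card with h' | h'
      · exact h'
      · exfalso
        have h3 := congrArg (Int.cast : ℤ → GaussianInt) h'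
        push_cast at h3
        rw [h] at h3
        exact absurd h3 (by decide)
    rw [h]
    push_cast
    rw [h']
    simp
  · have h' : (-1 : ℤ) ^ (A.filter fun i : Fin (p + q) => p ≤ (i : ℕ)).card = -1 := by
      rcases neg_one_pow_eq_or ℤ (A.filter fun i : Fin (p + q) => p ≤ (i : ℕ)).card with h' | h'
      · exfalso
        have h3 := congrArg (Int.cast : ℤ → GaussianInt) h'
        push_cast at h3
        rw [h] at h3
        exact absurd h3 (by decide)
      · exact h'
    rw [h]
    push_cast
    rw [h']
    simp

/-- Expanding a product of factors `1 + genRoot` over index sets turns the sum of signs into a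
product, with `1 + i` for each positive and `1 - i` for each negative generator. -/
theorem sqSum_eq (p q : ℕ) :
    sqSum p q = ((⟨1, -1⟩ : GaussianInt) * (⟨1, 1⟩ ^ p * ⟨1, -1⟩ ^ q)).re := by
  let re : GaussianInt →+ ℤ := { toFun := Zsqrtd.re, map_zero' := rfl, map_add' := fun _ _ => rfl }
  have h1 : ∑ A : Finset (Fin (p + q)), ∏ i ∈ A, genRoot p q i = ⟨1, 1⟩ ^ p * ⟨1, -1⟩ ^ q := by
    have := Finset.prod_one_add (f := genRoot p q) (Finset.univ : Finset (Fin (p + q)))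
    rw [Finset.powerset_univ] at this
    rw [← this, Fin.prod_univ_add]
    have e1 : ∀ i : Fin p, 1 + genRoot p q (Fin.castAdd q i) = ⟨1, 1⟩ := by
      intro i; unfold genRoot; rw [if_neg (by simp)]; decide
    have e2 : ∀ i : Fin q, 1 + genRoot p q (Fin.natAdd p i) = ⟨1, -1⟩ := by
      intro i; unfold genRoot; rw [if_pos (by simp)]; decide
    simp [e1, e2]
  rw [← h1, Finset.mul_sum]
  change _ = re _
  rw [map_sum]
  exact Finset.sum_congr rfl fun A _ => sqSign_eq_re A

theorem sqSign_univ (hpq : ((p : ℤ) - q) % 4 = 1) (hn : p + q ≤ 9) :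
    sqSign (Finset.univ : Finset (Fin (p + q))) = 1 := by
  have hp : p ≤ 9 := by omega
  have hq : q ≤ 9 := by omega
  interval_cases p <;> interval_cases q <;> first | omega | decide

/-- The Gaussian integer in `sqSum_eq` has modulus `2^((n+1)/2)` and argument `(p - q - 1)π/4`, here
`0`. The finitely many signatures are evaluated one by one. -/
theorem real_numerics (hpq : ((p : ℤ) - q) % 8 = 1) (hn : p + q ≤ 9)
    (hk : (k : ℤ) = q - radonHurwitz (q - p)) : p + q + 1 = 2 * k ∧ sqSum p q = 2 ^ k := by
  rw [sqSum_eq]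
  have hp : p ≤ 9 := by omega
  have hq : q ≤ 9 := by omega
  interval_cases p <;> interval_cases q <;> first
    | omega
    | (norm_num [radonHurwitz] at hk
       norm_cast at hk
       subst hk
       exact ⟨rfl, by decide⟩)

/-- Now the argument is `π`, whence the negative sign. -/
theorem quaternionic_numerics (hpq : ((p : ℤ) - q) % 8 = 5) (hn : p + q ≤ 9)
    (hk : (k : ℤ) = q - radonHurwitz (q - p)) :
    p + q = 2 * k + 1 ∧ 1 ≤ k ∧ sqSum p q = -2 ^ (k + 1) := by
  rw [sqSum_eq]
  have hp : p ≤ 9 := by omega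
  have hq : q ≤ 9 := by omega
  interval_cases p <;> interval_cases q <;> first
    | omega
    | (norm_num [radonHurwitz] at hk
       norm_cast at hk
       subst hk
       exact ⟨rfl, by decide, by decide⟩)

/-! ### Counting -/

theorem sum_commSet_eq (h0 : idem T ε ≠ 0) (hsub : fixSet (idem T ε) ⊆ commSet T) :
    ∑ A ∈ commSet T, (sqSign A : ℤ) =
      (fixSet (idem T ε)).card + ∑ A ∈ commSet T \ fixSet (idem T ε), (sqSign A : ℤ) := by
  rw [← Finset.sum_sdiff hsub, add_comm, Finset.sum_congr rfl fun A hA => show (sqSign A : ℤ) = 1 by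
    rw [sqSign_of_mem_fixSet h0 hA]; rfl]
  simp

theorem mem_fixSet_univ (hn : Odd (p + q))
    (hsq : sqSign (Finset.univ : Finset (Fin (p + q))) = 1)
    (hT : Admissible T) (hp : IsPrimitiveIdempotent (idem T ε)) :
    ∃ s : ℤˣ, mono p q Finset.univ * idem T ε = (s : ℤ) • idem T ε :=
  mem_fixSet.1 (mem_fixSet_of_isPrimitiveIdempotent hT hp
    (mem_commSet.2 fun i => by rw [commSign_comm, commSign_univ hn]) hsq)

/-- Monomials in `fixSet` have square `1` and, by primitivity, the remaining ones in `commSet T`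
have square `-1`; so the signs over `commSet T` add up to `2|H| - |C|`. -/
theorem two_mul_card_fixSet (hT : Admissible T) (hp : IsPrimitiveIdempotent (idem T ε)) :
    2 * ((fixSet (idem T ε)).card : ℤ) = sqSum p q + (commSet T).card := by
  have hsub := fixSet_subset_commSet hT hp.1
  have h1 := sum_commSet_eq hp.1 hsub
  rw [sum_commSet_sqSign hT hp.1, Finset.sum_congr rfl fun A hA => show (sqSign A : ℤ) = -1 by
    rw [Finset.mem_sdiff] at hA
    rw [(Int.units_eq_one_or (sqSign A)).resolve_left fun h =>
      hA.2 (mem_fixSet_of_isPrimitiveIdempotent hT hp hA.1 h)]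
    rfl] at h1
  simp only [Finset.sum_const, nsmul_eq_mul, mul_neg, mul_one, Finset.card_sdiff_of_subset hsub]
    at h1
  rw [Nat.cast_sub (Finset.card_le_card hsub)] at h1
  linarith

/-- In the real case the number of monomials fixing a primitive idempotent up to sign, and of those
commuting with the family, are both `2 ^ k`. -/
theorem card_real (hn : p + q + 1 = 2 * k) (hsum : sqSum p q = 2 ^ k) {m : ℕ}
    {T : Fin m → Finset (Fin (p + q))} {ε : Fin m → ℤˣ} (hT : Admissible T)
    (hp : IsPrimitiveIdempotent (idem T ε))
    (hsq : sqSign (Finset.univ : Finset (Fin (p + q))) = 1) :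
    (fixSet (idem T ε)).card = 2 ^ k ∧ (commSet T).card = 2 ^ k := by
  have hodd : Odd (p + q) := by rw [Nat.odd_iff]; omega
  obtain ⟨s, hs⟩ := mem_fixSet_univ hodd hsq hT hp
  have h1 := two_mul_card_fixSet hT hp
  have h2 := card_commSet_mul_card_fixSet hodd hsq hT hp.1 hs
  rw [hn, mul_comm 2 k, pow_mul] at h2
  rw [hsum] at h1
  have hx : (0 : ℤ) < 2 ^ k := by positivity
  have h3 : ((commSet T).card : ℤ) * (fixSet (idem T ε)).card = (2 ^ k) ^ 2 := by exact_mod_cast h2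
  -- Substituting `|C| = 2|H| - 2^k` into `|C||H| = (2^k)²` leaves a quadratic with a single
  -- positive root.
  have h4 : (2 * ((fixSet (idem T ε)).card : ℤ) + 2 ^ k) * ((fixSet (idem T ε)).card - 2 ^ k) = 0 := by
    linear_combination ((fixSet (idem T ε)).card : ℤ) * h1 + h3
  have h5 : ((fixSet (idem T ε)).card : ℤ) = 2 ^ k := by
    rcases mul_eq_zero.1 h4 with h | h
    · exfalso; have : (0 : ℤ) ≤ (fixSet (idem T ε)).card := by positivity
      linarith
    · linarith
  have h6 : ((commSet T).card : ℤ) = 2 ^ k := by linarith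
  exact ⟨by exact_mod_cast h5, by exact_mod_cast h6⟩

/-- In the quaternionic case `2 ^ k` monomials fix a primitive idempotent up to sign, and
`2 ^ (k + 2)` commute with the family. -/
theorem card_quaternionic (hn : p + q = 2 * k + 1) (hsum : sqSum p q = -2 ^ (k + 1)) {m : ℕ}
    {T : Fin m → Finset (Fin (p + q))} {ε : Fin m → ℤˣ} (hT : Admissible T)
    (hp : IsPrimitiveIdempotent (idem T ε))
    (hsq : sqSign (Finset.univ : Finset (Fin (p + q))) = 1) :
    (fixSet (idem T ε)).card = 2 ^ k ∧ (commSet T).card = 2 ^ (k + 2) := by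
  have hodd : Odd (p + q) := by rw [Nat.odd_iff]; omega
  obtain ⟨s, hs⟩ := mem_fixSet_univ hodd hsq hT hp
  have h1 := two_mul_card_fixSet hT hp
  have h2 := card_commSet_mul_card_fixSet hodd hsq hT hp.1 hs
  rw [show p + q + 1 = k * 2 + 2 by omega, pow_add, pow_mul] at h2
  rw [hsum, pow_succ] at h1
  have hx : (0 : ℤ) < 2 ^ k := by positivity
  have h3 : ((commSet T).card : ℤ) * (fixSet (idem T ε)).card = (2 ^ k) ^ 2 * 2 ^ 2 := by
    exact_mod_cast h2
  -- The same elimination, now with `|C| = 2|H| + 2·2^k` and `|C||H| = 4·(2^k)²`.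
  have h4 : (((fixSet (idem T ε)).card : ℤ) + 2 * 2 ^ k) * ((fixSet (idem T ε)).card - 2 ^ k) = 0 := by
    refine mul_left_cancel₀ (two_ne_zero (α := ℤ)) ?_
    linear_combination ((fixSet (idem T ε)).card : ℤ) * h1 + h3
  have h5 : ((fixSet (idem T ε)).card : ℤ) = 2 ^ k := by
    rcases mul_eq_zero.1 h4 with h | h
    · exfalso; have : (0 : ℤ) ≤ (fixSet (idem T ε)).card := by positivity
      linarith
    · linarith
  have h6 : ((commSet T).card : ℤ) = 2 ^ (k + 2) := by rw [pow_add]; linarith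
  exact ⟨by exact_mod_cast h5, by exact_mod_cast h6⟩

/-- In the real case, a lower bound on the number of monomials fixing `f` up to sign makes `f`
primitive. -/
theorem isPrimitiveIdempotent_of_real (hn : p + q + 1 = 2 * k) (hT : Admissible T)
    (h0 : idem T ε ≠ 0) (hsq : sqSign (Finset.univ : Finset (Fin (p + q))) = 1)
    (hU : Finset.univ ∈ fixSet (idem T ε)) (hH : 2 ^ k ≤ (fixSet (idem T ε)).card) :
    IsPrimitiveIdempotent (idem T ε) := by
  have hodd : Odd (p + q) := by rw [Nat.odd_iff]; omega
  obtain ⟨s, hs⟩ := mem_fixSet.1 hU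
  have h2 := card_commSet_mul_card_fixSet hodd hsq hT h0 hs
  have hsub := fixSet_subset_commSet hT h0
  rw [hn, mul_comm 2 k, pow_mul] at h2
  have hx : 0 < 2 ^ k := by positivity
  -- `|C||H| = (2^k)²` with `|H| ≥ 2^k` gives `|C| ≤ 2^k ≤ |H|`.
  have hC : fixSet (idem T ε) = commSet T := by
    refine Finset.eq_of_subset_of_card_le hsub ?_
    refine le_trans ?_ hH
    refine Nat.le_of_mul_le_mul_right ?_ hx
    calc _ ≤ (commSet T).card * (fixSet (idem T ε)).card := Nat.mul_le_mul_left _ hH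
      _ = _ := by rw [h2, sq]
  refine isPrimitiveIdempotent_idem hT h0 fun A hA _ => ?_
  rwa [hC]

/-- The signs over `C ∖ H` add up to `-2·2^k - |H|`. A square `1` among them would make this larger
than `|H| - |C|`, so `|C| > 2·2^k + 2|H| ≥ 4·2^k`, against `|C||H| = 4·(2^k)²`. -/
theorem isPrimitiveIdempotent_of_quaternionic (hn : p + q = 2 * k + 1)
    (hsum : sqSum p q = -2 ^ (k + 1)) (hT : Admissible T)
    (h0 : idem T ε ≠ 0) (hsq : sqSign (Finset.univ : Finset (Fin (p + q))) = 1)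
    (hU : Finset.univ ∈ fixSet (idem T ε)) (hH : 2 ^ k ≤ (fixSet (idem T ε)).card) :
    IsPrimitiveIdempotent (idem T ε) := by
  have hodd : Odd (p + q) := by rw [Nat.odd_iff]; omega
  obtain ⟨s, hs⟩ := mem_fixSet.1 hU
  have h2 := card_commSet_mul_card_fixSet hodd hsq hT h0 hs
  have hsub := fixSet_subset_commSet hT h0
  rw [show p + q + 1 = k * 2 + 2 by omega, pow_add, pow_mul] at h2
  have hx : (0 : ℤ) < 2 ^ k := by positivity
  have h3 : ((commSet T).card : ℤ) * (fixSet (idem T ε)).card = (2 ^ k) ^ 2 * 2 ^ 2 := by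
    exact_mod_cast h2
  have hH' : (2 : ℤ) ^ k ≤ (fixSet (idem T ε)).card := by exact_mod_cast hH
  have h1 := sum_commSet_eq h0 hsub
  rw [sum_commSet_sqSign hT h0, hsum, pow_succ] at h1
  have h4 : ((commSet T \ fixSet (idem T ε)).card : ℤ) =
      (commSet T).card - (fixSet (idem T ε)).card := by
    rw [Finset.card_sdiff_of_subset hsub, Nat.cast_sub (Finset.card_le_card hsub)]
  have hC : ((commSet T).card : ℤ) ≤ 4 * 2 ^ k := by
    by_contra hc
    push Not at hc
    nlinarith
  refine isPrimitiveIdempotent_idem hT h0 fun A hA hsA => ?_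
  by_contra hAH
  have h5 : -((commSet T \ fixSet (idem T ε)).card : ℤ) <
      ∑ A ∈ commSet T \ fixSet (idem T ε), (sqSign A : ℤ) := by
    have : -((commSet T \ fixSet (idem T ε)).card : ℤ) =
      ∑ A ∈ commSet T \ fixSet (idem T ε), (-1 : ℤ) := by simp
    rw [this]
    refine Finset.sum_lt_sum (fun B _ => ?_) ⟨A, Finset.mem_sdiff.2 ⟨hA, hAH⟩, ?_⟩
    · rcases Int.units_eq_one_or (sqSign B) with h | h <;> rw [h] <;> decide
    · rw [hsA]; decide
  rw [h4] at h5
  linarith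

/-! ### Elements of the vee group -/

/-- The element `u e_A` of `G_{p,q}`. -/
noncomputable def veeElt (u : ℤˣ) (A : Finset (Fin (p + q))) : veeGroup p q :=
  ⟨⟨(u : ℤ) • mono p q A, (u : ℤ) • adj (mono p q A),
    by rw [smul_mul_smul_comm, mono_mul_adj, ← Units.val_mul, Int.units_mul_self]; simp,
    by rw [smul_mul_smul_comm, adj_mono_mul, ← Units.val_mul, Int.units_mul_self]; simp⟩,
    A, by rcases Int.units_eq_one_or u with rfl | rfl <;> simp⟩

theorem coe_veeElt (u : ℤˣ) (A : Finset (Fin (p + q))) :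
    ((veeElt u A : (Cl p q)ˣ) : Cl p q) = (u : ℤ) • mono p q A := rfl

theorem vee_ext {g h : veeGroup p q} (e : ((g : (Cl p q)ˣ) : Cl p q) = ((h : (Cl p q)ˣ) : Cl p q)) :
    g = h := Subtype.ext (Units.ext e)

theorem exists_veeElt (g : veeGroup p q) : ∃ u A, g = veeElt u A := by
  obtain ⟨A, h | h⟩ := g.2
  · exact ⟨1, A, vee_ext (by rw [h, coe_veeElt]; simp)⟩
  · exact ⟨-1, A, vee_ext (by rw [h, coe_veeElt]; simp)⟩

theorem veeElt_inj {u v : ℤˣ} {A B : Finset (Fin (p + q))} (h : veeElt u A = veeElt v B) :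
    u = v ∧ A = B := by
  have := congrArg (fun g : veeGroup p q => ((g : (Cl p q)ˣ) : Cl p q)) h
  exact (mono_injective_up_to_sign this).symm

theorem conj_veeElt (u : ℤˣ) (A : Finset (Fin (p + q))) (x : Cl p q) :
    conj (veeElt u A) x = monoConj A x := by
  change (u : ℤ) • mono p q A * x * ((u : ℤ) • adj (mono p q A)) = _
  rw [smul_mul_assoc, smul_mul_smul_comm, ← Units.val_mul, Int.units_mul_self, monoConj_apply]
  simp

theorem exists_veeElt_mul (u v : ℤˣ) (A B : Finset (Fin (p + q))) :
    ∃ w : ℤˣ, veeElt u A * veeElt v B = veeElt (u * v * w) (A ∆ B) := by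
  obtain ⟨w, hw⟩ := exists_mono_mul_mono A B
  refine ⟨w, vee_ext ?_⟩
  rw [Subgroup.coe_mul, Units.val_mul, coe_veeElt, coe_veeElt, coe_veeElt, smul_mul_smul_comm, hw,
    smul_smul, Units.val_mul, Units.val_mul]

theorem veeElt_one_empty : (veeElt 1 ∅ : veeGroup p q) = 1 :=
  vee_ext (by rw [coe_veeElt]; simp [mono_empty])

theorem card_subgroup_veeGroup {K : Subgroup (veeGroup p q)} {C : Finset (Finset (Fin (p + q)))}
    (h : ∀ u A, veeElt u A ∈ K ↔ A ∈ C) : Nat.card K = 2 * C.card := by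
  let φ : ℤˣ × C → K := fun x => ⟨veeElt x.1 x.2.1, (h _ _).2 x.2.2⟩
  have hφ : Function.Bijective φ := by
    constructor
    · rintro ⟨u, A⟩ ⟨v, B⟩ e
      obtain ⟨h1, h2⟩ := veeElt_inj (congrArg Subtype.val e)
      exact Prod.ext h1 (Subtype.ext h2)
    · rintro ⟨g, hg⟩
      obtain ⟨u, A, rfl⟩ := exists_veeElt g
      exact ⟨⟨u, A, (h _ _).1 hg⟩, rfl⟩
  rw [← Nat.card_congr (Equiv.ofBijective φ hφ), Nat.card_prod]
  simp

instance : Finite (veeGroup p q) := by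
  refine Finite.of_surjective (fun x : ℤˣ × Finset (Fin (p + q)) => veeElt x.1 x.2) fun g => ?_
  obtain ⟨u, A, rfl⟩ := exists_veeElt g
  exact ⟨(u, A), rfl⟩

theorem mem_stab {f : Cl p q} {g : veeGroup p q} : g ∈ stab f ↔ conj g f = f := Iff.rfl

theorem veeElt_mem_stab (hT : Admissible T) (h0 : idem T ε ≠ 0) (u : ℤˣ)
    (A : Finset (Fin (p + q))) : veeElt u A ∈ stab (idem T ε) ↔ A ∈ commSet T := by
  have h := monoConj_idem_eq_iff (A := A) (B := ∅) hT h0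
  rw [← conj_veeElt 1 ∅, veeElt_one_empty, conj_one, ← Finset.bot_eq_empty, symmDiff_bot] at h
  rw [mem_stab, conj_veeElt, h]

theorem card_stab (hT : Admissible T) (h0 : idem T ε ≠ 0) :
    Nat.card (stab (idem T ε)) = 2 * (commSet T).card :=
  card_subgroup_veeGroup (veeElt_mem_stab hT h0)

theorem orbit_eq (x : Cl p q) : orbit x = orbitFinset x := by
  ext y
  simp only [orbit, Set.mem_ofPred_eq, Finset.mem_coe, mem_orbitFinset]
  constructor
  · rintro ⟨g, rfl⟩
    obtain ⟨u, A, rfl⟩ := exists_veeElt g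
    exact ⟨A, (conj_veeElt u A x).symm⟩
  · rintro ⟨A, rfl⟩
    exact ⟨veeElt 1 A, (conj_veeElt 1 A x).symm⟩

/-- Membership is decided by `commSet T`, into which the signs do not enter. -/
theorem stab_idem_eq {ε' : Fin k → ℤˣ} (hT : Admissible T) (h0 : idem T ε ≠ 0)
    (h0' : idem T ε' ≠ 0) : stab (idem T ε) = stab (idem T ε') := by
  ext g
  obtain ⟨u, A, rfl⟩ := exists_veeElt g
  rw [veeElt_mem_stab hT h0, veeElt_mem_stab hT h0']

theorem stab_normal (hT : Admissible T) (h0 : idem T ε ≠ 0) : (stab (idem T ε)).Normal := by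
  refine ⟨fun n hn g => ?_⟩
  have h1 : conj n (conj g⁻¹ (idem T ε)) = conj g⁻¹ (idem T ε) := by
    obtain ⟨v, B, hB⟩ := exists_veeElt g⁻¹
    have h2 : monoConj B (idem T ε) ≠ 0 := fun h =>
      h0 (monoConj_injective B (h.trans (map_zero _).symm))
    rw [hB, conj_veeElt]
    rw [monoConj_idem] at h2 ⊢
    rwa [← mem_stab, ← stab_idem_eq hT h0 h2]
  rw [mem_stab, conj_mul, conj_mul, h1, ← conj_mul, mul_inv_cancel, conj_one]

/-! ### The statements common to the two cases -/

section Common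

variable {s : ℤˣ}

/-- Conjugation fixes the central `e_{1⋯n}`, so its eigenvalue is constant on an orbit. The
involution negates it, which keeps the two orbits apart. -/
theorem mono_univ_mul_of_mem_orbit (hn : Odd (p + q)) {f x : Cl p q}
    (hs : mono p q Finset.univ * f = (s : ℤ) • f) (hx : x ∈ orbitFinset f) :
    mono p q Finset.univ * x = (s : ℤ) • x := by
  obtain ⟨A, rfl⟩ := mem_orbitFinset.1 hx
  have h : monoConj A (mono p q Finset.univ) = mono p q Finset.univ := by
    rw [monoConj_mono, commSign_univ hn]; simp
  nth_rewrite 1 [← h]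
  rw [← monoConj_mul, hs, map_zsmul]

theorem mono_univ_mul_involute (hn : Odd (p + q)) {f : Cl p q}
    (hs : mono p q Finset.univ * f = (s : ℤ) • f) :
    mono p q Finset.univ * CliffordAlgebra.involute f =
      ((-s : ℤˣ) : ℤ) • CliffordAlgebra.involute f := by
  have h := congrArg CliffordAlgebra.involute hs
  rw [map_mul, involute_mono, map_zsmul, Finset.card_univ, Fintype.card_fin, hn.neg_one_pow] at h
  rw [Units.val_neg, neg_smul, ← h]
  simp

theorem commonConclusion (hk : 1 ≤ k) (hn : Odd (p + q)) (hn9 : p + q ≤ 9)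
    (hpq : ((p : ℤ) - q) % 4 = 1)
    (hT : IsCommutingFamily T) (hp : IsPrimitiveIdempotent (idem T ε))
    (hH : (fixSet (idem T ε)).card = 2 ^ k) : CommonConclusion T ε := by
  classical
  have hsq := sqSign_univ hpq hn9
  have hA := hT.admissible
  have h0 := hp.1
  obtain ⟨s, hs⟩ := mem_fixSet_univ hn hsq hA hp
  obtain ⟨ε', hε'⟩ : ∃ ε' : Fin k → ℤˣ, ε' = fun i => ε i * (-1) ^ (T i).card := ⟨_, rfl⟩
  have hinv : CliffordAlgebra.involute (idem T ε) = idem T ε' := by rw [involute_idem, hε']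
  have hs' := mono_univ_mul_involute hn hs
  rw [hinv] at hs'
  have h0' : idem T ε' ≠ 0 := by
    rw [← hinv]
    intro h
    exact h0 (CliffordAlgebra.involute_involutive.injective (h.trans (map_zero _).symm))
  have hC := card_commSet_mul_card_fixSet hn hsq hA h0 hs
  have hC' := card_commSet_mul_card_fixSet hn hsq hA h0' hs'
  have hkn : k ≤ p + q + 1 := by
    rw [hH] at hC
    exact (Nat.pow_dvd_pow_iff_le_right (by norm_num : 1 < 2)).1 (Dvd.intro_left _ hC)
  have hCc : (commSet T).card = 2 ^ (p + q + 1 - k) := by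
    refine Nat.eq_of_mul_eq_mul_right (show 0 < 2 ^ k by positivity) ?_
    rw [← hH, hC, hH, ← pow_add, Nat.sub_add_cancel hkn]
  have hH' : (fixSet (idem T ε')).card = 2 ^ k := by
    refine Nat.eq_of_mul_eq_mul_left (show 0 < (commSet T).card by rw [hCc]; positivity) ?_
    rw [hC', ← hC, hH]
  have hcard : Nat.card (stab (idem T ε)) = 2 ^ (p + q + 2 - k) := by
    rw [card_stab hA h0, hCc, ← pow_succ']
    congr 1; omega
  have hO := two_mul_card_orbitFinset hn hsq hA h0 hs
  have hO' := two_mul_card_orbitFinset hn hsq hA h0' hs'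
  have hpow : 2 ^ k = 2 * 2 ^ (k - 1) := by rw [← pow_succ']; congr 1; omega
  rw [hH, hpow] at hO
  rw [hH', hpow] at hO'
  have hO1 : (orbitFinset (idem T ε)).card = 2 ^ (k - 1) := by omega
  have hO1' : (orbitFinset (idem T ε')).card = 2 ^ (k - 1) := by omega
  have hdisj : Disjoint (orbitFinset (idem T ε)) (orbitFinset (idem T ε')) := by
    rw [Finset.disjoint_left]
    intro x hx hx'
    have h1 := mono_univ_mul_of_mem_orbit hn hs hx
    rw [mono_univ_mul_of_mem_orbit hn hs' hx'] at h1
    have hx0 : x ≠ 0 := by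
      obtain ⟨A, rfl⟩ := mem_orbitFinset.1 hx
      exact fun h => h0 (monoConj_injective A (h.trans (map_zero _).symm))
    have h2 := unit_eq_of_zsmul_eq hx0 h1
    rcases Int.units_eq_one_or s with h | h <;> rw [h] at h2 <;> exact absurd h2 (by decide)
  refine ⟨?_, stab_normal hA h0, ?_, IsPGroup.of_card hcard, ?_, ?_, ?_, ?_, ?_, ?_⟩
  · rw [hinv]; exact stab_idem_eq hA h0 h0'
  · rw [hcard, Nat.cast_pow, Nat.cast_ofNat, ← zpow_natCast]
    congr 1
    have := hT.length
    rw [Nat.cast_sub (by omega)]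
    push_cast
    linarith
  · intro m hm i
    obtain ⟨u, A, rfl⟩ := exists_veeElt m
    rw [conj_veeElt, monoConj_mono, mem_commSet.1 ((veeElt_mem_stab hA h0 u A).1 hm)]
    simp
  · intro t
    refine ⟨halfSum_mul_self hsq t, ?_⟩
    rw [Subalgebra.mem_center_iff]
    intro b
    change b * halfSum Finset.univ t = halfSum Finset.univ t * b
    unfold halfSum
    rw [mul_smul_comm, smul_mul_assoc, mul_add, add_mul, mul_one, one_mul, mul_smul_comm,
      smul_mul_assoc, mono_univ_central hn]
  · rw [hinv, orbit_eq, orbit_eq, Set.ncard_coe_finset, Set.ncard_coe_finset]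
    exact ⟨hO1, hO1'⟩
  · rw [hinv, orbit_eq, orbit_eq, Finset.disjoint_coe]
    exact hdisj
  · rw [hinv, orbit_eq, orbit_eq, ← Finset.coe_union, ← Set.image_univ, ← Finset.coe_univ,
      ← Finset.coe_image]
    congr 1
    -- The two disjoint orbits together have `2^k` elements, and there are only `2^k` sign patterns.
    refine Finset.eq_of_subset_of_card_le ?_ ?_
    · refine Finset.union_subset ?_ ?_ <;>
      · intro x hx
        obtain ⟨A, rfl⟩ := mem_orbitFinset.1 hx
        rw [monoConj_idem]
        exact Finset.mem_image_of_mem _ (Finset.mem_univ _)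
    · rw [Finset.card_union_of_disjoint hdisj, hO1, hO1', ← two_mul, ← hpow]
      refine Finset.card_image_le.trans ?_
      simp
  · refine ⟨s, ?_, ?_⟩
    · rw [orbit_eq, finsum_mem_coe_finset]
      exact (sum_orbitFinset hn hsq hA h0 hs).2
    · rw [hinv, orbit_eq, finsum_mem_coe_finset]
      exact (sum_orbitFinset hn hsq hA h0' hs').2

end Common

/-! ### Two recognition lemmas for finite groups -/

/-- Exponent two forces commutativity, so `G` is a vector space over `ZMod 2` whose dimension is
read off from its order. -/
theorem nonempty_mulEquiv_of_sq_eq_one {G : Type*} [Group G] [Finite G] {m : ℕ}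
    (h : ∀ g : G, g * g = 1) (hcard : Nat.card G = 2 ^ m) :
    Nonempty (G ≃* Multiplicative (Fin m → ZMod 2)) := by
  let _ : CommGroup G :=
    { (inferInstance : Group G) with
      mul_comm := fun a b => by
        have ha : ∀ g : G, g⁻¹ = g := fun g => inv_eq_of_mul_eq_one_right (h g)
        rw [← ha (a * b), mul_inv_rev, ha, ha] }
  let _ : Module (ZMod 2) (Additive G) := AddCommGroup.zmodModule fun x => by
    rw [two_nsmul]; exact h x.toMul
  have : Finite (Additive G) := inferInstanceAs (Finite G)
  have hr : Module.finrank (ZMod 2) (Additive G) = m := by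
    have h1 := Module.natCard_eq_pow_finrank (K := ZMod 2) (V := Additive G)
    rw [Nat.card_zmod] at h1
    have h2 : Nat.card (Additive G) = 2 ^ m := hcard
    rw [h2] at h1
    exact (Nat.pow_right_injective (le_refl 2) h1).symm
  let e : Additive G ≃ₗ[ZMod 2] (Fin m → ZMod 2) :=
    LinearEquiv.ofFinrankEq _ _ (by rw [hr, Module.finrank_fin_fun])
  exact ⟨{ toFun := fun g => Multiplicative.ofAdd (e (Additive.ofMul g))
           invFun := fun v => (e.symm v.toAdd).toMul
           left_inv := fun g => by simp
           right_inv := fun v => by simp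
           map_mul' := fun a b => by simp }⟩

/-- The homomorphism from the quaternion group given by `x, y` with `x² = y² = (x y)²` of
order two. -/
def quaternionHom {G : Type*} [Group G] {x y z : G} (hx : x * x = z) (hy : y * y = z)
    (hz : z * z = 1) (hxy : x * y * (x * y) = z) : QuaternionGroup 2 →* G :=
  have h4 : x ^ 4 = 1 := by
    rw [show 4 = 2 + 2 from rfl, pow_add, sq, hx, hz]
  have hadd : ∀ i j : ZMod (2 * 2), x ^ (i + j).val = x ^ i.val * x ^ j.val := fun i j => by
    rw [ZMod.val_add, ← pow_add]
    exact (pow_eq_pow_mod _ h4).symm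
  have hsub : ∀ i j : ZMod (2 * 2), x ^ (j - i).val = (x ^ i.val)⁻¹ * x ^ j.val := fun i j => by
    rw [eq_inv_mul_iff_mul_eq, ← hadd]; congr 2; ring
  -- `x² = (x y)²` gives `y x y = x`; then `y² = x² = z` and `z² = 1` turn this into the quaternion
  -- relation.
  have hconj : y⁻¹ * x * y = x⁻¹ := by
    have h1 : y * x * y = x := by
      have : x * (y * x * y) = x * x := by rw [hx, ← hxy]; group
      exact mul_left_cancel this
    have h2 : y⁻¹ * x * y = (y * y)⁻¹ * (y * x * y) := by group
    rw [h2, h1, hy, inv_eq_of_mul_eq_one_left hz, eq_inv_iff_mul_eq_one, mul_assoc, hx, hz]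
  have hpow : ∀ i : ℕ, y⁻¹ * x ^ i * y = (x ^ i)⁻¹ := fun i => by
    rw [← inv_pow, ← hconj]
    have := conj_pow (i := i) (a := y⁻¹) (b := x)
    rw [inv_inv] at this
    exact this.symm
  { toFun := fun g => match g with
      | .a i => x ^ i.val
      | .xa i => y * x ^ i.val
    map_one' := by
      change x ^ (0 : ZMod (2 * 2)).val = 1
      simp
    map_mul' := by
      rintro (i | i) (j | j)
      · exact hadd i j
      · change y * x ^ (j - i).val = x ^ i.val * (y * x ^ j.val)
        rw [hsub, ← hpow]; group
      · change y * x ^ (i + j).val = y * x ^ i.val * x ^ j.val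
        rw [hadd, mul_assoc]
      · change x ^ (((2 : ℕ) : ZMod (2 * 2)) + j - i).val = y * x ^ i.val * (y * x ^ j.val)
        have h2 : x ^ (((2 : ℕ) : ZMod (2 * 2))).val = y * y := by
          rw [show (((2 : ℕ) : ZMod (2 * 2))).val = 2 from rfl, sq, hx, hy]
        rw [add_sub_assoc, hadd, hsub, h2, ← hpow]; group }

theorem quaternionHom_a {G : Type*} [Group G] {x y z : G} (hx : x * x = z) (hy : y * y = z)
    (hz : z * z = 1) (hxy : x * y * (x * y) = z) (i : ZMod (2 * 2)) :
    quaternionHom hx hy hz hxy (.a i) = x ^ i.val := rfl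

theorem quaternionHom_sq {G : Type*} [Group G] {x y z : G} (hx : x * x = z) (hy : y * y = z)
    (hz : z * z = 1) (hxy : x * y * (x * y) = z) (g : QuaternionGroup 2) :
    g = .a 0 ∨ g = .a 2 ∨
      quaternionHom hx hy hz hxy g * quaternionHom hx hy hz hxy g = z := by
  have h2 : ∀ g : QuaternionGroup 2, g = .a 0 ∨ g = .a 2 ∨ g * g = .a 2 := by decide
  rcases h2 g with h | h | h
  · exact Or.inl h
  · exact Or.inr (Or.inl h)
  · right; right
    rw [← map_mul, h, quaternionHom_a, show (2 : ZMod (2 * 2)).val = 2 from rfl, sq, hx]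

/-- A group of order `2 ^ (k + 3)` which contains a quaternion group and a complementary central
elementary abelian subgroup. -/
theorem nonempty_mulEquiv_quaternion_prod {G : Type*} [Group G] [Finite G] {x y z : G} {k : ℕ}
    (P : Subgroup G) (hx : x * x = z) (hy : y * y = z)
    (hz : z * z = 1) (hxy : x * y * (x * y) = z) (hc : ∀ g ∈ P, ∀ h, g * h = h * g)
    (hP : ∀ g ∈ P, g * g = 1) (hzP : z ∉ P) (hcP : Nat.card P = 2 ^ k)
    (hcG : Nat.card G = 2 ^ (k + 3)) :
    Nonempty (G ≃* QuaternionGroup 2 × Multiplicative (Fin k → ZMod 2)) := by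
  obtain ⟨e⟩ := nonempty_mulEquiv_of_sq_eq_one (G := P) (fun g => Subtype.ext (hP g g.2)) hcP
  let φ := quaternionHom hx hy hz hxy
  let Ψ : QuaternionGroup 2 × P →* G := φ.noncommCoprod P.subtype
    fun g h => (hc h h.2 (φ g)).symm
  have hinj : Function.Injective Ψ := by
    rw [injective_iff_map_eq_one]
    rintro ⟨u, v⟩ huv
    have h1 : φ u * v = 1 := huv
    -- Elements of `P` have square `1` and `z` is not among them. So `u` is neither `a 2`, which
    -- maps to `z`, nor an element whose image has square `z`.
    have h2 : φ u ∈ P := by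
      rw [eq_inv_of_mul_eq_one_left h1]; exact P.inv_mem v.2
    have hu : u = .a 0 := by
      rcases quaternionHom_sq hx hy hz hxy u with h | h | h
      · exact h
      · exfalso; apply hzP
        have : φ u = z := by
          rw [h]; change x ^ (2 : ZMod (2 * 2)).val = z
          rw [show (2 : ZMod (2 * 2)).val = 2 from rfl, sq, hx]
        rwa [← this]
      · exfalso
        have h3 := hP _ h2
        change φ u * φ u = z at h
        rw [h] at h3
        exact hzP (h3 ▸ P.one_mem)
    rw [hu, QuaternionGroup.a_zero, map_one, one_mul] at h1
    rw [hu, QuaternionGroup.a_zero]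
    exact Prod.ext rfl (Subtype.ext h1)
  have hbij : Function.Bijective Ψ := by
    rw [Nat.bijective_iff_injective_and_card]
    refine ⟨hinj, ?_⟩
    rw [Nat.card_prod, hcP, hcG, Nat.card_eq_fintype_card, QuaternionGroup.card, pow_add]
    ring
  exact ⟨(MulEquiv.ofBijective Ψ hbij).symm.trans ((MulEquiv.refl _).prodCongr e)⟩

/-- Splitting off the first coordinate. -/
noncomputable def finConsMulEquiv (m : ℕ) : Multiplicative (Fin (m + 1) → ZMod 2) ≃*
    Multiplicative (Fin 1 → ZMod 2) × Multiplicative (Fin m → ZMod 2) where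
  toFun v := (Multiplicative.ofAdd fun _ => v.toAdd 0, Multiplicative.ofAdd fun i => v.toAdd i.succ)
  invFun w := Multiplicative.ofAdd (Fin.cons (w.1.toAdd 0) w.2.toAdd)
  left_inv v := by
    apply Multiplicative.toAdd.injective
    ext i
    refine Fin.cases ?_ (fun j => ?_) i <;> simp
  right_inv w := by
    refine Prod.ext ?_ ?_
    · apply Multiplicative.toAdd.injective
      ext i
      fin_cases i
      simp
    · apply Multiplicative.toAdd.injective
      ext i
      simp
  map_mul' v w := rfl

theorem closure_range_single (m : ℕ) : Subgroup.closure (Set.range fun i : Fin m =>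
    (Multiplicative.ofAdd (Pi.single i 1 : Fin m → ZMod 2))) = ⊤ := by
  rw [eq_top_iff]
  intro v _
  have hv : v = ∏ i, Multiplicative.ofAdd (Pi.single i 1 : Fin m → ZMod 2) ^ (v.toAdd i).val := by
    apply Multiplicative.toAdd.injective
    rw [toAdd_prod]
    simp only [toAdd_pow, toAdd_ofAdd]
    ext j
    rw [Finset.sum_apply, Finset.sum_eq_single j]
    · simp
    · intro i _ hij
      simp [Pi.single_eq_of_ne hij.symm]
    · simp
  rw [hv]
  exact Subgroup.prod_mem _ fun i _ => Subgroup.pow_mem _ (Subgroup.subset_closure (Set.mem_range_self i)) _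

theorem orderOf_single {m : ℕ} (i : Fin m) :
    orderOf (Multiplicative.ofAdd (Pi.single i 1 : Fin m → ZMod 2)) = 2 := by
  rw [orderOf_eq_prime_iff]
  constructor
  · apply Multiplicative.toAdd.injective
    rw [toAdd_pow, toAdd_ofAdd, ← Pi.single_smul]
    simp; decide
  · intro h
    have := congrFun (congrArg Multiplicative.toAdd h) i
    simp at this

theorem realConclusion_of_sq_eq_one {G : Type} [Group G] [Finite G] {k : ℕ}
    (h : ∀ g : G, g * g = 1) (hcard : Nat.card G = 2 ^ (k + 1)) : RealConclusion k G := by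
  obtain ⟨e⟩ := nonempty_mulEquiv_of_sq_eq_one h hcard
  refine ⟨fun a b => e.injective (by rw [map_mul, map_mul, mul_comm]),
    ⟨fun i => e.symm (Multiplicative.ofAdd (Pi.single i 1)), ?_, ?_, ?_⟩, ⟨e⟩⟩
  · intro i j hij
    have h1 := Multiplicative.ofAdd.injective (e.symm.injective hij)
    by_contra hne
    have := congrFun h1 i
    rw [Pi.single_eq_same, Pi.single_eq_of_ne hne] at this
    exact one_ne_zero this
  · have h1 := congrArg (Subgroup.map e.symm.toMonoidHom) (closure_range_single (k + 1))
    rw [MonoidHom.map_closure, ← Set.range_comp, ← MonoidHom.range_eq_map,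
      MonoidHom.range_eq_top.2 e.symm.surjective] at h1
    exact h1
  · intro i
    rw [MulEquiv.orderOf_eq, orderOf_single]

/-! ### The structure of the stabilizer -/

theorem veeElt_mul_self_of_one {A : Finset (Fin (p + q))} (h : sqSign A = 1) (u : ℤˣ) :
    veeElt u A * veeElt u A = 1 := by
  refine vee_ext ?_
  rw [Subgroup.coe_mul, Units.val_mul, coe_veeElt, smul_mul_smul_comm, mono_mul_self, h,
    ← Units.val_mul, Int.units_mul_self]
  simp

theorem veeElt_mul_self_of_neg_one {A : Finset (Fin (p + q))} (h : sqSign A = -1) (u : ℤˣ) :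
    veeElt u A * veeElt u A = veeElt (-1) ∅ := by
  refine vee_ext ?_
  rw [Subgroup.coe_mul, Units.val_mul, coe_veeElt, coe_veeElt, smul_mul_smul_comm, mono_mul_self, h,
    ← Units.val_mul, Int.units_mul_self]
  simp [mono_empty]

/-- The subgroup of `G_{p,q}` of the elements `g` with `g x = x`. -/
noncomputable def fixGroup (x : Cl p q) : Subgroup (veeGroup p q) where
  carrier := {g | ((g : (Cl p q)ˣ) : Cl p q) * x = x}
  one_mem' := by simp
  mul_mem' := by
    intro a b ha hb
    simp only [Set.mem_ofPred_eq, Subgroup.coe_mul, Units.val_mul] at *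
    rw [mul_assoc, hb, ha]
  inv_mem' := by
    intro a ha
    simp only [Set.mem_ofPred_eq, Subgroup.coe_inv] at *
    rw [Units.inv_mul_eq_iff_eq_mul, ha]

theorem mem_fixGroup {x : Cl p q} {g : veeGroup p q} :
    g ∈ fixGroup x ↔ ((g : (Cl p q)ˣ) : Cl p q) * x = x := Iff.rfl

theorem veeElt_mem_fixGroup {x : Cl p q} {u : ℤˣ} {A : Finset (Fin (p + q))} :
    veeElt u A ∈ fixGroup x ↔ mono p q A * x = (u : ℤ) • x := by
  rw [mem_fixGroup, coe_veeElt, smul_mul_assoc]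
  constructor
  · intro h
    rw [← units_zsmul_self u (mono p q A * x), h]
  · intro h
    rw [h, units_zsmul_self]

/-- For each index set in `fixSet x` exactly one of the two signs fixes `x`. -/
theorem card_fixGroup {x : Cl p q} (hx : x ≠ 0) : Nat.card (fixGroup x) = (fixSet x).card := by
  have h : ∀ A : fixSet x, ∃ u : ℤˣ, veeElt u A.1 ∈ fixGroup x := fun A => by
    obtain ⟨u, hu⟩ := mem_fixSet.1 A.2
    exact ⟨u, veeElt_mem_fixGroup.2 hu⟩
  choose u hu using h
  have hb : Function.Bijective fun A : fixSet x => (⟨veeElt (u A) A.1, hu A⟩ : fixGroup x) := by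
    constructor
    · intro A B hAB
      exact Subtype.ext (veeElt_inj (congrArg Subtype.val hAB)).2
    · rintro ⟨g, hg⟩
      obtain ⟨v, A, rfl⟩ := exists_veeElt g
      have hA := veeElt_mem_fixGroup.1 hg
      refine ⟨⟨A, mem_fixSet.2 ⟨v, hA⟩⟩, Subtype.ext ?_⟩
      have h1 := veeElt_mem_fixGroup.1 (hu ⟨A, mem_fixSet.2 ⟨v, hA⟩⟩)
      change veeElt _ A = veeElt _ A
      rw [unit_eq_of_zsmul_eq hx (h1.symm.trans hA)]
  rw [← Nat.card_congr (Equiv.ofBijective _ hb)]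
  simp

theorem fixGroup_le_stab (hT : Admissible T) (h0 : idem T ε ≠ 0) :
    fixGroup (idem T ε) ≤ stab (idem T ε) := by
  intro g hg
  obtain ⟨u, A, rfl⟩ := exists_veeElt g
  rw [veeElt_mem_stab hT h0]
  exact fixSet_subset_commSet hT h0 (mem_fixSet.2 ⟨u, veeElt_mem_fixGroup.1 hg⟩)

/-- The monomials which commute with the family commute with those fixing `f` up to sign. -/
theorem commSign_eq_one_of_mem (h0 : idem T ε ≠ 0)
    {A B : Finset (Fin (p + q))} (hA : A ∈ fixSet (idem T ε)) (hB : B ∈ commSet T) :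
    commSign A B = 1 := by
  obtain ⟨u, hu⟩ := mem_fixSet.1 hA
  have hne : mono p q B * (mono p q A * idem T ε) ≠ 0 := by
    intro h
    apply h0
    have h1 := congrArg (fun x => adj (mono p q A) * (adj (mono p q B) * x)) h
    simpa only [← mul_assoc (adj (mono p q B)), adj_mono_mul, one_mul,
      ← mul_assoc (adj (mono p q A)), mul_zero] using h1
  have h1 : mono p q A * (mono p q B * idem T ε) = mono p q B * (mono p q A * idem T ε) := by
    rw [mono_mul_idem_comm hB, ← mul_assoc, hu, smul_mul_assoc, mul_smul_comm,
      mono_mul_idem_comm hB]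
  rw [← mul_assoc, mono_mul_mono_comm, smul_mul_assoc, mul_assoc] at h1
  exact unit_eq_of_zsmul_eq (v := 1) hne (by simpa using h1)

theorem realConclusion_stab (hn : p + q + 1 = 2 * k) (hsum : sqSum p q = 2 ^ k)
    (hsq : sqSign (Finset.univ : Finset (Fin (p + q))) = 1) (hT : Admissible T)
    (hp : IsPrimitiveIdempotent (idem T ε)) : RealConclusion k (stab (idem T ε)) := by
  obtain ⟨hH, hC⟩ := card_real hn hsum hT hp hsq
  have hHC := Finset.eq_of_subset_of_card_le (fixSet_subset_commSet hT hp.1) (hC.trans hH.symm).le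
  refine realConclusion_of_sq_eq_one ?_ (by rw [card_stab hT hp.1, hC, pow_succ'])
  rintro ⟨g, hg⟩
  obtain ⟨u, A, rfl⟩ := exists_veeElt g
  rw [veeElt_mem_stab hT hp.1, ← hHC] at hg
  exact Subtype.ext (veeElt_mul_self_of_one (sqSign_of_mem_fixSet hp.1 hg) u)

/-- The elements with `g f = f` form the central factor. With `A` and `B` independent modulo
`fixSet`, the monomials of `A`, `B` and `A ∆ B` all have square `-1` and give the quaternion factor.
-/
theorem nonempty_stab_mulEquiv (hn : p + q = 2 * k + 1) (hsum : sqSum p q = -2 ^ (k + 1))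
    (hsq : sqSign (Finset.univ : Finset (Fin (p + q))) = 1) (hT : Admissible T)
    (hp : IsPrimitiveIdempotent (idem T ε)) :
    Nonempty (stab (idem T ε) ≃* QuaternionGroup 2 × Multiplicative (Fin k → ZMod 2)) := by
  obtain ⟨hH, hC⟩ := card_quaternionic hn hsum hT hp hsq
  have h0 := hp.1
  have hneg : ∀ A ∈ commSet T, A ∉ fixSet (idem T ε) → sqSign A = -1 := fun A hA hAH =>
    (Int.units_eq_one_or _).resolve_left fun h =>
      hAH (mem_fixSet_of_isPrimitiveIdempotent hT hp hA h)
  have hpow : (0 : ℕ) < 2 ^ k := by positivity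
  obtain ⟨A, hA, hAH⟩ : ∃ A ∈ commSet T, A ∉ fixSet (idem T ε) := by
    apply Finset.exists_mem_notMem_of_card_lt_card
    rw [hH, hC, pow_add]; omega
  -- The sets to avoid number at most `2·2^k`, out of `4·2^k`; avoiding the translate by `A` keeps
  -- `A ∆ B` out of `fixSet`.
  obtain ⟨B, hB, hBH⟩ : ∃ B ∈ commSet T, B ∉ fixSet (idem T ε) ∪
      (fixSet (idem T ε)).image (A ∆ ·) := by
    apply Finset.exists_mem_notMem_of_card_lt_card
    refine (Finset.card_union_le _ _).trans_lt ?_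
    refine (Nat.add_le_add_left Finset.card_image_le _).trans_lt ?_
    rw [hH, hC, pow_add]; omega
  rw [Finset.mem_union, not_or] at hBH
  have hABH : A ∆ B ∉ fixSet (idem T ε) := fun h =>
    hBH.2 (Finset.mem_image.2 ⟨_, h, symmDiff_symmDiff_cancel_left A B⟩)
  let x : stab (idem T ε) := ⟨veeElt 1 A, (veeElt_mem_stab hT h0 _ _).2 hA⟩
  let y : stab (idem T ε) := ⟨veeElt 1 B, (veeElt_mem_stab hT h0 _ _).2 hB⟩
  let z : stab (idem T ε) := ⟨veeElt (-1) ∅, (veeElt_mem_stab hT h0 _ _).2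
    (mem_commSet.2 fun i => by rw [commSign_comm, commSign_empty])⟩
  refine nonempty_mulEquiv_quaternion_prod (x := x) (y := y) (z := z)
    ((fixGroup (idem T ε)).subgroupOf (stab (idem T ε))) ?_ ?_ ?_ ?_ ?_ ?_ ?_ ?_ ?_
  · exact Subtype.ext (veeElt_mul_self_of_neg_one (hneg A hA hAH) 1)
  · exact Subtype.ext (veeElt_mul_self_of_neg_one (hneg B hB hBH.1) 1)
  · exact Subtype.ext (veeElt_mul_self_of_one (by simp [sqSign]) (-1))
  · refine Subtype.ext ?_
    change veeElt 1 A * veeElt 1 B * (veeElt 1 A * veeElt 1 B) = veeElt (-1) ∅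
    obtain ⟨w, hw⟩ := exists_veeElt_mul 1 1 A B
    rw [hw]
    exact veeElt_mul_self_of_neg_one (hneg _ (symmDiff_mem_commSet hA hB) hABH) _
  · rintro ⟨g, hg⟩ hgP ⟨h, hh⟩
    obtain ⟨u, D, rfl⟩ := exists_veeElt g
    obtain ⟨v, E, rfl⟩ := exists_veeElt h
    rw [veeElt_mem_stab hT h0] at hh
    have hD := mem_fixSet.2 ⟨u, veeElt_mem_fixGroup.1 (Subgroup.mem_subgroupOf.1 hgP)⟩
    refine Subtype.ext (vee_ext ?_)
    change (u : ℤ) • mono p q D * (v : ℤ) • mono p q E =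
      (v : ℤ) • mono p q E * (u : ℤ) • mono p q D
    rw [smul_mul_smul_comm, smul_mul_smul_comm, mono_mul_mono_comm,
      commSign_eq_one_of_mem h0 hD hh, Units.val_one, one_smul, mul_comm]
  · rintro ⟨g, hg⟩ hgP
    obtain ⟨u, D, rfl⟩ := exists_veeElt g
    have hD := mem_fixSet.2 ⟨u, veeElt_mem_fixGroup.1 (Subgroup.mem_subgroupOf.1 hgP)⟩
    exact Subtype.ext (veeElt_mul_self_of_one (sqSign_of_mem_fixSet h0 hD) u)
  · intro hz
    have h1 := veeElt_mem_fixGroup.1 (Subgroup.mem_subgroupOf.1 hz)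
    rw [mono_empty, one_mul] at h1
    exact h0 (eq_zero_of_eq_neg (by simpa using h1))
  · rw [Nat.card_congr (Subgroup.subgroupOfEquivOfLe (fixGroup_le_stab hT h0)).toEquiv,
      card_fixGroup h0, hH]
  · rw [card_stab hT h0, hC, ← pow_succ']

/-! ### Independent families of index sets -/

/-- The symmetric differences of the subfamilies of a list of sets. -/
def symmDiffSpan {n : ℕ} : List (Finset (Fin n)) → List (Finset (Fin n))
  | [] => [∅]
  | A :: L => symmDiffSpan L ++ (symmDiffSpan L).map (A ∆ ·)

/-- No set of the list is a symmetric difference of later ones. -/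
def SymmDiffIndep {n : ℕ} : List (Finset (Fin n)) → Prop
  | [] => True
  | A :: L => A ∉ symmDiffSpan L ∧ SymmDiffIndep L

theorem length_symmDiffSpan {n : ℕ} (L : List (Finset (Fin n))) :
    (symmDiffSpan L).length = 2 ^ L.length := by
  induction L with
  | nil => rfl
  | cons A L ih =>
    rw [symmDiffSpan, List.length_append, List.length_map, ih, List.length_cons, pow_succ]; ring

theorem mem_symmDiffSpan_cons {n : ℕ} {A B : Finset (Fin n)} {L : List (Finset (Fin n))} :
    B ∈ symmDiffSpan (A :: L) ↔ B ∈ symmDiffSpan L ∨ A ∆ B ∈ symmDiffSpan L := by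
  rw [symmDiffSpan, List.mem_append, List.mem_map]
  refine or_congr Iff.rfl ⟨?_, fun h => ⟨_, h, symmDiff_symmDiff_cancel_left A B⟩⟩
  rintro ⟨D, hD, rfl⟩
  rwa [symmDiff_symmDiff_cancel_left]

theorem symmDiff_mem_symmDiffSpan {n : ℕ} {L : List (Finset (Fin n))} :
    ∀ {A B : Finset (Fin n)}, A ∈ symmDiffSpan L → B ∈ symmDiffSpan L → A ∆ B ∈ symmDiffSpan L := by
  induction L with
  | nil =>
    intro A B hA hB
    simp only [symmDiffSpan, List.mem_singleton] at *
    rw [hA, hB]; simp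
  | cons D L ih =>
    intro A B hA hB
    rw [mem_symmDiffSpan_cons] at *
    rcases hA with hA | hA <;> rcases hB with hB | hB
    · exact Or.inl (ih hA hB)
    · right; rw [symmDiff_left_comm]; exact ih hA hB
    · right; rw [← symmDiff_assoc]; exact ih hA hB
    · left
      have := ih hA hB
      rwa [symmDiff_symmDiff_symmDiff_comm, symmDiff_self, bot_symmDiff] at this

theorem SymmDiffIndep.nodup {n : ℕ} {L : List (Finset (Fin n))} (h : SymmDiffIndep L) :
    (symmDiffSpan L).Nodup := by
  induction L with
  | nil => simp [symmDiffSpan]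
  | cons A L ih =>
    rw [symmDiffSpan, List.nodup_append']
    refine ⟨ih h.2, (ih h.2).map (symmDiff_right_injective A), ?_⟩
    intro B hB hB'
    obtain ⟨D, hD, rfl⟩ := List.mem_map.1 hB'
    apply h.1
    have := symmDiff_mem_symmDiffSpan hB hD
    rwa [symmDiff_symmDiff_cancel_right] at this

theorem SymmDiffIndep.card {n : ℕ} {L : List (Finset (Fin n))} (h : SymmDiffIndep L) :
    (symmDiffSpan L).toFinset.card = 2 ^ L.length := by
  rw [List.toFinset_card_of_nodup h.nodup, length_symmDiffSpan]

theorem mem_of_mem_symmDiffSpan {n : ℕ} {L : List (Finset (Fin n))} {P : Finset (Fin n) → Prop}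
    (h0 : P ∅) (hL : ∀ A ∈ L, P A) (hadd : ∀ A B, P A → P B → P (A ∆ B)) :
    ∀ B ∈ symmDiffSpan L, P B := by
  induction L with
  | nil =>
    intro B hB
    rw [symmDiffSpan, List.mem_singleton] at hB
    rwa [hB]
  | cons A L ih =>
    have ih' := ih fun D hD => hL D (List.mem_cons_of_mem _ hD)
    intro B hB
    rw [mem_symmDiffSpan_cons] at hB
    rcases hB with hB | hB
    · exact ih' B hB
    · rw [← symmDiff_symmDiff_cancel_left A B]
      exact hadd _ _ (hL A List.mem_cons_self) (ih' _ hB)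

theorem exists_coef_mono_mul (A B : Finset (Fin (p + q))) : ∃ u : ℤˣ, ∀ x : Cl p q,
    coef B (mono p q A * x) = (u : ℤ) • coef (A ∆ B) x := by
  obtain ⟨u, hu⟩ := exists_mono_mul_mono A B
  refine ⟨u * (sqSign A), fun x => ?_⟩
  have h1 : adj (mono p q (A ∆ B)) = (u : ℤ) • (adj (mono p q B) * adj (mono p q A)) := by
    rw [← adj_mul, hu, map_zsmul, units_zsmul_self]
  rw [coef_apply, coef_apply, h1, smul_mul_assoc, map_zsmul, smul_smul, adj_mono A, mul_smul_comm,
    smul_mul_assoc, map_zsmul, smul_smul, ← mul_assoc, ← Units.val_mul, ← Units.val_mul]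
  have : u * sqSign A * u * sqSign A = 1 := by
    rw [mul_right_comm u, mul_assoc, Int.units_mul_self, Int.units_mul_self, mul_one]
  rw [this, Units.val_one, one_smul]

/-- By independence a further factor `½(1 + e_A)` adds only monomials outside the previous span, so
it just halves the trace. In particular the product is not zero. -/
theorem halfSum_list_prod {L : List (Finset (Fin (p + q)))} (h : SymmDiffIndep L) :
    (∀ B ∉ symmDiffSpan L, coef B (L.map fun A => halfSum A 1).prod = 0) ∧
      tr (L.map fun A => halfSum A 1).prod = (1 / 2) ^ L.length := by
  induction L with
  | nil =>
    refine ⟨fun B hB => ?_, by simp [tr_one]⟩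
    rw [symmDiffSpan, List.mem_singleton] at hB
    rw [List.map_nil, List.prod_nil, ← mono_empty, coef_mono, if_neg hB]
  | cons A L ih =>
    obtain ⟨ih1, ih2⟩ := ih h.2
    rw [List.map_cons, List.prod_cons, halfSum_mul]
    constructor
    · intro B hB
      rw [mem_symmDiffSpan_cons, not_or] at hB
      obtain ⟨u, hu⟩ := exists_coef_mono_mul A B
      rw [map_smul, map_add, map_zsmul, hu, ih1 B hB.1, ih1 _ hB.2]
      simp
    · obtain ⟨u, hu⟩ := exists_coef_mono_mul A ∅
      have h1 : A ∆ ∅ = A := symmDiff_bot A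
      rw [map_smul, map_add, map_zsmul, ← coef_empty (_ * _), hu, h1, ih1 A h.1, ih2,
        List.length_cons, pow_succ]
      simp
      ring

/-! ### Subgroups generated by monomials -/

theorem exists_veeElt_mem {K : Subgroup (veeGroup p q)} {L : List (Finset (Fin (p + q)))}
    (hL : ∀ A ∈ L, ∃ u, veeElt u A ∈ K) : ∀ B ∈ symmDiffSpan L, ∃ u, veeElt u B ∈ K := by
  refine mem_of_mem_symmDiffSpan ⟨1, ?_⟩ hL ?_
  · rw [veeElt_one_empty]; exact K.one_mem
  · rintro A B ⟨u, hu⟩ ⟨v, hv⟩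
    obtain ⟨w, hw⟩ := exists_veeElt_mul u v A B
    exact ⟨_, hw ▸ K.mul_mem hu hv⟩

theorem pow_le_card {K : Subgroup (veeGroup p q)} {L : List (Finset (Fin (p + q)))}
    (hi : SymmDiffIndep L) (hL : ∀ A ∈ L, ∃ u, veeElt u A ∈ K) :
    2 ^ L.length ≤ Nat.card K := by
  have h : ∀ B : (symmDiffSpan L).toFinset, ∃ u, veeElt u B.1 ∈ K := fun B =>
    exists_veeElt_mem hL B.1 (List.mem_toFinset.1 B.2)
  choose u hu using h
  rw [← hi.card, ← Fintype.card_coe, ← Nat.card_eq_fintype_card]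
  exact Nat.card_le_card_of_injective
    (fun B : (symmDiffSpan L).toFinset => (⟨veeElt (u B) B.1, hu B⟩ : K))
    fun A B hAB => Subtype.ext (veeElt_inj (congrArg Subtype.val hAB)).2

theorem two_mul_pow_le_card {K : Subgroup (veeGroup p q)} {L : List (Finset (Fin (p + q)))}
    (hi : SymmDiffIndep L) (hL : ∀ A ∈ L, ∃ u, veeElt u A ∈ K) (hneg : veeElt (-1) ∅ ∈ K) :
    2 * 2 ^ L.length ≤ Nat.card K := by
  have h : ∀ B : (symmDiffSpan L).toFinset, ∀ v, veeElt v B.1 ∈ K := fun B v => by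
    obtain ⟨u, hu⟩ := exists_veeElt_mem hL B.1 (List.mem_toFinset.1 B.2)
    have h1 : veeElt (-u) B.1 ∈ K := by
      have := K.mul_mem hneg hu
      convert this using 1
      refine vee_ext ?_
      rw [Subgroup.coe_mul, Units.val_mul, coe_veeElt, coe_veeElt, coe_veeElt, mono_empty]
      simp
    rcases Int.units_eq_one_or u with e | e <;> rcases Int.units_eq_one_or v with e' | e' <;>
      subst e e' <;> simpa using by first | exact hu | exact h1
  have h2 : Nat.card (ℤˣ × (symmDiffSpan L).toFinset) = 2 * 2 ^ L.length := by
    rw [← hi.card, Nat.card_prod, ← Fintype.card_coe, ← Nat.card_eq_fintype_card]; simp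
  rw [← h2]
  exact Nat.card_le_card_of_injective
    (fun x : ℤˣ × (symmDiffSpan L).toFinset => (⟨veeElt x.1 x.2.1, h x.2 x.1⟩ : K))
    fun A B hAB => by
      obtain ⟨h1, h2⟩ := veeElt_inj (congrArg Subtype.val hAB)
      exact Prod.ext h1 (Subtype.ext h2)

theorem orderOf_mono_of_one {A : Finset (Fin (p + q))} (h : sqSign A = 1) (hA : A ≠ ∅) :
    orderOf (mono p q A) = 2 := by
  rw [orderOf_eq_prime_iff]
  refine ⟨by rw [sq, mono_mul_self, h]; simp, fun h1 => ?_⟩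
  rw [← mono_empty] at h1
  exact hA (mono_injective_up_to_sign (u := 1) (v := 1) (by rw [h1])).1

theorem orderOf_neg_one_cl : orderOf (-1 : Cl p q) = 2 := by
  rw [orderOf_eq_prime_iff]
  exact ⟨by simp, fun h => one_ne_zero_cl (eq_zero_of_eq_neg h.symm)⟩

theorem orderOf_mono_of_neg_one {A : Finset (Fin (p + q))} (h : sqSign A = -1) :
    orderOf (mono p q A) = 4 := by
  have h1 : mono p q A ^ 2 = -1 := by rw [sq, mono_mul_self, h]; simp
  have := orderOf_eq_prime_pow (x := mono p q A) (p := 2) (n := 1)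
    (by rw [pow_one, h1]; exact fun h => one_ne_zero_cl (eq_zero_of_eq_neg h.symm))
    (by rw [show 2 ^ (1 + 1) = 2 * 2 from rfl, pow_mul, h1]; simp)
  simpa using this

/-! ### The tabulated examples -/

namespace Row

/-- The index sets of the commuting monomials of a row. -/
def sets (r : Row) : List (Finset (Fin (r.p + r.q))) := r.T.map (idx (r.p + r.q))

/-- The index sets of the generators of a row. -/
def genSets (r : Row) : List (Finset (Fin (r.p + r.q))) := r.gens.map fun l => idx (r.p + r.q) l.1

/-- The combinatorial properties of a row. -/
def Valid (r : Row) : Prop :=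
  ((r.p : ℤ) - r.q) % 4 = 1 ∧ r.p + r.q ≤ 9 ∧
    (r.T.length : ℤ) = (r.q : ℤ) - radonHurwitz ((r.q : ℤ) - r.p) ∧
    (∀ A ∈ r.sets, sqSign A = 1 ∧ ∀ B ∈ r.sets, commSign A B = 1) ∧
    SymmDiffIndep r.sets ∧ Finset.univ ∈ symmDiffSpan r.sets ∧
    SymmDiffIndep r.genSets ∧ (∀ A ∈ r.genSets, ∀ B ∈ r.sets, commSign A B = 1) ∧
    ∀ l ∈ r.gens, (sqSign (idx (r.p + r.q) l.1) = 1 ∧ idx (r.p + r.q) l.1 ≠ ∅ ∧ l.2 = 2) ∨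
      (sqSign (idx (r.p + r.q) l.1) = -1 ∧ l.2 = 4)

theorem family_mem (r : Row) (i : Fin r.T.length) : r.family i ∈ r.sets :=
  List.mem_map.2 ⟨_, List.get_mem _ _, rfl⟩

theorem exists_family {r : Row} {A : Finset (Fin (r.p + r.q))} (hA : A ∈ r.sets) :
    ∃ i, r.family i = A := by
  obtain ⟨l, hl, rfl⟩ := List.mem_map.1 hA
  obtain ⟨i, rfl⟩ := List.get_of_mem hl
  exact ⟨i, rfl⟩

theorem f_eq (r : Row) : r.f = (r.sets.map fun A => halfSum A 1).prod := by
  unfold f sets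
  rw [idem_eq, List.map_map, ← List.ofFn_getElem_eq_map]
  rfl

namespace Valid

variable {r : Row}

theorem admissible (h : r.Valid) : Admissible r.family :=
  ⟨fun i => (h.2.2.2.1 _ (r.family_mem i)).1,
    fun i j => (h.2.2.2.1 _ (r.family_mem i)).2 _ (r.family_mem j)⟩

theorem sqSign_univ (h : r.Valid) : sqSign (Finset.univ : Finset (Fin (r.p + r.q))) = 1 :=
  CliffordVee.sqSign_univ h.1 h.2.1

theorem f_ne_zero (h : r.Valid) : r.f ≠ 0 := by
  intro h0
  have h1 := (halfSum_list_prod h.2.2.2.2.1).2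
  rw [← f_eq, h0, map_zero] at h1
  exact absurd h1 (by positivity)

theorem mono_mul_f (h : r.Valid) (i : Fin r.T.length) : mono r.p r.q (r.family i) * r.f = r.f := by
  have := h.admissible.mono_mul_idem (ε := fun _ => 1) i
  rwa [Units.val_one, one_smul] at this

theorem mem_fixSet (h : r.Valid) : ∀ B ∈ symmDiffSpan r.sets, B ∈ fixSet r.f := by
  refine mem_of_mem_symmDiffSpan (empty_mem_fixSet _) (fun A hA => ?_)
    fun A B hA hB => symmDiff_mem_fixSet hA hB
  obtain ⟨i, rfl⟩ := exists_family hA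
  exact CliffordVee.mem_fixSet.2 ⟨_, h.admissible.mono_mul_idem i⟩

theorem pow_le_card_fixSet (h : r.Valid) : 2 ^ r.T.length ≤ (fixSet r.f).card := by
  have h1 := h.2.2.2.2.1.card
  have h2 : r.sets.length = r.T.length := List.length_map _
  rw [h2] at h1
  rw [← h1]
  exact Finset.card_le_card fun B hB => h.mem_fixSet B (List.mem_toFinset.1 hB)

theorem isPrimitiveIdempotent_of_one (h : r.Valid) (hr : ((r.p : ℤ) - r.q) % 8 = 1) :
    IsPrimitiveIdempotent r.f :=
  isPrimitiveIdempotent_of_real (real_numerics hr h.2.1 h.2.2.1).1 h.admissible h.f_ne_zero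
    h.sqSign_univ (h.mem_fixSet _ h.2.2.2.2.2.1) h.pow_le_card_fixSet

theorem isPrimitiveIdempotent_of_five (h : r.Valid) (hr : ((r.p : ℤ) - r.q) % 8 = 5) :
    IsPrimitiveIdempotent r.f :=
  isPrimitiveIdempotent_of_quaternionic (quaternionic_numerics hr h.2.1 h.2.2.1).1
    (quaternionic_numerics hr h.2.1 h.2.2.1).2.2 h.admissible h.f_ne_zero
    h.sqSign_univ (h.mem_fixSet _ h.2.2.2.2.2.1) h.pow_le_card_fixSet

/-- The generated group fixes `f`, which bounds its order above by the size of `fixSet`;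
independence gives the same bound from below. -/
theorem isCommutingFamily (h : r.Valid) (hc : (fixSet r.f).card = 2 ^ r.T.length) :
    IsCommutingFamily r.family := by
  refine ⟨h.2.2.1, fun i => ?_, fun i j => ?_, ?_⟩
  · rw [mono_mul_self, h.admissible.sq, Units.val_one, one_smul]
  · rw [mono_mul_mono_comm, h.admissible.comm, Units.val_one, one_smul]
  · let S : Set (veeGroup r.p r.q) :=
      {g | ∃ i, ((g : (Cl r.p r.q)ˣ) : Cl r.p r.q) = mono r.p r.q (r.family i)}
    have hS : {u : (Cl r.p r.q)ˣ | ∃ i, (u : Cl r.p r.q) = mono r.p r.q (r.family i)} =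
        (veeGroup r.p r.q).subtype '' S := by
      ext u
      constructor
      · rintro ⟨i, hi⟩
        exact ⟨⟨u, _, Or.inl hi⟩, ⟨i, hi⟩, rfl⟩
      · rintro ⟨g, ⟨i, hi⟩, rfl⟩
        exact ⟨i, hi⟩
    rw [hS, ← MonoidHom.map_closure, Subgroup.card_map_of_injective (Subgroup.subtype_injective _)]
    refine le_antisymm ?_ ?_
    · rw [← hc, ← card_fixGroup h.f_ne_zero]
      refine Nat.card_mono (Set.toFinite _) ?_
      rw [SetLike.coe_subset_coe, Subgroup.closure_le]
      rintro g ⟨i, hi⟩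
      change _ * _ = _
      rw [hi, h.mono_mul_f]
    · have h2 : r.sets.length = r.T.length := List.length_map _
      rw [← h2]
      refine pow_le_card h.2.2.2.2.1 fun A hA => ?_
      obtain ⟨i, rfl⟩ := exists_family hA
      exact ⟨1, Subgroup.subset_closure ⟨i, by rw [coe_veeElt]; simp⟩⟩

/-- The generators lie in the stabilizer, and their independence together with `-1` makes the group
they generate at least as large. -/
theorem stab_eq_closure (h : r.Valid) (hc : (commSet r.family).card = 2 ^ r.gens.length)
    {S : Set (veeGroup r.p r.q)} (hneg : veeElt (-1) ∅ ∈ Subgroup.closure S)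
    (hS : ∀ g ∈ S, ((g : (Cl r.p r.q)ˣ) : Cl r.p r.q) = -1 ∨
      ∃ l ∈ r.gens, ((g : (Cl r.p r.q)ˣ) : Cl r.p r.q) = mono r.p r.q (idx (r.p + r.q) l.1))
    (hS' : ∀ l ∈ r.gens, veeElt 1 (idx (r.p + r.q) l.1) ∈ S) :
    stab r.f = Subgroup.closure S := by
  have hstab := veeElt_mem_stab h.admissible (ε := fun _ => 1) h.f_ne_zero
  refine (Subgroup.eq_of_le_of_card_ge ?_ ?_).symm
  · rw [Subgroup.closure_le]
    intro g hg
    rcases hS g hg with hg | ⟨l, hl, hg⟩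
    · have : g = veeElt (-1) ∅ := vee_ext (by rw [hg, coe_veeElt]; simp [mono_empty])
      rw [this]
      exact (hstab _ _).2 (mem_commSet.2 fun i => by rw [commSign_comm, commSign_empty])
    · have : g = veeElt 1 (idx (r.p + r.q) l.1) := vee_ext (by rw [hg, coe_veeElt]; simp)
      rw [this]
      exact (hstab _ _).2 (mem_commSet.2 fun i =>
        h.2.2.2.2.2.2.2.1 _ (List.mem_map.2 ⟨l, hl, rfl⟩) _ (r.family_mem i))
  · have h1 := card_stab h.admissible (ε := fun _ => 1) h.f_ne_zero
    have h2 : r.genSets.length = r.gens.length := List.length_map _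
    rw [hc, ← h2] at h1
    refine h1.le.trans (two_mul_pow_le_card h.2.2.2.2.2.2.1 (fun A hA => ?_) hneg)
    obtain ⟨l, hl, rfl⟩ := List.mem_map.1 hA
    exact ⟨1, Subgroup.subset_closure (hS' l hl)⟩

theorem orderOf_gens (h : r.Valid) :
    ∀ l ∈ r.gens, orderOf (mono r.p r.q (idx (r.p + r.q) l.1)) = l.2 := by
  intro l hl
  rcases h.2.2.2.2.2.2.2.2 l hl with ⟨h1, h2, h3⟩ | ⟨h1, h3⟩
  · rw [h3, orderOf_mono_of_one h1 h2]
  · rw [h3, orderOf_mono_of_neg_one h1]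

end Valid

end Row

/-! ### Index sets as bit masks -/

/-- The index set with bit mask `m`: the index `i` corresponds to the bit `i + 1`. -/
def ofMask (n m : ℕ) : Finset (Fin n) := Finset.univ.filter fun i => m.testBit (i + 1)

theorem mem_ofMask {n m : ℕ} {i : Fin n} : i ∈ ofMask n m ↔ m.testBit (i + 1) := by
  simp [ofMask]

/-- The bit mask of a list of numbers. -/
def listMask (l : List ℕ) : ℕ := l.foldr (fun a m => 2 ^ a ||| m) 0

theorem testBit_listMask (l : List ℕ) (j : ℕ) : (listMask l).testBit j ↔ j ∈ l := by
  induction l with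
  | nil => simp [listMask]
  | cons a l ih =>
    have : listMask (a :: l) = 2 ^ a ||| listMask l := rfl
    rw [this, Nat.testBit_or, Nat.testBit_two_pow, Bool.or_eq_true, ih, decide_eq_true_eq,
      List.mem_cons, eq_comm]

theorem idx_eq_ofMask (n : ℕ) (l : List ℕ) : idx n l = ofMask n (listMask l) := by
  ext i
  rw [mem_ofMask, testBit_listMask]
  simp [idx]

theorem ofMask_xor (n a b : ℕ) : ofMask n (a ^^^ b) = ofMask n a ∆ ofMask n b := by
  ext i
  rw [Finset.mem_symmDiff, mem_ofMask, mem_ofMask, mem_ofMask, Nat.testBit_xor]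
  cases a.testBit (i + 1) <;> cases b.testBit (i + 1) <;> simp

theorem ofMask_and (n a b : ℕ) : ofMask n (a &&& b) = ofMask n a ∩ ofMask n b := by
  ext i
  rw [Finset.mem_inter, mem_ofMask, mem_ofMask, mem_ofMask, Nat.testBit_and, Bool.and_eq_true]

/-- The number of the bits `l + 1, …, n` in the mask `m`. -/
def bitCount (l m : ℕ) : ℕ → ℕ
  | 0 => 0
  | n + 1 => bitCount l m n + if l ≤ n ∧ m.testBit (n + 1) then 1 else 0

theorem card_filter_ofMask (l n m : ℕ) :
    ((ofMask n m).filter fun i : Fin n => l ≤ (i : ℕ)).card = bitCount l m n := by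
  unfold ofMask
  rw [Finset.filter_filter, Finset.card_filter]
  induction n with
  | zero => rfl
  | succ n ih =>
    rw [Fin.sum_univ_castSucc, bitCount, ← ih]
    simp only [Fin.val_castSucc, Fin.val_last, and_comm]

theorem card_ofMask (n m : ℕ) : (ofMask n m).card = bitCount 0 m n := by
  rw [← card_filter_ofMask]; simp

/-- The exclusive disjunctions of the sublists of a list of masks. -/
def maskSpan : List ℕ → List ℕ
  | [] => [0]
  | a :: L => maskSpan L ++ (maskSpan L).map (a ^^^ ·)

/-- No mask of the list is an exclusive disjunction of later ones. -/
def maskIndep (n : ℕ) : List ℕ → Bool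
  | [] => true
  | a :: L => (maskSpan L).all (fun b => bitCount 0 (a ^^^ b) n != 0) && maskIndep n L

theorem symmDiffSpan_map_ofMask (n : ℕ) (L : List ℕ) :
    symmDiffSpan (L.map (ofMask n)) = (maskSpan L).map (ofMask n) := by
  induction L with
  | nil =>
    have : ofMask n 0 = ∅ := by ext i; simp [mem_ofMask]
    simp [symmDiffSpan, maskSpan, this]
  | cons a L ih =>
    rw [List.map_cons, symmDiffSpan, maskSpan, ih, List.map_append, List.map_map, List.map_map]
    congr 2
    ext b
    simp [ofMask_xor]

theorem symmDiffIndep_of_maskIndep {n : ℕ} {L : List ℕ} (h : maskIndep n L) :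
    SymmDiffIndep (L.map (ofMask n)) := by
  induction L with
  | nil => trivial
  | cons a L ih =>
    rw [maskIndep, Bool.and_eq_true, List.all_eq_true] at h
    refine ⟨fun ha => ?_, ih h.2⟩
    rw [symmDiffSpan_map_ofMask, List.mem_map] at ha
    obtain ⟨b, hb, hab⟩ := ha
    have h1 := h.1 b hb
    rw [← card_ofMask, ofMask_xor, hab, symmDiff_self] at h1
    simp at h1

/-- The parity of the exponent in `commSign`. -/
def commExponent (n a b : ℕ) : ℕ := bitCount 0 a n * bitCount 0 b n + bitCount 0 (a &&& b) n

theorem commSign_ofMask {n a b : ℕ} (h : commExponent n a b % 2 = 0) :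
    commSign (ofMask n a) (ofMask n b) = 1 := by
  unfold commSign
  rw [card_ofMask, card_ofMask, ← ofMask_and, card_ofMask]
  exact (Nat.even_iff.2 h).neg_one_pow

/-- The parity of the exponent in `sqSign`. -/
def sqExponent (p n a : ℕ) : ℕ := bitCount 0 a n * (bitCount 0 a n - 1) / 2 + bitCount p a n

theorem sqSign_ofMask {p q a : ℕ} (h : sqExponent p (p + q) a % 2 = 0) :
    sqSign (ofMask (p + q) a) = 1 := by
  unfold sqSign
  rw [card_ofMask, card_filter_ofMask, Nat.choose_two_right]
  exact (Nat.even_iff.2 h).neg_one_pow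

theorem sqSign_ofMask_odd {p q a : ℕ} (h : sqExponent p (p + q) a % 2 = 1) :
    sqSign (ofMask (p + q) a) = -1 := by
  unfold sqSign
  rw [card_ofMask, card_filter_ofMask, Nat.choose_two_right]
  exact (Nat.odd_iff.2 h).neg_one_pow

namespace Row

/-- The masks of the commuting monomials of a row. -/
def masks (r : Row) : List ℕ := r.T.map listMask

/-- The masks of the generators of a row. -/
def genMasks (r : Row) : List ℕ := r.gens.map fun l => listMask l.1

theorem sets_eq (r : Row) : r.sets = r.masks.map (ofMask (r.p + r.q)) := by
  rw [masks, List.map_map, sets]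
  exact List.map_congr_left fun l _ => idx_eq_ofMask _ l

theorem genSets_eq (r : Row) : r.genSets = r.genMasks.map (ofMask (r.p + r.q)) := by
  rw [genMasks, List.map_map, genSets]
  exact List.map_congr_left fun l _ => idx_eq_ofMask _ l.1

/-- Replaces computations with finite sets by bit arithmetic on numerals, which the kernel evaluates
for each table. -/
theorem valid_of_masks {r : Row} (h1 : ((r.p : ℤ) - r.q) % 4 = 1) (h2 : r.p + r.q ≤ 9)
    (h3 : (r.T.length : ℤ) = (r.q : ℤ) - radonHurwitz ((r.q : ℤ) - r.p))
    (h4 : ∀ a ∈ r.masks, sqExponent r.p (r.p + r.q) a % 2 = 0)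
    (h5 : ∀ a ∈ r.masks, ∀ b ∈ r.masks, commExponent (r.p + r.q) a b % 2 = 0)
    (h6 : maskIndep (r.p + r.q) r.masks)
    (h7 : ∃ a ∈ maskSpan r.masks, bitCount 0 a (r.p + r.q) = r.p + r.q)
    (h8 : maskIndep (r.p + r.q) r.genMasks)
    (h9 : ∀ a ∈ r.genMasks, ∀ b ∈ r.masks, commExponent (r.p + r.q) a b % 2 = 0)
    (h10 : ∀ l ∈ r.gens,
      (sqExponent r.p (r.p + r.q) (listMask l.1) % 2 = 0 ∧
        bitCount 0 (listMask l.1) (r.p + r.q) ≠ 0 ∧ l.2 = 2) ∨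
      (sqExponent r.p (r.p + r.q) (listMask l.1) % 2 = 1 ∧ l.2 = 4)) : r.Valid := by
  refine ⟨h1, h2, h3, ?_, ?_, ?_, ?_, ?_, ?_⟩
  · rw [sets_eq, List.forall_mem_map]
    intro a ha
    rw [List.forall_mem_map]
    exact ⟨sqSign_ofMask (h4 a ha), fun b hb => commSign_ofMask (h5 a ha b hb)⟩
  · rw [sets_eq]; exact symmDiffIndep_of_maskIndep h6
  · obtain ⟨a, ha, hc⟩ := h7
    rw [sets_eq, symmDiffSpan_map_ofMask, List.mem_map]
    refine ⟨a, ha, ?_⟩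
    rw [← Finset.card_eq_iff_eq_univ, card_ofMask, hc, Fintype.card_fin]
  · rw [genSets_eq]; exact symmDiffIndep_of_maskIndep h8
  · rw [genSets_eq, sets_eq, List.forall_mem_map]
    intro a ha
    rw [List.forall_mem_map]
    exact fun b hb => commSign_ofMask (h9 a ha b hb)
  · intro l hl
    rw [idx_eq_ofMask]
    rcases h10 l hl with ⟨h, h', h''⟩ | ⟨h, h'⟩
    · refine Or.inl ⟨sqSign_ofMask h, ?_, h''⟩
      rw [Ne, ← Finset.card_eq_zero, card_ofMask]
      exact h'
    · exact Or.inr ⟨sqSign_ofMask_odd h, h'⟩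

end Row

theorem realTable_valid : ∀ r ∈ realTable,
    r.Valid ∧ ((r.p : ℤ) - r.q) % 8 = 1 ∧ r.gens.length = r.T.length := by
  intro r hr
  refine ⟨Row.valid_of_masks ?_ ?_ ?_ ?_ ?_ ?_ ?_ ?_ ?_ ?_, ?_, ?_⟩ <;> revert r <;>
    decide +kernel

theorem quaternionicTable_valid : ∀ r ∈ quaternionicTable,
    r.Valid ∧ ((r.p : ℤ) - r.q) % 8 = 5 ∧ r.gens.length = r.T.length + 2 ∧
      ∃ l ∈ r.gens, sqSign (idx (r.p + r.q) l.1) = -1 := by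
  intro r hr
  have h : ∃ l ∈ r.gens, sqExponent r.p (r.p + r.q) (listMask l.1) % 2 = 1 := by
    revert r; decide +kernel
  obtain ⟨l, hl, h⟩ := h
  refine ⟨Row.valid_of_masks ?_ ?_ ?_ ?_ ?_ ?_ ?_ ?_ ?_ ?_, ?_, ?_,
    ⟨l, hl, by rw [idx_eq_ofMask]; exact sqSign_ofMask_odd h⟩⟩ <;> clear h hl l <;> revert r <;>
    decide +kernel

theorem realTable_conclusion : ∀ r ∈ realTable,
    IsCommutingFamily r.family ∧ IsPrimitiveIdempotent r.f ∧
    stab r.f = Subgroup.closure {g : veeGroup r.p r.q | ((g : (Cl r.p r.q)ˣ) : Cl r.p r.q) = -1 ∨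
      ∃ l ∈ r.gens, ((g : (Cl r.p r.q)ˣ) : Cl r.p r.q) = mono r.p r.q (idx (r.p + r.q) l.1)} ∧
    orderOf (-1 : Cl r.p r.q) = 2 ∧
    ∀ l ∈ r.gens, orderOf (mono r.p r.q (idx (r.p + r.q) l.1)) = l.2 := by
  intro r hr
  obtain ⟨hv, h1, hl⟩ := realTable_valid r hr
  have hp := hv.isPrimitiveIdempotent_of_one h1
  obtain ⟨hn, hs⟩ := real_numerics h1 hv.2.1 hv.2.2.1
  obtain ⟨hH, hC⟩ := card_real hn hs hv.admissible hp hv.sqSign_univ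
  refine ⟨hv.isCommutingFamily hH, hp, ?_, orderOf_neg_one_cl, hv.orderOf_gens⟩
  refine hv.stab_eq_closure (by rw [hC, hl]) ?_ (fun g hg => hg) fun l hl => ?_
  · exact Subgroup.subset_closure (Or.inl (by rw [coe_veeElt]; simp [mono_empty]))
  · exact Or.inr ⟨l, hl, by rw [coe_veeElt]; simp⟩

theorem quaternionicTable_conclusion : ∀ r ∈ quaternionicTable,
    IsCommutingFamily r.family ∧ IsPrimitiveIdempotent r.f ∧
    stab r.f = Subgroup.closure {g : veeGroup r.p r.q |
      ∃ l ∈ r.gens, ((g : (Cl r.p r.q)ˣ) : Cl r.p r.q) = mono r.p r.q (idx (r.p + r.q) l.1)} ∧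
    ∀ l ∈ r.gens, orderOf (mono r.p r.q (idx (r.p + r.q) l.1)) = l.2 := by
  intro r hr
  obtain ⟨hv, h1, hl, l₀, hl₀, hneg⟩ := quaternionicTable_valid r hr
  have hp := hv.isPrimitiveIdempotent_of_five h1
  obtain ⟨hn, hk, hs⟩ := quaternionic_numerics h1 hv.2.1 hv.2.2.1
  obtain ⟨hH, hC⟩ := card_quaternionic hn hs hv.admissible hp hv.sqSign_univ
  refine ⟨hv.isCommutingFamily hH, hp, ?_, hv.orderOf_gens⟩
  refine hv.stab_eq_closure (by rw [hC, hl]) ?_ (fun g hg => Or.inr hg) fun l hl => ?_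
  -- `-1` is not a listed generator here; it is the square of one of order four.
  · rw [← veeElt_mul_self_of_neg_one hneg 1]
    have : veeElt 1 (idx (r.p + r.q) l₀.1) ∈ Subgroup.closure {g : veeGroup r.p r.q |
      ∃ l ∈ r.gens, ((g : (Cl r.p r.q)ˣ) : Cl r.p r.q) = mono r.p r.q (idx (r.p + r.q) l.1)} :=
      Subgroup.subset_closure ⟨l₀, hl₀, by rw [coe_veeElt]; simp⟩
    exact Subgroup.mul_mem _ this this
  · exact ⟨l, hl, by rw [coe_veeElt]; simp⟩

/-! ### The group `F₃` -/

/-- The generators multiply to all monomials, and `e₁² = -1` supplies the negatives. -/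
theorem F3_eq_veeGroup : F3 = veeGroup 0 3 := by
  have hgen : ∀ i : Fin (0 + 3), ∃ u : (Cl 0 3)ˣ, (u : Cl 0 3) = gen 0 3 i ∧ u ∈ F3 := fun i =>
    ⟨veeElt 1 {i}, by rw [coe_veeElt, mono_singleton]; simp,
      Subgroup.subset_closure ⟨i, by rw [coe_veeElt, mono_singleton]; simp⟩⟩
  apply le_antisymm
  · unfold F3
    rw [Subgroup.closure_le]
    rintro u ⟨i, hi⟩
    exact ⟨{i}, Or.inl (by rw [hi, mono_singleton])⟩
  · have hmono : ∀ A, ∃ u : (Cl 0 3)ˣ, (u : Cl 0 3) = mono 0 3 A ∧ u ∈ F3 := by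
      intro A
      induction A using Finset.induction_on_min with
      | empty => exact ⟨1, mono_empty.symm, F3.one_mem⟩
      | insert a s hs ih =>
        obtain ⟨u, hu, hu'⟩ := ih
        obtain ⟨v, hv, hv'⟩ := hgen a
        exact ⟨v * u, by rw [Units.val_mul, hu, hv, mono_insert hs], F3.mul_mem hv' hu'⟩
    have hneg : (-1 : (Cl 0 3)ˣ) ∈ F3 := by
      obtain ⟨u, hu, hu'⟩ := hgen 0
      have : (-1 : (Cl 0 3)ˣ) = u * u := Units.ext (by
        rw [Units.val_mul, hu, gen_mul_self]; simp [weight])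
      rw [this]
      exact F3.mul_mem hu' hu'
    rintro u ⟨A, hA | hA⟩ <;> obtain ⟨v, hv, hv'⟩ := hmono A
    · rwa [show u = v from Units.ext (by rw [hA, hv])]
    · rw [show u = -1 * v from Units.ext (by rw [hA, Units.val_mul, hv]; simp)]
      exact F3.mul_mem hneg hv'

/-- `F₃` is itself a stabilizer: in `Cl_{0,3}` the family consists of the central `e_{123}`, so the
stabilizer is the whole vee group, and the structure result applies with `k = 1`. -/
theorem nonempty_F3_mulEquiv :
    Nonempty (F3 ≃* QuaternionGroup 2 × Multiplicative (Fin 1 → ZMod 2)) := by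
  let r : Row := ⟨0, 3, [[1, 2, 3]], [([1], 4), ([2], 4), ([3], 4)]⟩
  obtain ⟨hv, h1, -⟩ := quaternionicTable_valid r List.mem_cons_self
  obtain ⟨hn, hk, hs⟩ := quaternionic_numerics h1 hv.2.1 hv.2.2.1
  obtain ⟨e⟩ := nonempty_stab_mulEquiv hn hs hv.sqSign_univ hv.admissible
    (hv.isPrimitiveIdempotent_of_five h1)
  have htop : stab r.f = ⊤ := by
    rw [eq_top_iff]
    intro g _
    obtain ⟨u, A, rfl⟩ := exists_veeElt g
    refine (veeElt_mem_stab hv.admissible hv.f_ne_zero u A).2 (mem_commSet.2 fun i => ?_)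
    have hi : r.family i = Finset.univ := by
      have : ∀ i : Fin r.T.length, r.family i = Finset.univ := by decide
      exact this i
    rw [hi]
    exact commSign_univ (by decide) A
  exact ⟨(MulEquiv.subgroupCongr F3_eq_veeGroup).trans
    (Subgroup.topEquiv.symm.trans ((MulEquiv.subgroupCongr htop.symm).trans e))⟩

/-- The generator `e_{i+1}` of `F₃`. -/
noncomputable def F3gen (i : Fin (0 + 3)) : F3 :=
  ⟨veeElt 1 {i}, Subgroup.subset_closure ⟨i, by rw [coe_veeElt, mono_singleton]; simp⟩⟩

theorem coe_F3gen (i : Fin (0 + 3)) : ((F3gen i : (Cl 0 3)ˣ) : Cl 0 3) = mono 0 3 {i} := by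
  change ((veeElt 1 {i} : (Cl 0 3)ˣ) : Cl 0 3) = _
  rw [coe_veeElt]; simp

theorem orderOf_F3gen (i : Fin (0 + 3)) : orderOf (F3gen i) = 4 := by
  rw [← Subgroup.orderOf_coe, ← orderOf_units, coe_F3gen]
  refine orderOf_mono_of_neg_one ?_
  revert i; decide

theorem F3gen_injective : Function.Injective F3gen := by
  intro i j h
  have h1 := congrArg (fun g : F3 => ((g : (Cl 0 3)ˣ) : Cl 0 3)) h
  simp only [coe_F3gen] at h1
  exact Finset.singleton_injective
    (mono_injective_up_to_sign (u := 1) (v := 1) (by rw [h1])).1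

theorem F3_nonabelian : F3gen 0 * F3gen 1 ≠ F3gen 1 * F3gen 0 := by
  intro h
  have h1 := congrArg (fun g : F3 => ((g : (Cl 0 3)ˣ) : Cl 0 3)) h
  simp only [Subgroup.coe_mul, Units.val_mul, coe_F3gen] at h1
  rw [mono_mul_mono_comm] at h1
  obtain ⟨u, hu⟩ := exists_mono_mul_mono (p := 0) (q := 3) {1} {0}
  rw [hu, smul_smul, ← Units.val_mul] at h1
  have h2 := mul_eq_right.1 (mono_injective_up_to_sign h1).2
  exact absurd h2 (by decide)

theorem quaternionicConclusion_of_mulEquiv {G : Type} [Group G] {k : ℕ} (hk : 1 ≤ k)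
    (e : G ≃* F3 × Multiplicative (Fin (k - 1) → ZMod 2)) : QuaternionicConclusion k G := by
  -- Indices `0, 1, 2` carry the generators of `F₃`, the other `k - 1` the coordinate vectors,
  -- whence the shift by `3`.
  let g : Fin (k + 2) → F3 × Multiplicative (Fin (k - 1) → ZMod 2) := fun i =>
    if h : (i : ℕ) < 3 then (F3gen ⟨i, h⟩, 1)
    else (1, Multiplicative.ofAdd (Pi.single ⟨i - 3, by omega⟩ 1))
  have hg1 : ∀ (i : Fin (k + 2)) (h : (i : ℕ) < 3), g i = (F3gen ⟨i, h⟩, 1) := fun i h => dif_pos h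
  have hg2 : ∀ (i : Fin (k + 2)) (h : ¬ (i : ℕ) < 3),
      g i = (1, Multiplicative.ofAdd (Pi.single ⟨i - 3, by omega⟩ 1)) := fun i h => dif_neg h
  have hord : ∀ i, orderOf (g i) = if (i : ℕ) < 3 then 4 else 2 := by
    intro i
    split_ifs with h
    · rw [hg1 i h, Prod.orderOf, orderOf_F3gen, orderOf_one]; rfl
    · rw [hg2 i h, Prod.orderOf, orderOf_single, orderOf_one]; rfl
  have hinj : Function.Injective g := by
    intro i j hij
    by_cases hi : (i : ℕ) < 3 <;> by_cases hj : (j : ℕ) < 3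
    · rw [hg1 i hi, hg1 j hj] at hij
      have := F3gen_injective (congrArg Prod.fst hij)
      exact Fin.ext (Fin.mk.inj_iff.1 this)
    · have := (hord i).symm.trans ((congrArg orderOf hij).trans (hord j))
      simp [hi, hj] at this
    · have := (hord i).symm.trans ((congrArg orderOf hij).trans (hord j))
      simp [hi, hj] at this
    · rw [hg2 i hi, hg2 j hj] at hij
      have h1 := Multiplicative.ofAdd.injective (Prod.mk.inj hij).2
      by_contra hne
      have h2 := congrFun h1 ⟨i - 3, by omega⟩
      rw [Pi.single_eq_same, Pi.single_eq_of_ne] at h2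
      · exact one_ne_zero h2
      · intro h3
        have := congrArg Fin.val h3
        simp only at this
        exact hne (Fin.ext (by omega))
  have hclos : Subgroup.closure (Set.range g) = ⊤ := by
    rw [eq_top_iff]
    rintro ⟨⟨a, ha⟩, v⟩ -
    have h1 : ∀ (x : (Cl 0 3)ˣ) (hx : x ∈ F3),
        ((⟨x, hx⟩ : F3), (1 : Multiplicative (Fin (k - 1) → ZMod 2))) ∈
          Subgroup.closure (Set.range g) := by
      intro x hx
      unfold F3 at hx
      induction hx using Subgroup.closure_induction with
      | mem x hx =>
        obtain ⟨i, hi⟩ := hx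
        refine Subgroup.subset_closure ⟨⟨i, by omega⟩, ?_⟩
        rw [hg1 _ (by exact i.2)]
        refine Prod.ext (Subtype.ext (Units.ext ?_)) rfl
        rw [coe_F3gen, hi, mono_singleton]
      | one => exact Subgroup.one_mem _
      | mul x y hx hy h1 h2 =>
        have := Subgroup.mul_mem _ h1 h2
        rwa [Prod.mk_mul_mk, mul_one] at this
      | inv x hx h1 =>
        have := Subgroup.inv_mem _ h1
        rwa [Prod.inv_mk, inv_one] at this
    have h2 : (⊤ : Subgroup (Multiplicative (Fin (k - 1) → ZMod 2))) ≤
        (Subgroup.closure (Set.range g)).comap (MonoidHom.inr F3 _) := by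
      rw [← closure_range_single, Subgroup.closure_le]
      rintro _ ⟨i, rfl⟩
      refine Subgroup.subset_closure ⟨⟨i + 3, by omega⟩, ?_⟩
      rw [hg2 _ (by simp)]
      simp
    have h3 := Subgroup.mul_mem _ (h1 a ha) (h2 (Subgroup.mem_top v))
    simpa using h3
  refine ⟨fun h => ?_, ⟨fun i => e.symm (g i), e.symm.injective.comp hinj, ?_, fun i => ?_⟩, ⟨e⟩⟩
  · have h1 := congrArg e (h (e.symm (F3gen 0, 1)) (e.symm (F3gen 1, 1)))
    simp only [map_mul, MulEquiv.apply_symm_apply] at h1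
    exact F3_nonabelian (congrArg Prod.fst h1)
  · have h1 := congrArg (Subgroup.map e.symm.toMonoidHom) hclos
    rw [MonoidHom.map_closure, ← Set.range_comp, ← MonoidHom.range_eq_map,
      MonoidHom.range_eq_top.2 e.symm.surjective] at h1
    exact h1
  · rw [MulEquiv.orderOf_eq, hord]

/-- One of the `k` factors of order two is moved to the quaternion group, since `F₃` is the product
of these two. -/
theorem quaternionicConclusion_stab {p q k : ℕ} {T : Fin k → Finset (Fin (p + q))}
    {ε : Fin k → ℤˣ} (hn : p + q = 2 * k + 1) (hk : 1 ≤ k) (hsum : sqSum p q = -2 ^ (k + 1))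
    (hsq : sqSign (Finset.univ : Finset (Fin (p + q))) = 1) (hT : Admissible T)
    (hp : IsPrimitiveIdempotent (idem T ε)) : QuaternionicConclusion k (stab (idem T ε)) := by
  obtain ⟨e⟩ := nonempty_stab_mulEquiv hn hsum hsq hT hp
  obtain ⟨e₃⟩ := nonempty_F3_mulEquiv
  obtain ⟨m, rfl⟩ := Nat.exists_eq_add_of_le' hk
  exact quaternionicConclusion_of_mulEquiv hk (e.trans
    (((MulEquiv.refl _).prodCongr (finConsMulEquiv m)).trans
      (MulEquiv.prodAssoc.symm.trans (e₃.symm.prodCongr (MulEquiv.refl _)))))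

end CliffordVee

-- The two residues of `p - q` modulo `8`, and the tables

open CliffordVee

theorem mainTheorem3 :
    (∀ (p q k : ℕ) (_ : ((p : ℤ) - q) % 4 = 1) (_ : p + q ≤ 9)
      (T : Fin k → Finset (Fin (p + q))) (ε : Fin k → ℤˣ)
      (_ : IsCommutingFamily T) (_ : IsPrimitiveIdempotent (idem T ε)),
      CommonConclusion T ε ∧
      (((p : ℤ) - q) % 8 = 1 → RealConclusion k (stab (idem T ε))) ∧
      (((p : ℤ) - q) % 8 = 5 → QuaternionicConclusion k (stab (idem T ε)))) ∧
    (∀ r ∈ realTable,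
      IsCommutingFamily r.family ∧ IsPrimitiveIdempotent r.f ∧
      stab r.f = Subgroup.closure {g : veeGroup r.p r.q | ((g : (Cl r.p r.q)ˣ) : Cl r.p r.q) = -1 ∨
        ∃ l ∈ r.gens, ((g : (Cl r.p r.q)ˣ) : Cl r.p r.q) = mono r.p r.q (idx (r.p + r.q) l.1)} ∧
      orderOf (-1 : Cl r.p r.q) = 2 ∧
      ∀ l ∈ r.gens, orderOf (mono r.p r.q (idx (r.p + r.q) l.1)) = l.2) ∧
    (∀ r ∈ quaternionicTable,
      IsCommutingFamily r.family ∧ IsPrimitiveIdempotent r.f ∧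
      stab r.f = Subgroup.closure {g : veeGroup r.p r.q |
        ∃ l ∈ r.gens, ((g : (Cl r.p r.q)ˣ) : Cl r.p r.q) = mono r.p r.q (idx (r.p + r.q) l.1)} ∧
      ∀ l ∈ r.gens, orderOf (mono r.p r.q (idx (r.p + r.q) l.1)) = l.2) := by
  refine ⟨fun p q k hpq hn T ε hT hp => ?_, realTable_conclusion, quaternionicTable_conclusion⟩
  have hsq := sqSign_univ hpq hn
  have hA := hT.admissible
  refine ⟨?_, fun h => ?_, fun h => ?_⟩
  · have hodd : Odd (p + q) := by rw [Nat.odd_iff]; omega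
    have h8 : ((p : ℤ) - q) % 8 = 1 ∨ ((p : ℤ) - q) % 8 = 5 := by omega
    rcases h8 with h | h
    · obtain ⟨h1, h2⟩ := real_numerics h hn hT.length
      exact commonConclusion (by omega) hodd hn hpq hT hp (card_real h1 h2 hA hp hsq).1
    · obtain ⟨h1, h2, h3⟩ := quaternionic_numerics h hn hT.length
      exact commonConclusion h2 hodd hn hpq hT hp (card_quaternionic h1 h3 hA hp hsq).1
  · obtain ⟨h1, h2⟩ := real_numerics h hn hT.length
    exact realConclusion_stab h1 h2 hsq hA hp
  · obtain ⟨h1, h2, h3⟩ := quaternionic_numerics h hn hT.length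
    exact quaternionicConclusion_stab h1 h2 h3 hsq hA hp
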